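/- An instance of the super-stable matching problem is a finite bipartite graph $G=(A\cup B,E)$ (men $A$, women $B$) in which the adjacency list of every vertex is a linearly ordered list of disjoint nonempty ties. Let $n=|A|+|B|$ and $m=|E|$, and assume $m\ge 1$. A vertex weakly prefers $y$ to $y'$ if the tie of $y$ is not after the tie of $y'$ in its list. A matching $M\subseteq E$ (a set of disjoint edges) is super-stable if no edge of $E\setminus M$ blocks it, where $(x,y)\in E\setminus M$ blocks $M$ if $x$ is unmatched or weakly prefers $y$ to $M(x)$, and $y$ is unmatched or weakly prefers $x$ to $M(y)$. Let $\mathcal M_G$ be the set of super-stable matchings. $M$ dominates $N$ if every man weakly prefers $M(a)$ to $N(a)$ (being unmatched is worst). The $P$-set $P(M)$ is the set of all $(a,b)\in E$ such that $b=M(a)$, or $a$ weakly prefers $b$ to $M(a)$, or $a$ is unmatched in $M$. A matching $M\in\mathcal M_G$ is irreducible if, for some edge $e$, $P(M)$ is the inclusion-least set containing $e$ among the sets $P(N)$, $N\in\mathcal M_G$. Let $I(\mathcal M_G)$ be the set of irreducible super-stable matchings, ordered by $M\le N\iff P(M)\subseteq P(N)$. **Theorem.** 1. The poset $(I(\mathcal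 M_G),\le)$ can be constructed in $O(nm^2)$ time: there is one program for a word RAM with words of $O(\log(n+m))$ bits which, given the adjacency lists (with ties) of any instance with $m\ge1$, halts within $C\,nm^2$ steps, $C$ an absolute constant, and outputs every irreducible super-stable matching exactly once, together with the table of the relation $\le$ between them. 2. For every instance with $m\ge 1$: - $I(\mathcal M_G)$ consists exactly of the man-optimal super-stable $(a,b)$-matchings, $(a,b)\in E$, where a man-optimal super-stable $(a,b)$-matching is a super-stable matching containing $(a,b)$ that dominates all super-stable matchings containing $(a,b)$. For each edge contained in some super-stable matching there is exactly one such matching. - $M\mapsto P(M)$ is injective on $\mathcal M_G$, and for $M,N\in\mathcal M_G$, $P(M)\subseteq P(N)$ if and only if $M$ dominates $N$. - (Birkhoff) $S\mapsto\bigcup_{M\in S}P(M)$ is a bijection from the nonempty closed subsets $S$ of $I(\mathcal M_G)$ (closed: $M\in S$, $N\in I(\mathcal M_G)$, $N\le M$ imply $N\in S$) onto $\{P(M):M\in\mathcal M_G\}$, and $\bigcup_{M\in S}P(M)\subseteq\bigcup_{M\in S'}P(M)$ if and only if $S\subseteq S'$ for any two such subsets $S,S'$. -/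

import Mathlib

/-! ### Instances of the super-stable matching problem -/

/-- A bipartite graph on men and women in which every vertex carries its adjacency list as a
linearly ordered list (most preferred first) of disjoint nonempty ties. -/
structure SMInstance where
  numMen : ℕ
  numWomen : ℕ
  menPref : Fin numMen → List (List (Fin numWomen))
  womenPref : Fin numWomen → List (List (Fin numMen))
  menPref_nodup : ∀ a, (menPref a).flatten.Nodup
  womenPref_nodup : ∀ b, (womenPref b).flatten.Nodup
  menPref_ne : ∀ a, [] ∉ menPref a
  womenPref_ne : ∀ b, [] ∉ womenPref b
  mutual_adj : ∀ a b, b ∈ (menPref a).flatten ↔ a ∈ (womenPref b).flatten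

namespace SMInstance

/-- Man-woman pairs. -/
abbrev Pair (G : SMInstance) : Type := Fin G.numMen × Fin G.numWomen

/-- The edge set (the acceptable pairs). -/
def edges (G : SMInstance) : Finset G.Pair :=
  Finset.univ.filter (fun e => e.2 ∈ (G.menPref e.1).flatten)

/-- The number of vertices. -/
def nVerts (G : SMInstance) : ℕ := G.numMen + G.numWomen

/-- The number of edges. -/
def nEdges (G : SMInstance) : ℕ := G.edges.card

/-- The position of the tie of `b` in the list of the man `a`. -/
def manRank (G : SMInstance) (a : Fin G.numMen) (b : Fin G.numWomen) : ℕ :=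
  (G.menPref a).findIdx (fun t => decide (b ∈ t))

/-- The position of the tie of `a` in the list of the woman `b`. -/
def womanRank (G : SMInstance) (b : Fin G.numWomen) (a : Fin G.numMen) : ℕ :=
  (G.womenPref b).findIdx (fun t => decide (a ∈ t))

/-- For neighbours `b`, `b'` of the man `a`: `a` weakly prefers `b` to `b'`. -/
def ManWeak (G : SMInstance) (a : Fin G.numMen) (b b' : Fin G.numWomen) : Prop :=
  G.manRank a b ≤ G.manRank a b'

/-- For neighbours `a`, `a'` of the woman `b`: `b` weakly prefers `a` to `a'`. -/
def WomanWeak (G : SMInstance) (b : Fin G.numWomen) (a a' : Fin G.numMen) : Prop :=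
  G.womanRank b a ≤ G.womanRank b a'

/-- A matching: a set of pairwise disjoint edges. -/
def IsMatching (G : SMInstance) (M : Finset G.Pair) : Prop :=
  M ⊆ G.edges ∧ ∀ e ∈ M, ∀ f ∈ M, (e.1 = f.1 ∨ e.2 = f.2) → e = f

/-- `e` blocks `M`: it is an edge outside `M`, and each endpoint is unmatched in `M` or weakly
prefers the other endpoint to its partner in `M`. -/
def Blocks (G : SMInstance) (e : G.Pair) (M : Finset G.Pair) : Prop :=
  e ∈ G.edges ∧ e ∉ M ∧
    (∀ b, (e.1, b) ∈ M → G.ManWeak e.1 e.2 b) ∧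
    (∀ a, (a, e.2) ∈ M → G.WomanWeak e.2 e.1 a)

/-- The set of all super-stable matchings. -/
def superStable (G : SMInstance) : Set (Finset G.Pair) :=
  {M | G.IsMatching M ∧ ∀ e, ¬ G.Blocks e M}

/-- `M` dominates `N`: every man weakly prefers his partner in `M` to his partner in `N`, being
unmatched counting as worse than any neighbour. -/
def Dominates (G : SMInstance) (M N : Finset G.Pair) : Prop :=
  ∀ a b', (a, b') ∈ N → ∃ b, (a, b) ∈ M ∧ G.ManWeak a b b'

/-- `M` is a man-optimal super-stable `e`-matching: a super-stable matching containing `e` that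
dominates every super-stable matching containing `e`. -/
def IsManOptimalWith (G : SMInstance) (e : G.Pair) (M : Finset G.Pair) : Prop :=
  (M ∈ G.superStable ∧ e ∈ M) ∧ ∀ N ∈ G.superStable, e ∈ N → G.Dominates M N

/-- The `P`-set of `M`: all edges `(a, b)` such that `b` is the partner of `a` in `M` or `a` weakly
prefers `b` to that partner (every edge at `a` if `a` is unmatched). -/
def pSet (G : SMInstance) (M : Finset G.Pair) : Set G.Pair :=
  {e | e ∈ G.edges ∧ ∀ b, (e.1, b) ∈ M → G.ManWeak e.1 e.2 b}

end SMInstance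

/-- `X` is an irreducible member of a family `F` of sets: for some element `x`, it is the
inclusion-least member of `F` that contains `x`. -/
def IrreducibleMember {α : Type*} (F : Set (Set α)) (X : Set α) : Prop :=
  ∃ x, IsLeast {Y | Y ∈ F ∧ x ∈ Y} X

namespace SMInstance

/-- The set of irreducible super-stable matchings. It is ordered by inclusion of `P`-sets. -/
def irreducibles (G : SMInstance) : Set (Finset G.Pair) :=
  {M | M ∈ G.superStable ∧ IrreducibleMember (G.pSet '' G.superStable) (G.pSet M)}

/-- Closed subsets (lower sets) of the poset of irreducible super-stable matchings. -/
def IsClosedSubset (G : SMInstance) (S : Set (Finset G.Pair)) : Prop :=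
  S ⊆ G.irreducibles ∧
    ∀ M ∈ S, ∀ N ∈ G.irreducibles, G.pSet N ⊆ G.pSet M → N ∈ S

/-- The set of edges generated by a set of matchings: the union of their `P`-sets. -/
def generated (G : SMInstance) (S : Set (Finset G.Pair)) : Set G.Pair :=
  ⋃ M ∈ S, G.pSet M

end SMInstance

/-! ### The machine model: structured programs of a word RAM

Words have `w` bits, memory consists of registers and of arrays of words. A program mentions only
finitely many registers and arrays. Every elementary operation (reading a constant, a register or
an array cell, one arithmetic operation or comparison, one write, one test) costs one step. -/

namespace WordRAM

structure State where
  reg : ℕ → ℕ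
  arr : ℕ → ℕ → ℕ

inductive Expr where
  | const (k : ℕ)
  | var (x : ℕ)
  | read (A : ℕ) (i : Expr)
  | add (e f : Expr)
  | sub (e f : Expr)
  | mul (e f : Expr)
  | lt (e f : Expr)
  | eq (e f : Expr)

namespace Expr

/-- Value of an expression; arithmetic is modulo `2 ^ w`, subtraction is truncated at `0`, and
comparisons return `1` or `0`. -/
def eval (w : ℕ) (s : State) : Expr → ℕ
  | const k => k % 2 ^ w
  | var x => s.reg x
  | read A i => s.arr A (i.eval w s)
  | add e f => (e.eval w s + f.eval w s) % 2 ^ w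
  | sub e f => e.eval w s - f.eval w s
  | mul e f => (e.eval w s * f.eval w s) % 2 ^ w
  | lt e f => if e.eval w s < f.eval w s then 1 else 0
  | eq e f => if e.eval w s = f.eval w s then 1 else 0

/-- Number of elementary operations in the evaluation of an expression. -/
def cost : Expr → ℕ
  | const _ => 1
  | var _ => 1
  | read _ i => i.cost + 1
  | add e f => e.cost + f.cost + 1
  | sub e f => e.cost + f.cost + 1
  | mul e f => e.cost + f.cost + 1
  | lt e f => e.cost + f.cost + 1
  | eq e f => e.cost + f.cost + 1

end Expr

inductive Prog where
  | skip
  | assign (x : ℕ) (e : Expr)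
  | write (A : ℕ) (i e : Expr)
  | seq (p q : Prog)
  | ite (e : Expr) (p q : Prog)
  | loop (e : Expr) (p : Prog)

def State.setReg (s : State) (x v : ℕ) : State :=
  { s with reg := Function.update s.reg x v }

def State.setArr (s : State) (A i v : ℕ) : State :=
  { s with arr := Function.update s.arr A (Function.update (s.arr A) i v) }

/-- `Exec w p s t s'`: with `w`-bit words, the program `p` started in the state `s` halts after
exactly `t` steps in the state `s'`. -/
inductive Exec (w : ℕ) : Prog → State → ℕ → State → Prop where
  | skip (s : State) : Exec w Prog.skip s 1 s
  | assign (x : ℕ) (e : Expr) (s : State) :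
      Exec w (Prog.assign x e) s (e.cost + 1) (s.setReg x (e.eval w s))
  | write (A : ℕ) (i e : Expr) (s : State) :
      Exec w (Prog.write A i e) s (i.cost + e.cost + 1) (s.setArr A (i.eval w s) (e.eval w s))
  | seq {p q : Prog} {s s' s'' : State} {t t' : ℕ}
      (hp : Exec w p s t s') (hq : Exec w q s' t' s'') :
      Exec w (Prog.seq p q) s (t + t') s''
  | ite_true {e : Expr} {p q : Prog} {s s' : State} {t : ℕ}
      (he : e.eval w s ≠ 0) (hp : Exec w p s t s') :
      Exec w (Prog.ite e p q) s (e.cost + 1 + t) s'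
  | ite_false {e : Expr} {p q : Prog} {s s' : State} {t : ℕ}
      (he : e.eval w s = 0) (hq : Exec w q s t s') :
      Exec w (Prog.ite e p q) s (e.cost + 1 + t) s'
  | loop_stop {e : Expr} {p : Prog} {s : State} (he : e.eval w s = 0) :
      Exec w (Prog.loop e p) s (e.cost + 1) s
  | loop_step {e : Expr} {p : Prog} {s s' s'' : State} {t t' : ℕ}
      (he : e.eval w s ≠ 0) (hp : Exec w p s t s') (hl : Exec w (Prog.loop e p) s' t' s'') :
      Exec w (Prog.loop e p) s (e.cost + 1 + t + t') s''

end WordRAM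

/-! ### Input and output conventions -/

namespace SMInstance

/-- The adjacency list of a vertex with ties marked: the neighbours in list order, each with the
number (counted from `0`) of its tie. -/
def flatAdj {k : ℕ} (l : List (List (Fin k))) : List (ℕ × ℕ) :=
  l.zipIdx.flatMap (fun p => p.1.map (fun v => ((v : ℕ), p.2)))

/-- The adjacency lists of all vertices of one side, concatenated. -/
def allAdj {j k : ℕ} (pref : Fin j → List (List (Fin k))) : List (ℕ × ℕ) :=
  (List.finRange j).flatMap (fun v => flatAdj (pref v))

/-- The place in `allAdj` where the adjacency list of the vertex number `i` starts (for `i = j`: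
the total length). -/
def adjStart {j k : ℕ} (pref : Fin j → List (List (Fin k))) (i : ℕ) : ℕ :=
  (((List.finRange j).take i).map (fun v => (flatAdj (pref v)).length)).sum

/-- The input: the numbers of men and of women in registers 0 and 1. Arrays 0, 1, 2 hold the
adjacency lists of the men: start positions, neighbours, tie numbers. Arrays 3, 4, 5 hold those of
the women in the same way. All else is 0. -/
def input (G : SMInstance) : WordRAM.State where
  reg x := match x with
    | 0 => G.numMen
    | 1 => G.numWomen
    | _ => 0
  arr A i := match A with
    | 0 => if i ≤ G.numMen then adjStart G.menPref i else 0
    | 1 => ((allAdj G.menPref).getD i (0, 0)).1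
    | 2 => ((allAdj G.menPref).getD i (0, 0)).2
    | 3 => if i ≤ G.numWomen then adjStart G.womenPref i else 0
    | 4 => ((allAdj G.womenPref).getD i (0, 0)).1
    | 5 => ((allAdj G.womenPref).getD i (0, 0)).2
    | _ => 0

/-- The final state `s` holds the poset of irreducible super-stable matchings: register 2 holds
their number `k`; for some enumeration `L` of them without repetition, array 6 holds at place
`i * numMen + a` the partner of the man `a` in `L i` (`b + 1` for the woman `b`, and `0` if `a` is
unmatched), and array 7 holds at place `i * k + j` the truth value of `L i ≤ L j`. -/
def OutputsPoset (G : SMInstance) (s : WordRAM.State) : Prop :=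
  ∃ (k : ℕ) (L : Fin k → Finset G.Pair),
    Function.Injective L ∧ Set.range L = G.irreducibles ∧
    s.reg 2 = k ∧
    (∀ (i : Fin k) (a : Fin G.numMen),
      (∀ b : Fin G.numWomen, (a, b) ∈ L i → s.arr 6 (i * G.numMen + a) = b + 1) ∧
      ((∀ b : Fin G.numWomen, (a, b) ∉ L i) → s.arr 6 (i * G.numMen + a) = 0)) ∧
    (∀ i j : Fin k,
      (G.pSet (L i) ⊆ G.pSet (L j) → s.arr 7 (i * k + j) = 1) ∧
      (¬ G.pSet (L i) ⊆ G.pSet (L j) → s.arr 7 (i * k + j) = 0))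

end SMInstance

namespace SMInstance

variable {G : SMInstance}

/-! Structure. Since ties count as blocking, an edge outside a super-stable matching is strictly
beaten at one of its ends (`exists_better`). For super-stable `M` and `N`, a man strictly better off
in `M` therefore has an `M`-partner strictly better off in `N`, whose `N`-partner is in turn
strictly better off in `M`. Both steps are injective, so by counting they are onto
(`image_fst_better`, `image_snd_better`). Hence all super-stable matchings match the same men, no
man is indifferent between two distinct super-stable partners, and giving every man the worse of two
partners yields a super-stable matching `join M N`. Its `P`-set is the union of the two `P`-sets. So
`P` is injective, inclusion is dominance, and the `P`-sets form a finite family closed under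
nonempty unions.

Least members. For an edge `e₀`, a proposal process determines the least `P`-set containing `e₀`. A
counter `r a` records how many ties the man `a` has tried, and a woman retains a proposal only if it
is her unique best one. A man without a retained proposal in his current tie, or one who is the man
of `e₀` and has not yet reached its tie, moves on. No admissible super-stable matching is ever
skipped (`lowerBound_update`). At a fixpoint a selection of retained proposals is super-stable if
every woman with a proposal is matched, and this condition holds whenever an admissible matching
exists (`IsSelection.covers`). This proves existence of least members and at the same time decides
whether there is one.

Birkhoff. Every `P`-set is the union of the least `P`-sets of its elements. An edge whose least
`P`-set is `P(M)` witnesses that `P(M)` is contained in a union only if it is contained in one of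
its terms. This gives the bijection with nonempty closed subsets.

Time. The counters are bounded by the degrees, which sum to `m`, so one search takes at most `m`
advancing rounds of `O(n)` steps. There are `m` searches. Comparing each result with the rows
already stored costs `O(nm)`, and the order table costs `O(nm²)`. The program is verified by a small
logic of step-bounded runs with syntactic frame conditions and an invariant rule for counting loops
(`Run.forUp`). -/

/-- The rank of an edge at its man. -/
def mRank (G : SMInstance) (e : G.Pair) : ℕ := G.manRank e.1 e.2

/-- The rank of an edge at its woman. -/
def wRank (G : SMInstance) (e : G.Pair) : ℕ := G.womanRank e.2 e.1

theorem mem_pSet {M : Finset G.Pair} {e : G.Pair} :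
    e ∈ G.pSet M ↔ e ∈ G.edges ∧ ∀ f ∈ M, f.1 = e.1 → G.mRank e ≤ G.mRank f := by
  refine and_congr_right fun _ => ⟨?_, fun h b hb => h _ hb rfl⟩
  rintro h ⟨a, b⟩ hf rfl
  exact h b hf

theorem dominates_iff {M N : Finset G.Pair} :
    G.Dominates M N ↔ ∀ e ∈ N, ∃ f ∈ M, f.1 = e.1 ∧ G.mRank f ≤ G.mRank e := by
  constructor
  · rintro h ⟨a, b'⟩ he
    obtain ⟨b, hb, hr⟩ := h a b' he
    exact ⟨(a, b), hb, rfl, hr⟩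
  · intro h a b' he
    obtain ⟨⟨_, b⟩, hb, rfl, hr⟩ := h _ he
    exact ⟨b, hb, hr⟩

theorem blocks_iff {M : Finset G.Pair} {e : G.Pair} :
    G.Blocks e M ↔ e ∈ G.edges ∧ e ∉ M ∧ (∀ f ∈ M, f.1 = e.1 → G.mRank e ≤ G.mRank f) ∧
      ∀ f ∈ M, f.2 = e.2 → G.wRank e ≤ G.wRank f := by
  refine and_congr_right fun _ => and_congr_right fun _ => and_congr ?_ ?_
  · refine ⟨?_, fun h b hb => h _ hb rfl⟩
    rintro h ⟨a, b⟩ hf rfl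
    exact h b hf
  · refine ⟨?_, fun h b hb => h _ hb rfl⟩
    rintro h ⟨a, b⟩ hf rfl
    exact h a hf

/-! ### Comparing two super-stable matchings, and their join -/

section Lattice

variable {M N : Finset G.Pair}

theorem subset_edges (hM : M ∈ G.superStable) {e : G.Pair} (he : e ∈ M) : e ∈ G.edges :=
  hM.1.1 he

theorem eq_of_fst (hM : M ∈ G.superStable) {e f : G.Pair} (he : e ∈ M) (hf : f ∈ M)
    (h : e.1 = f.1) : e = f :=
  hM.1.2 e he f hf (Or.inl h)

theorem eq_of_snd (hM : M ∈ G.superStable) {e f : G.Pair} (he : e ∈ M) (hf : f ∈ M)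
    (h : e.2 = f.2) : e = f :=
  hM.1.2 e he f hf (Or.inr h)

/-- The negation of blocking. Strictness at one end is what super-stability gains over weaker
notions, and everything below rests on it. -/
theorem exists_better (hM : M ∈ G.superStable) {e : G.Pair} (he : e ∈ G.edges) (heM : e ∉ M) :
    (∃ f ∈ M, f.1 = e.1 ∧ G.mRank f < G.mRank e) ∨
      ∃ f ∈ M, f.2 = e.2 ∧ G.wRank f < G.wRank e := by
  have h := hM.2 e
  rw [blocks_iff] at h
  by_contra hcon
  push Not at hcon
  exact h ⟨he, heM, hcon.1, hcon.2⟩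

theorem injOn_fst (hM : M ∈ G.superStable) : Set.InjOn Prod.fst (M : Set G.Pair) :=
  fun _ he _ hf h => eq_of_fst hM he hf h

theorem injOn_snd (hM : M ∈ G.superStable) : Set.InjOn Prod.snd (M : Set G.Pair) :=
  fun _ he _ hf h => eq_of_snd hM he hf h

open scoped Classical in
/-- The edges of `M` whose man strictly prefers `M` to `N`. -/
noncomputable def manBetter (M N : Finset G.Pair) : Finset G.Pair :=
  M.filter fun e => ∀ f ∈ N, f.1 = e.1 → G.mRank e < G.mRank f

open scoped Classical in
/-- The edges of `M` whose woman strictly prefers `M` to `N`. -/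
noncomputable def womanBetter (M N : Finset G.Pair) : Finset G.Pair :=
  M.filter fun e => ∀ f ∈ N, f.2 = e.2 → G.wRank e < G.wRank f

/-- An edge of `M` that its man strictly prefers to `N` is not in `N`, so it must be beaten in `N`
at its woman. The next lemma is the same argument started from the women of `N`. -/
theorem image_snd_manBetter_subset (hM : M ∈ G.superStable) (hN : N ∈ G.superStable) :
    (manBetter M N).image Prod.snd ⊆ (womanBetter N M).image Prod.snd := by
  classical
  intro b hb
  obtain ⟨e, he, rfl⟩ := Finset.mem_image.1 hb
  obtain ⟨heM, hX⟩ := Finset.mem_filter.1 he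
  have heN : e ∉ N := fun h => lt_irrefl _ (hX e h rfl)
  rcases exists_better hN (subset_edges hM heM) heN with ⟨f, hf, h1, h2⟩ | ⟨f, hf, h1, h2⟩
  · exact absurd (hX f hf h1) h2.not_gt
  · refine Finset.mem_image.2 ⟨f, Finset.mem_filter.2 ⟨hf, fun g hg hgf => ?_⟩, h1⟩
    rwa [eq_of_snd hM hg heM (hgf.trans h1)]

theorem image_fst_womanBetter_subset (hM : M ∈ G.superStable) (hN : N ∈ G.superStable) :
    (womanBetter N M).image Prod.fst ⊆ (manBetter M N).image Prod.fst := by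
  classical
  intro b hb
  obtain ⟨e, he, rfl⟩ := Finset.mem_image.1 hb
  obtain ⟨heN, hX⟩ := Finset.mem_filter.1 he
  have heM : e ∉ M := fun h => lt_irrefl _ (hX e h rfl)
  rcases exists_better hM (subset_edges hN heN) heM with ⟨f, hf, h1, h2⟩ | ⟨f, hf, h1, h2⟩
  · refine Finset.mem_image.2 ⟨f, Finset.mem_filter.2 ⟨hf, fun g hg hgf => ?_⟩, h1⟩
    rwa [eq_of_fst hN hg heN (hgf.trans h1)]
  · exact absurd (hX f hf h1) h2.not_gt

theorem card_image_better (hM : M ∈ G.superStable) (hN : N ∈ G.superStable) :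
    ((manBetter M N).image Prod.snd).card = (manBetter M N).card ∧
    ((manBetter M N).image Prod.fst).card = (manBetter M N).card ∧
    ((womanBetter N M).image Prod.snd).card = (womanBetter N M).card ∧
    ((womanBetter N M).image Prod.fst).card = (womanBetter N M).card := by
  classical
  have h1 : ((manBetter M N : Finset G.Pair) : Set G.Pair) ⊆ M :=
    fun _ h => Finset.mem_of_mem_filter _ h
  have h2 : ((womanBetter N M : Finset G.Pair) : Set G.Pair) ⊆ N :=
    fun _ h => Finset.mem_of_mem_filter _ h
  exact ⟨Finset.card_image_of_injOn ((injOn_snd hM).mono h1),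
    Finset.card_image_of_injOn ((injOn_fst hM).mono h1),
    Finset.card_image_of_injOn ((injOn_snd hN).mono h2),
    Finset.card_image_of_injOn ((injOn_fst hN).mono h2)⟩

/-- The two inclusions give `|manBetter M N| ≤ |womanBetter N M| ≤ |manBetter M N|`, because
projections are injective on matchings. Equal cardinalities turn the inclusions into equalities. -/
theorem image_fst_better (hM : M ∈ G.superStable) (hN : N ∈ G.superStable) :
    (womanBetter N M).image Prod.fst = (manBetter M N).image Prod.fst := by
  have h1 := Finset.card_le_card (image_snd_manBetter_subset hM hN)
  have h2 := Finset.card_le_card (image_fst_womanBetter_subset hM hN)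
  obtain ⟨c1, c2, c3, c4⟩ := card_image_better hM hN
  exact Finset.eq_of_subset_of_card_le (image_fst_womanBetter_subset hM hN) (by omega)

theorem image_snd_better (hM : M ∈ G.superStable) (hN : N ∈ G.superStable) :
    (manBetter M N).image Prod.snd = (womanBetter N M).image Prod.snd := by
  have h1 := Finset.card_le_card (image_snd_manBetter_subset hM hN)
  have h2 := Finset.card_le_card (image_fst_womanBetter_subset hM hN)
  obtain ⟨c1, c2, c3, c4⟩ := card_image_better hM hN
  exact Finset.eq_of_subset_of_card_le (image_snd_manBetter_subset hM hN) (by omega)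

theorem exists_womanBetter_of_manBetter (hM : M ∈ G.superStable) (hN : N ∈ G.superStable)
    {e : G.Pair} (he : e ∈ manBetter M N) : ∃ f ∈ womanBetter N M, f.1 = e.1 := by
  have := Finset.mem_image_of_mem Prod.fst he
  rw [← image_fst_better hM hN] at this
  exact Finset.mem_image.1 this

theorem exists_manBetter_of_womanBetter (hM : M ∈ G.superStable) (hN : N ∈ G.superStable)
    {f : G.Pair} (hf : f ∈ womanBetter N M) : ∃ e ∈ manBetter M N, e.2 = f.2 := by
  have := Finset.mem_image_of_mem Prod.snd hf
  rw [← image_snd_better hM hN] at this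
  exact Finset.mem_image.1 this

/-- Super-stable matchings match the same men. -/
theorem exists_mem_fst (hM : M ∈ G.superStable) (hN : N ∈ G.superStable) {e : G.Pair}
    (he : e ∈ M) : ∃ f ∈ N, f.1 = e.1 := by
  classical
  by_contra! h
  -- A man unmatched in `N` belongs here vacuously, yet every man met here has an edge in
  -- `womanBetter N M ⊆ N`.
  have hX : e ∈ manBetter M N := Finset.mem_filter.2 ⟨he, fun f hf hfe => absurd hfe (h f hf)⟩
  obtain ⟨f, hf, hfe⟩ := exists_womanBetter_of_manBetter hM hN hX
  exact h f (Finset.mem_of_mem_filter _ hf) hfe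

theorem mem_manBetter (hN : N ∈ G.superStable) {e f : G.Pair}
    (he : e ∈ M) (hf : f ∈ N) (h : f.1 = e.1) (hlt : G.mRank e < G.mRank f) :
    e ∈ manBetter M N := by
  classical
  refine Finset.mem_filter.2 ⟨he, fun g hg hge => ?_⟩
  rwa [eq_of_fst hN hg hf (hge.trans h.symm)]

theorem mem_womanBetter (hN : N ∈ G.superStable) {e f : G.Pair}
    (he : e ∈ M) (hf : f ∈ N) (h : f.2 = e.2) (hlt : G.wRank e < G.wRank f) :
    e ∈ womanBetter M N := by
  classical
  refine Finset.mem_filter.2 ⟨he, fun g hg hge => ?_⟩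
  rwa [eq_of_snd hN hg hf (hge.trans h.symm)]

/-- No man is indifferent between distinct partners in super-stable matchings. -/
theorem eq_of_mRank_eq (hM : M ∈ G.superStable) (hN : N ∈ G.superStable) {e f : G.Pair}
    (he : e ∈ M) (hf : f ∈ N) (h : f.1 = e.1) (hr : G.mRank e = G.mRank f) : e = f := by
  classical
  by_contra hne
  have heN : e ∉ N := fun h' => hne (eq_of_fst hN h' hf h.symm)
  rcases exists_better hN (subset_edges hM he) heN with ⟨g, hg, h1, h2⟩ | ⟨g, hg, h1, h2⟩
  · rw [eq_of_fst hN hg hf (h1.trans h.symm)] at h2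
    omega
  -- The woman of `e` is strictly better off in `N`, so she is also the woman of an edge in
  -- `manBetter M N`. That edge is `e`, whose man would then strictly prefer it to `f`.
  · obtain ⟨e', he', h3⟩ :=
      exists_manBetter_of_womanBetter hM hN (mem_womanBetter hM hg he h1.symm h2)
    have := eq_of_snd hM (Finset.mem_of_mem_filter _ he') he (h3.trans h1)
    subst this
    exact (hr ▸ (Finset.mem_filter.1 he').2 f hf h).false

/-- A man strictly worse off in `M` than in `N` has a partner who is strictly better off in `M`. -/
theorem mem_womanBetter_of_lt (hM : M ∈ G.superStable) (hN : N ∈ G.superStable) {e f : G.Pair}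
    (he : e ∈ M) (hf : f ∈ N) (h : f.1 = e.1) (hlt : G.mRank f < G.mRank e) :
    e ∈ womanBetter M N := by
  classical
  obtain ⟨g, hg, h1⟩ :=
    exists_womanBetter_of_manBetter hN hM (mem_manBetter hM hf he h.symm hlt)
  rwa [← eq_of_fst hM (Finset.mem_of_mem_filter _ hg) he (h1.trans h)]

open scoped Classical in
/-- The matching that gives every man the worse of his partners in `M` and `N`. -/
noncomputable def join (M N : Finset G.Pair) : Finset G.Pair :=
  (M.filter fun e => ∀ f ∈ N, f.1 = e.1 → G.mRank f ≤ G.mRank e) ∪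
    (N.filter fun e => ∀ f ∈ M, f.1 = e.1 → G.mRank f ≤ G.mRank e)

theorem mem_join {e : G.Pair} : e ∈ join M N ↔
    (e ∈ M ∧ ∀ f ∈ N, f.1 = e.1 → G.mRank f ≤ G.mRank e) ∨
    (e ∈ N ∧ ∀ f ∈ M, f.1 = e.1 → G.mRank f ≤ G.mRank e) := by
  classical
  simp [join]

theorem join_comm (M N : Finset G.Pair) : join M N = join N M :=
  Finset.ext fun e => by rw [mem_join, mem_join, or_comm]

/-- If a woman were given distinct edges from `M` and `N`, both men would be strictly worse off with
them than in the other matching. She would then strictly prefer each edge to the other. -/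
theorem join_eq_aux (hM : M ∈ G.superStable) (hN : N ∈ G.superStable) {e f : G.Pair}
    (he : e ∈ M) (he' : ∀ f ∈ N, f.1 = e.1 → G.mRank f ≤ G.mRank e)
    (hf : f ∈ N) (hf' : ∀ e ∈ M, e.1 = f.1 → G.mRank e ≤ G.mRank f)
    (h : e.1 = f.1 ∨ e.2 = f.2) : e = f := by
  rcases h with h | h
  · exact eq_of_mRank_eq hM hN he hf h.symm (le_antisymm (hf' e he h) (he' f hf h.symm))
  · by_contra hne
    obtain ⟨f₁, hf₁, h₁⟩ := exists_mem_fst hM hN he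
    obtain ⟨e₁, he₁, h₂⟩ := exists_mem_fst hN hM hf
    have a₁ : f₁ ≠ e := by
      rintro rfl
      exact hne (eq_of_snd hN hf₁ hf h)
    have a₂ : e₁ ≠ f := by
      rintro rfl
      exact hne (eq_of_snd hM he he₁ h)
    have b₁ : G.mRank f₁ < G.mRank e := lt_of_le_of_ne (he' _ hf₁ h₁) fun hr =>
      a₁ (eq_of_mRank_eq hM hN he hf₁ h₁ hr.symm).symm
    have b₂ : G.mRank e₁ < G.mRank f := lt_of_le_of_ne (hf' _ he₁ h₂) fun hr =>
      a₂ (eq_of_mRank_eq hN hM hf he₁ h₂ hr.symm).symm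
    have c₁ := (Finset.mem_filter.1 (mem_womanBetter_of_lt hM hN he hf₁ h₁ b₁)).2 f hf h.symm
    have c₂ := (Finset.mem_filter.1 (mem_womanBetter_of_lt hN hM hf he₁ h₂ b₂)).2 e he h
    omega

theorem join_isMatching (hM : M ∈ G.superStable) (hN : N ∈ G.superStable) :
    G.IsMatching (join M N) := by
  constructor
  · intro e he
    rcases mem_join.1 he with h | h
    · exact subset_edges hM h.1
    · exact subset_edges hN h.1
  · intro e he f hf h
    rcases mem_join.1 he with ⟨he, he'⟩ | ⟨he, he'⟩ <;>
      rcases mem_join.1 hf with ⟨hf, hf'⟩ | ⟨hf, hf'⟩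
    · exact hM.1.2 e he f hf h
    · exact join_eq_aux hM hN he he' hf hf' h
    · exact join_eq_aux hN hM he he' hf hf' h
    · exact hN.1.2 e he f hf h

/-- The woman of `e` has a better edge `g` in `M`. If `join M N` drops `g`, then `g` lies in
`manBetter M N`, so she has a still better edge `k` in `N`. The man of `k` prefers `M`, hence `k` is
the worse of his two edges and survives in the join. -/
theorem join_not_blocks_aux (hM : M ∈ G.superStable) (hN : N ∈ G.superStable) {e : G.Pair}
    (he : e ∈ G.edges) (heM : e ∉ M) (hm : ∀ f ∈ M, f.1 = e.1 → G.mRank e ≤ G.mRank f) :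
    ∃ f ∈ join M N, f.2 = e.2 ∧ G.wRank f < G.wRank e := by
  classical
  rcases exists_better hM he heM with ⟨g, hg, h1, h2⟩ | ⟨g, hg, h1, h2⟩
  · exact absurd (hm g hg h1) h2.not_ge
  by_cases hgK : g ∈ join M N
  · exact ⟨g, hgK, h1, h2⟩
  have : ∃ f ∈ N, f.1 = g.1 ∧ G.mRank g < G.mRank f := by
    by_contra! hcon
    exact hgK (mem_join.2 (Or.inl ⟨hg, hcon⟩))
  obtain ⟨f, hf, h3, h4⟩ := this
  have hX := mem_manBetter hN hg hf h3 h4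
  have h5 := Finset.mem_image_of_mem Prod.snd hX
  rw [image_snd_better hM hN] at h5
  obtain ⟨k, hk, h6⟩ := Finset.mem_image.1 h5
  have h7 := Finset.mem_image_of_mem Prod.fst hk
  rw [image_fst_better hM hN] at h7
  obtain ⟨e', he', h8⟩ := Finset.mem_image.1 h7
  obtain ⟨hkN, hkw⟩ := Finset.mem_filter.1 hk
  obtain ⟨heM', hem'⟩ := Finset.mem_filter.1 he'
  refine ⟨k, mem_join.2 (Or.inr ⟨hkN, fun x hx hxk => ?_⟩), h6.trans h1,
    (hkw g hg h6.symm).trans h2⟩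
  rw [eq_of_fst hM hx heM' (hxk.trans h8.symm)]
  exact (hem' k hkN h8.symm).le

theorem join_mem_superStable (hM : M ∈ G.superStable) (hN : N ∈ G.superStable) :
    join M N ∈ G.superStable := by
  refine ⟨join_isMatching hM hN, fun e hb => ?_⟩
  rw [blocks_iff] at hb
  obtain ⟨he, heK, hm, hw⟩ := hb
  have key : ∃ f ∈ join M N, f.2 = e.2 ∧ G.wRank f < G.wRank e := by
    by_cases hex : ∃ e₁ ∈ M, e₁.1 = e.1
    · obtain ⟨e₁, he₁, h₁⟩ := hex
      obtain ⟨f₁, hf₁, h₂⟩ := exists_mem_fst hM hN he₁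
      -- The join gives the man one of `e₁`, `f₁`; the auxiliary lemma is applied to the matching
      -- that edge comes from.
      rcases le_total (G.mRank f₁) (G.mRank e₁) with hle | hle
      · have hK : e₁ ∈ join M N := mem_join.2 (Or.inl ⟨he₁, fun f hf h => by
          rwa [eq_of_fst hN hf hf₁ (h.trans h₂.symm)]⟩)
        refine join_not_blocks_aux hM hN he (fun h => heK ?_) fun f hf h => ?_
        · rwa [eq_of_fst hM h he₁ h₁.symm]
        · rw [eq_of_fst hM hf he₁ (h.trans h₁.symm)]
          exact hm _ hK h₁
      · have hK : f₁ ∈ join N M := mem_join.2 (Or.inl ⟨hf₁, fun f hf h => by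
          rwa [eq_of_fst hM hf he₁ (h.trans h₂)]⟩)
        rw [join_comm] at heK hm ⊢
        refine join_not_blocks_aux hN hM he (fun h => heK ?_) fun f hf h => ?_
        · rwa [eq_of_fst hN h hf₁ (h₂.trans h₁).symm]
        · rw [eq_of_fst hN hf hf₁ (h.trans (h₂.trans h₁).symm)]
          exact hm _ hK (h₂.trans h₁)
    · push Not at hex
      exact join_not_blocks_aux hM hN he (fun h => hex e h rfl)
        fun f hf h => absurd h (hex f hf)
  obtain ⟨f, hf, h1, h2⟩ := key
  exact absurd (hw f hf h1) h2.not_ge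

/-- The threshold of each man is the larger of his two ranks. That the same men are matched is
needed for the inclusion of the union in the `P`-set of the join. -/
theorem pSet_join (hM : M ∈ G.superStable) (hN : N ∈ G.superStable) :
    G.pSet (join M N) = G.pSet M ∪ G.pSet N := by
  ext e
  rw [Set.mem_union, mem_pSet, mem_pSet, mem_pSet, ← and_or_left]
  refine and_congr_right fun _ => ⟨fun h => ?_, ?_⟩
  · by_contra! hcon
    obtain ⟨⟨e₁, he₁, h1, h2⟩, f₁, hf₁, h3, h4⟩ := hcon
    rcases le_total (G.mRank f₁) (G.mRank e₁) with hle | hle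
    · refine absurd (h e₁ (mem_join.2 (Or.inl ⟨he₁, fun f hf h' => ?_⟩)) h1) h2.not_ge
      rwa [eq_of_fst hN hf hf₁ (h'.trans (h1.trans h3.symm))]
    · refine absurd (h f₁ (mem_join.2 (Or.inr ⟨hf₁, fun f hf h' => ?_⟩)) h3) h4.not_ge
      rwa [eq_of_fst hM hf he₁ (h'.trans (h3.trans h1.symm))]
  · rintro (h | h) k hk hke <;> rcases mem_join.1 hk with ⟨h1, h2⟩ | ⟨h1, h2⟩
    · exact h k h1 hke
    · obtain ⟨g, hg, h3⟩ := exists_mem_fst hN hM h1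
      exact (h g hg (h3.trans hke)).trans (h2 g hg h3)
    · obtain ⟨g, hg, h3⟩ := exists_mem_fst hM hN h1
      exact (h g hg (h3.trans hke)).trans (h2 g hg h3)
    · exact h k h1 hke

/-- A `P`-set is determined by one threshold rank per man. Matching the same men ensures that an
absent threshold never meets a present one. -/
theorem pSet_subset_iff (hM : M ∈ G.superStable) (hN : N ∈ G.superStable) :
    G.pSet M ⊆ G.pSet N ↔ G.Dominates M N := by
  rw [dominates_iff]
  constructor
  · intro h e he
    obtain ⟨f, hf, hfe⟩ := exists_mem_fst hN hM he
    have : f ∈ G.pSet M := mem_pSet.2 ⟨subset_edges hM hf, fun g hg hgf => by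
      rw [eq_of_fst hM hg hf hgf]⟩
    exact ⟨f, hf, hfe, (mem_pSet.1 (h this)).2 e he hfe.symm⟩
  · intro h e he
    rw [mem_pSet] at he ⊢
    refine ⟨he.1, fun f hf hfe => ?_⟩
    obtain ⟨g, hg, hgf, hr⟩ := h f hf
    exact (he.2 g hg (hgf.trans hfe)).trans hr

/-- Equal `P`-sets give each man partners of equal rank, and then equal partners because
indifference is impossible. -/
theorem pSet_injOn : Set.InjOn G.pSet G.superStable := by
  intro M hM N hN h
  have aux : ∀ {M N : Finset G.Pair}, M ∈ G.superStable → N ∈ G.superStable →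
      G.pSet M = G.pSet N → M ⊆ N := by
    intro M N hM hN h e he
    obtain ⟨f, hf, hfe, hr⟩ := dominates_iff.1 ((pSet_subset_iff hN hM).1 h.ge) e he
    obtain ⟨e', he', hfe', hr'⟩ := dominates_iff.1 ((pSet_subset_iff hM hN).1 h.le) f hf
    have := eq_of_fst hM he' he (hfe'.trans hfe)
    subst this
    rwa [eq_of_mRank_eq hM hN he' hf hfe (le_antisymm hr' hr)]
  exact (aux hM hN h).antisymm (aux hN hM h.symm)

end Lattice

end SMInstance

/-! ### The proposal process for the least `P`-set containing an edge -/

namespace SMInstance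

variable {G : SMInstance}

/-- The degree of a man. -/
def deg (G : SMInstance) (a : Fin G.numMen) : ℕ := (G.menPref a).flatten.length

theorem length_le_length_flatten {α : Type*} {l : List (List α)} (h : [] ∉ l) :
    l.length ≤ l.flatten.length := by
  induction l with
  | nil => simp
  | cons t l ih =>
    simp only [List.mem_cons, not_or] at h
    have := List.length_pos_iff.2 (Ne.symm h.1)
    have := ih h.2
    simp only [List.length_cons, List.flatten_cons, List.length_append]
    omega

theorem mem_edges {e : G.Pair} : e ∈ G.edges ↔ e.2 ∈ (G.menPref e.1).flatten := by
  simp [edges]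

/-- Ties are nonempty, so there are at most as many ties as neighbours. The degree caps the counters
because the degrees sum to `m`; counting past the last tie adds no proposals. -/
theorem mRank_lt_deg {e : G.Pair} (he : e ∈ G.edges) : G.mRank e < G.deg e.1 := by
  obtain ⟨t, ht, hb⟩ := List.mem_flatten.1 (mem_edges.1 he)
  exact (List.findIdx_lt_length.2 ⟨t, ht, by simpa using hb⟩).trans_le
    (length_le_length_flatten (G.menPref_ne e.1))

/-- The edges along which a proposal has been made when each man `a` has proposed to his first
`r a` ties. -/
def props (G : SMInstance) (r : Fin G.numMen → ℕ) : Finset G.Pair :=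
  G.edges.filter fun e => G.mRank e < r e.1

theorem mem_props {r : Fin G.numMen → ℕ} {e : G.Pair} :
    e ∈ G.props r ↔ e ∈ G.edges ∧ G.mRank e < r e.1 :=
  Finset.mem_filter

/-- `e` is the unique best edge of its woman in `Q`. -/
def UniqueBest (G : SMInstance) (Q : Finset G.Pair) (e : G.Pair) : Prop :=
  e ∈ Q ∧ ∀ f ∈ Q, f.2 = e.2 → f ≠ e → G.wRank e < G.wRank f

/-- `e` lies in the last tie its man has proposed to and is the unique best proposal of its
woman. -/
def Alive (G : SMInstance) (r : Fin G.numMen → ℕ) (e : G.Pair) : Prop :=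
  G.mRank e + 1 = r e.1 ∧ G.UniqueBest (G.props r) e

/-- The man `a` has to propose to a further tie in the search for the man-optimal super-stable
matching whose `P`-set contains `e₀`. -/
def Need (G : SMInstance) (e₀ : G.Pair) (r : Fin G.numMen → ℕ) (a : Fin G.numMen) : Prop :=
  r a < G.deg a ∧ ((∀ e, G.Alive r e → e.1 ≠ a) ∨ (a = e₀.1 ∧ r a < G.mRank e₀ + 1))

/-- No super-stable matching whose `P`-set contains `e₀` gives a man a partner in a tie before the
last one he has proposed to. -/
def LowerBound (G : SMInstance) (e₀ : G.Pair) (r : Fin G.numMen → ℕ) : Prop :=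
  ∀ N ∈ G.superStable, e₀ ∈ G.pSet N → ∀ e ∈ N, r e.1 ≤ G.mRank e + 1

/-- `M` consists of one alive edge for each man who has one. -/
def IsSelection (G : SMInstance) (r : Fin G.numMen → ℕ) (M : Finset G.Pair) : Prop :=
  (∀ e ∈ M, G.Alive r e) ∧ (∀ e, G.Alive r e → ∃ f ∈ M, f.1 = e.1) ∧
    ∀ e ∈ M, ∀ f ∈ M, e.1 = f.1 → e = f

/-- Every woman with a proposal is matched in `M`. -/
def Covers (G : SMInstance) (r : Fin G.numMen → ℕ) (M : Finset G.Pair) : Prop :=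
  ∀ f ∈ G.props r, ∃ e ∈ M, e.2 = f.2

/-- `M` has the least `P`-set that contains `e₀`. -/
def IsLeastFor (G : SMInstance) (e₀ : G.Pair) (M : Finset G.Pair) : Prop :=
  M ∈ G.superStable ∧ e₀ ∈ G.pSet M ∧ ∀ N ∈ G.superStable, e₀ ∈ G.pSet N → G.pSet M ⊆ G.pSet N

section Search

variable {e₀ : G.Pair} {r : Fin G.numMen → ℕ} {M N : Finset G.Pair}

theorem Alive.mem_edges {e : G.Pair} (h : G.Alive r e) : e ∈ G.edges :=
  (mem_props.1 h.2.1).1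

/-- By the lower bound, no man is strictly better off in `N` than with an edge he has already
proposed along. So such an edge outside `N` must be beaten at its woman. -/
theorem exists_snd_of_mem_props (hr : G.LowerBound e₀ r) (hN : N ∈ G.superStable)
    (h₀ : e₀ ∈ G.pSet N) {f : G.Pair} (hf : f ∈ G.props r) :
    f ∈ N ∨ ∃ g ∈ N, g.2 = f.2 ∧ G.wRank g < G.wRank f := by
  by_cases hfN : f ∈ N
  · exact Or.inl hfN
  obtain ⟨hf, hlt⟩ := mem_props.1 hf
  rcases exists_better hN hf hfN with ⟨g, hg, h1, h2⟩ | h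
  · have := hr N hN h₀ g hg
    rw [h1] at this
    omega
  · exact Or.inr h

/-- Every rival proposal to the woman of `e` is strictly beaten by her partner in `N`, which is `e`
itself. -/
theorem alive_of_tight (hr : G.LowerBound e₀ r) (hN : N ∈ G.superStable) (h₀ : e₀ ∈ G.pSet N)
    {e : G.Pair} (he : e ∈ N) (ht : G.mRank e + 1 = r e.1) : G.Alive r e := by
  refine ⟨ht, mem_props.2 ⟨subset_edges hN he, by omega⟩, fun f hf hfe hne => ?_⟩
  rcases exists_snd_of_mem_props hr hN h₀ hf with h | ⟨g, hg, h1, h2⟩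
  · exact absurd (eq_of_snd hN h he hfe) hne
  · rwa [← eq_of_snd hN hg he (h1.trans hfe)]

/-- If no edge of `a` is alive, no admissible `N` can use his current tie. If `a` is the man of `e₀`
and has not reached its tie, `e₀ ∈ G.pSet N` already excludes all earlier ties. -/
theorem lowerBound_update (hr : G.LowerBound e₀ r) {a : Fin G.numMen} (ha : G.Need e₀ r a) :
    G.LowerBound e₀ (Function.update r a (r a + 1)) := by
  intro N hN h₀ e he
  by_cases hea : e.1 = a
  · subst hea
    rw [Function.update_self]
    rcases ha.2 with h | ⟨h1, h2⟩
    · refine lt_of_le_of_ne (hr N hN h₀ e he) fun ht => ?_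
      exact h e (alive_of_tight hr hN h₀ he ht.symm) rfl
    · have := (mem_pSet.1 h₀).2 e he h1
      omega
  · rw [Function.update_of_ne hea]
    exact hr N hN h₀ e he

theorem mem_props_of_not_need (hfix : ∀ a, ¬ G.Need e₀ r a) {e : G.Pair} (he : e ∈ G.edges)
    (hM : G.IsSelection r M) (h : ∀ f ∈ M, f.1 ≠ e.1) : e ∈ G.props r := by
  refine mem_props.2 ⟨he, ?_⟩
  have h1 := hfix e.1
  have h2 := mRank_lt_deg he
  by_contra hcon
  refine h1 ⟨by omega, Or.inl fun f hf hfe => ?_⟩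
  obtain ⟨g, hg, hgf⟩ := hM.2.1 f hf
  exact h g hg (hgf.trans hfe)

theorem IsSelection.isMatching (hM : G.IsSelection r M) : G.IsMatching M := by
  refine ⟨fun e he => (hM.1 e he).mem_edges, fun e he f hf h => ?_⟩
  rcases h with h | h
  · exact hM.2.2 e he f hf h
  · by_contra hne
    have h1 := (hM.1 e he).2.2 f (hM.1 f hf).2.1 h.symm (Ne.symm hne)
    have h2 := (hM.1 f hf).2.2 e (hM.1 e he).2.1 h hne
    omega

/-- A blocking edge would have been proposed: either its man is matched at least as late, or he has
exhausted his list. Its woman is matched by her unique best proposal, which strictly beats it. -/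
theorem IsSelection.mem_superStable (hfix : ∀ a, ¬ G.Need e₀ r a) (hM : G.IsSelection r M)
    (hc : G.Covers r M) : M ∈ G.superStable := by
  refine ⟨hM.isMatching, fun e hb => ?_⟩
  obtain ⟨he, heM, hm, hw⟩ := blocks_iff.1 hb
  have hP : e ∈ G.props r := by
    by_cases h : ∃ f ∈ M, f.1 = e.1
    · obtain ⟨f, hf, hfe⟩ := h
      have h1 := hm f hf hfe
      have h2 := (hM.1 f hf).1
      rw [hfe] at h2
      exact mem_props.2 ⟨he, by omega⟩
    · push Not at h
      exact mem_props_of_not_need hfix he hM h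
  obtain ⟨k, hk, hke⟩ := hc e hP
  have h1 := (hM.1 k hk).2.2 e hP hke.symm (fun h => heM (h ▸ hk))
  exact absurd (hw k hk hke) h1.not_ge

theorem IsSelection.mem_pSet (he₀ : e₀ ∈ G.edges) (hfix : ∀ a, ¬ G.Need e₀ r a)
    (hM : G.IsSelection r M) : e₀ ∈ G.pSet M := by
  refine SMInstance.mem_pSet.2 ⟨he₀, fun f hf hfe => ?_⟩
  have h1 := (hM.1 f hf).1
  have h2 := mRank_lt_deg he₀
  have h3 := hfix e₀.1
  rw [hfe] at h1
  by_contra hcon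
  exact h3 ⟨by omega, Or.inr ⟨rfl, by omega⟩⟩

/-- A man matched in `N` but not in the selection has exhausted his list. The lower bound then makes
his edge in `N` tight, hence alive, and he would have been selected. -/
theorem IsSelection.dominates (hr : G.LowerBound e₀ r) (hfix : ∀ a, ¬ G.Need e₀ r a)
    (hM : G.IsSelection r M) (hN : N ∈ G.superStable) (h₀ : e₀ ∈ G.pSet N) :
    G.Dominates M N := by
  rw [dominates_iff]
  intro e he
  have hex : ∃ f ∈ M, f.1 = e.1 := by
    by_contra! hcon
    have h1 := (mem_props.1 (mem_props_of_not_need hfix (subset_edges hN he) hM hcon)).2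
    have h2 := hr N hN h₀ e he
    obtain ⟨f, hf, hfe⟩ := hM.2.1 e (alive_of_tight hr hN h₀ he (by omega))
    exact hcon f hf hfe
  obtain ⟨f, hf, hfe⟩ := hex
  have h1 := (hM.1 f hf).1
  have h2 := hr N hN h₀ e he
  rw [hfe] at h1
  exact ⟨f, hf, hfe, by omega⟩

/-- Women of `M` have proposals, women with proposals are matched in `N`, and `|N| ≤ |M|` by
dominance. So both inclusions are equalities. In particular, failure to cover proves that no
admissible matching exists. -/
theorem IsSelection.covers (hr : G.LowerBound e₀ r) (hfix : ∀ a, ¬ G.Need e₀ r a)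
    (hM : G.IsSelection r M) (hN : N ∈ G.superStable) (h₀ : e₀ ∈ G.pSet N) :
    G.Covers r M := by
  have hdom := dominates_iff.1 (hM.dominates hr hfix hN h₀)
  have i1 : N.image Prod.fst ⊆ M.image Prod.fst := fun a ha => by
    obtain ⟨e, he, rfl⟩ := Finset.mem_image.1 ha
    obtain ⟨f, hf, hfe, -⟩ := hdom e he
    exact Finset.mem_image.2 ⟨f, hf, hfe⟩
  have i2 : M.image Prod.snd ⊆ (G.props r).image Prod.snd :=
    Finset.image_subset_image fun e he => (hM.1 e he).2.1
  have i3 : (G.props r).image Prod.snd ⊆ N.image Prod.snd := fun b hb => by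
    obtain ⟨f, hf, rfl⟩ := Finset.mem_image.1 hb
    rcases exists_snd_of_mem_props hr hN h₀ hf with h | ⟨g, hg, h1, -⟩
    · exact Finset.mem_image_of_mem _ h
    · exact Finset.mem_image.2 ⟨g, hg, h1⟩
  have c1 := Finset.card_le_card i1
  have c3 := Finset.card_le_card i3
  have d1 := Finset.card_image_of_injOn (injOn_fst hN)
  have d2 := Finset.card_image_of_injOn (injOn_snd hN)
  have d3 : (M.image Prod.fst).card = M.card :=
    Finset.card_image_of_injOn fun e he f hf h => hM.2.2 e he f hf h
  have d4 : (M.image Prod.snd).card = M.card :=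
    Finset.card_image_of_injOn fun e he f hf h => hM.isMatching.2 e he f hf (Or.inr h)
  have := Finset.eq_of_subset_of_card_le i2 (by omega)
  intro f hf
  have := this ▸ Finset.mem_image_of_mem Prod.snd hf
  exact Finset.mem_image.1 this

theorem IsSelection.isLeastFor (he₀ : e₀ ∈ G.edges) (hr : G.LowerBound e₀ r)
    (hfix : ∀ a, ¬ G.Need e₀ r a) (hM : G.IsSelection r M) (hc : G.Covers r M) :
    G.IsLeastFor e₀ M :=
  ⟨hM.mem_superStable hfix hc, hM.mem_pSet he₀ hfix, fun _ hN h₀ =>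
    (pSet_subset_iff (hM.mem_superStable hfix hc) hN).2 (hM.dominates hr hfix hN h₀)⟩

theorem IsLeastFor.unique (hM : G.IsLeastFor e₀ M) (hN : G.IsLeastFor e₀ N) : M = N :=
  pSet_injOn hM.1 hN.1
    ((hM.2.2 N hN.1 hN.2.1).antisymm (hN.2.2 M hM.1 hM.2.1))

/-- One man may have several alive edges in his current tie; any choice among them serves. -/
theorem exists_isSelection (r : Fin G.numMen → ℕ) : ∃ M, G.IsSelection r M := by
  classical
  obtain ⟨M, hM, hinj, himg⟩ := Finset.exists_subset_injOn_image_eq_of_surjOn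
    (f := Prod.fst) (s := ((G.edges.filter (G.Alive r) : Finset G.Pair) : Set G.Pair))
    (t := (G.edges.filter (G.Alive r)).image Prod.fst) (fun a ha => by simpa using ha)
  refine ⟨M, fun e he => (Finset.mem_filter.1 (hM he)).2, fun e he => ?_, hinj⟩
  have : e.1 ∈ M.image Prod.fst := by
    rw [himg]
    exact Finset.mem_image_of_mem _ (Finset.mem_filter.2 ⟨he.mem_edges, he⟩)
  exact Finset.mem_image.1 this

theorem sum_update_add_one (r : Fin G.numMen → ℕ) (a : Fin G.numMen) :
    ∑ x, Function.update r a (r a + 1) x = ∑ x, r x + 1 := by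
  rw [Finset.sum_update_of_mem (Finset.mem_univ a), ← Finset.add_sum_erase _ r (Finset.mem_univ a),
    Finset.sdiff_singleton_eq_erase]
  omega

theorem update_le_deg (hle : ∀ a, r a ≤ G.deg a) {a : Fin G.numMen} (ha : G.Need e₀ r a)
    (x : Fin G.numMen) : Function.update r a (r a + 1) x ≤ G.deg x := by
  by_cases h : x = a
  · subst h
    rw [Function.update_self]
    exact ha.1
  · rw [Function.update_of_ne h]
    exact hle x

/-- Each step raises the sum of the counters by one, and that sum is at most the sum of the degrees.
-/
theorem exists_fixpoint (hr : G.LowerBound e₀ r) (hle : ∀ a, r a ≤ G.deg a) :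
    ∃ r', G.LowerBound e₀ r' ∧ ∀ a, ¬ G.Need e₀ r' a := by
  induction hd : ∑ a, G.deg a - ∑ a, r a using Nat.strong_induction_on generalizing r with
  | _ d ih =>
    by_cases h : ∃ a, G.Need e₀ r a
    · obtain ⟨a, ha⟩ := h
      have hle' := update_le_deg hle ha
      have h1 := Finset.sum_le_sum fun x (_ : x ∈ Finset.univ) => hle' x
      have h2 := sum_update_add_one r a
      exact ih _ (by omega) (lowerBound_update hr ha) hle' rfl
    · exact ⟨r, hr, not_exists.1 h⟩

theorem lowerBound_zero (e₀ : G.Pair) : G.LowerBound e₀ fun _ => 0 :=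
  fun _ _ _ _ _ => Nat.zero_le _

theorem exists_isLeastFor (hN : N ∈ G.superStable) (h₀ : e₀ ∈ G.pSet N) :
    ∃ M, G.IsLeastFor e₀ M := by
  obtain ⟨r, hr, hfix⟩ := exists_fixpoint (lowerBound_zero e₀) fun a => Nat.zero_le _
  obtain ⟨M, hM⟩ := exists_isSelection r
  exact ⟨M, hM.isLeastFor (mem_pSet.1 h₀).1 hr hfix (hM.covers hr hfix hN h₀)⟩

end Search

/-! ### Irreducible matchings, man-optimal matchings and Birkhoff's correspondence -/

section Poset

variable {M N : Finset G.Pair}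

theorem mem_irreducibles : M ∈ G.irreducibles ↔ ∃ e, G.IsLeastFor e M := by
  constructor
  · rintro ⟨hM, e, ⟨-, he⟩, hl⟩
    exact ⟨e, hM, he, fun N hN h => hl ⟨Set.mem_image_of_mem _ hN, h⟩⟩
  · rintro ⟨e, hM, he, hl⟩
    refine ⟨hM, e, ⟨Set.mem_image_of_mem _ hM, he⟩, ?_⟩
    rintro _ ⟨⟨N, hN, rfl⟩, h⟩
    exact hl N hN h

theorem mem_pSet_of_mem (hM : M ∈ G.superStable) {e : G.Pair} (he : e ∈ M) : e ∈ G.pSet M :=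
  mem_pSet.2 ⟨subset_edges hM he, fun f hf h => by rw [eq_of_fst hM hf he h]⟩

theorem nonempty_of_mem_superStable (hG : 0 < G.nEdges) (hM : M ∈ G.superStable) : M.Nonempty := by
  obtain ⟨e, he⟩ := Finset.card_pos.1 hG
  by_contra h
  rw [Finset.not_nonempty_iff_eq_empty] at h
  subst h
  rcases exists_better hM he (by simp) with ⟨f, hf, -⟩ | ⟨f, hf, -⟩ <;> simp at hf

theorem isManOptimalWith_of_isLeastFor {e : G.Pair} (h : G.IsLeastFor e M) (he : e ∈ M) :
    G.IsManOptimalWith e M :=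
  ⟨⟨h.1, he⟩, fun N hN heN => (pSet_subset_iff h.1 hN).1 (h.2.2 N hN (mem_pSet_of_mem hN heN))⟩

/-- The least matching `L` for an edge `e` of `M` itself contains `e`: the `P`-set condition and
dominance force the man of `e` to have a partner of equal rank in `L`, and indifference is
impossible. -/
theorem isLeastFor_of_isManOptimalWith {e : G.Pair} (h : G.IsManOptimalWith e M) :
    G.IsLeastFor e M := by
  obtain ⟨⟨hM, he⟩, hopt⟩ := h
  obtain ⟨L, hL⟩ := exists_isLeastFor hM (mem_pSet_of_mem hM he)
  have heL : e ∈ L := by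
    obtain ⟨f, hf, hfe⟩ := exists_mem_fst hM hL.1 he
    have h1 := (mem_pSet.1 hL.2.1).2 f hf hfe
    obtain ⟨g, hg, hge, h2⟩ :=
      dominates_iff.1 ((pSet_subset_iff hL.1 hM).1 (hL.2.2 M hM (mem_pSet_of_mem hM he))) e he
    rw [eq_of_fst hL.1 hg hf (hge.trans hfe.symm)] at h2
    rwa [eq_of_mRank_eq hM hL.1 he hf hfe (le_antisymm h1 h2)]
  have : M = L := pSet_injOn hM hL.1 (Set.Subset.antisymm
    ((pSet_subset_iff hM hL.1).2 (hopt L hL.1 heL)) (hL.2.2 M hM (mem_pSet_of_mem hM he)))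
  rwa [this]

/-- If the man of `e` is matched in `M`, his edge `f` in `M` serves, since every `P`-set of a
matching through `f` contains `e`. If not, he is unmatched in every super-stable matching, so `e`
lies in all `P`-sets and any edge of `M` serves; `M` is nonempty because there are edges. -/
theorem exists_isManOptimalWith (hG : 0 < G.nEdges) {e : G.Pair} (h : G.IsLeastFor e M) :
    ∃ f ∈ G.edges, G.IsManOptimalWith f M := by
  obtain ⟨f, hf, hle⟩ : ∃ f ∈ M, ∀ N ∈ G.superStable, f ∈ N → e ∈ G.pSet N := by
    have heE := (mem_pSet.1 h.2.1).1
    by_cases hex : ∃ f ∈ M, f.1 = e.1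
    · obtain ⟨f, hf, hfe⟩ := hex
      refine ⟨f, hf, fun N hN hfN => mem_pSet.2 ⟨heE, fun g hg hge => ?_⟩⟩
      rw [eq_of_fst hN hg hfN (hge.trans hfe.symm)]
      exact (mem_pSet.1 h.2.1).2 f hf hfe
    · push Not at hex
      obtain ⟨f, hf⟩ := nonempty_of_mem_superStable hG h.1
      refine ⟨f, hf, fun N hN hfN => mem_pSet.2 ⟨heE, fun g hg hge => ?_⟩⟩
      obtain ⟨k, hk, hkg⟩ := exists_mem_fst hN h.1 hg
      exact absurd (hkg.trans hge) (hex k hk)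
  exact ⟨f, subset_edges h.1 hf, ⟨h.1, hf⟩, fun N hN hfN =>
    (pSet_subset_iff h.1 hN).1 (h.2.2 N hN (hle N hN hfN))⟩

theorem mem_irreducibles_iff_isManOptimalWith (hG : 0 < G.nEdges) :
    M ∈ G.irreducibles ↔ ∃ e ∈ G.edges, G.IsManOptimalWith e M := by
  rw [mem_irreducibles]
  constructor
  · rintro ⟨e, he⟩
    exact exists_isManOptimalWith hG he
  · rintro ⟨e, -, he⟩
    exact ⟨e, isLeastFor_of_isManOptimalWith he⟩

theorem existsUnique_isManOptimalWith {e : G.Pair} (hM : M ∈ G.superStable) (he : e ∈ M) :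
    ∃! M, G.IsManOptimalWith e M := by
  obtain ⟨L, hL⟩ := exists_isLeastFor hM (mem_pSet_of_mem hM he)
  obtain ⟨f, hf, hfe⟩ := exists_mem_fst hM hL.1 he
  have h1 := (mem_pSet.1 hL.2.1).2 f hf hfe
  obtain ⟨g, hg, hge, h2⟩ :=
    dominates_iff.1 ((pSet_subset_iff hL.1 hM).1 (hL.2.2 M hM (mem_pSet_of_mem hM he))) e he
  rw [eq_of_fst hL.1 hg hf (hge.trans hfe.symm)] at h2
  have heL := hf
  rw [← eq_of_mRank_eq hM hL.1 he hf hfe (le_antisymm h1 h2)] at heL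
  exact ⟨L, isManOptimalWith_of_isLeastFor hL heL, fun K hK =>
    (isLeastFor_of_isManOptimalWith hK).unique hL⟩

theorem mem_generated {S : Set (Finset G.Pair)} {e : G.Pair} :
    e ∈ G.generated S ↔ ∃ M ∈ S, e ∈ G.pSet M := by
  simp [generated]

/-- Iterated joins. Nonemptiness of `S` matters, as the empty union need not be a `P`-set. -/
theorem exists_pSet_eq_generated (S : Finset (Finset G.Pair)) (hS : S.Nonempty)
    (h : ∀ M ∈ S, M ∈ G.superStable) : ∃ M ∈ G.superStable, G.pSet M = G.generated S := by
  classical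
  induction hS using Finset.Nonempty.cons_induction with
  | singleton M => exact ⟨M, h M (by simp), by simp [generated]⟩
  | cons M S hMS hS ih =>
    obtain ⟨N, hN, hNS⟩ := ih fun K hK => h K (by simp [hK])
    have hM := h M (by simp)
    refine ⟨join M N, join_mem_superStable hM hN, ?_⟩
    rw [pSet_join hM hN, hNS]
    simp [generated]

/-- An edge whose least `P`-set is that of `M` lies in the union for `S'` only through some `N ∈ S'`
with `G.pSet M ⊆ G.pSet N`; closedness then puts `M` in `S'`. -/
theorem generated_subset_iff {S S' : Set (Finset G.Pair)} (hS : G.IsClosedSubset S)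
    (hS' : G.IsClosedSubset S') : G.generated S ⊆ G.generated S' ↔ S ⊆ S' := by
  constructor
  · intro h M hM
    obtain ⟨e, he⟩ := mem_irreducibles.1 (hS.1 hM)
    obtain ⟨N, hN, heN⟩ := mem_generated.1 (h (mem_generated.2 ⟨M, hM, he.2.1⟩))
    exact hS'.2 N hN M (hS.1 hM) (he.2.2 N (hS'.1 hN).1 heN)
  · exact fun h => Set.biUnion_subset_biUnion_left h

theorem bijOn_generated (hG : 0 < G.nEdges) :
    Set.BijOn G.generated {S | G.IsClosedSubset S ∧ S.Nonempty} (G.pSet '' G.superStable) := by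
  refine ⟨?_, ?_, ?_⟩
  · rintro S ⟨hS, hne⟩
    obtain ⟨M, hM, h⟩ := exists_pSet_eq_generated (S.toFinite.toFinset) (by simpa using hne)
      fun M hM => (hS.1 (by simpa using hM)).1
    exact ⟨M, hM, by simpa using h⟩
  · rintro S ⟨hS, -⟩ S' ⟨hS', -⟩ h
    exact ((generated_subset_iff hS hS').1 h.le).antisymm ((generated_subset_iff hS' hS).1 h.ge)
  · rintro _ ⟨M, hM, rfl⟩
    have key : ∀ e ∈ G.pSet M, ∃ L ∈ G.irreducibles, e ∈ G.pSet L ∧ G.pSet L ⊆ G.pSet M := by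
      intro e he
      obtain ⟨L, hL⟩ := exists_isLeastFor hM he
      exact ⟨L, mem_irreducibles.2 ⟨e, hL⟩, hL.2.1, hL.2.2 M hM he⟩
    -- The preimage of `G.pSet M` consists of all irreducibles below `M`; they generate it because
    -- each of its edges has a least `P`-set inside it.
    refine ⟨{L | L ∈ G.irreducibles ∧ G.pSet L ⊆ G.pSet M},
      ⟨⟨fun L hL => hL.1, fun L hL K hK h => ⟨hK, h.trans hL.2⟩⟩, ?_⟩, ?_⟩
    · obtain ⟨e, he⟩ := nonempty_of_mem_superStable hG hM
      obtain ⟨L, h1, -, h2⟩ := key e (mem_pSet_of_mem hM he)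
      exact ⟨L, h1, h2⟩
    · ext e
      rw [mem_generated]
      constructor
      · rintro ⟨L, hL, he⟩
        exact hL.2 he
      · intro he
        obtain ⟨L, h1, h2, h3⟩ := key e he
        exact ⟨L, ⟨h1, h3⟩, h2⟩

end Poset

end SMInstance

/-! ### A program logic with step bounds -/

namespace WordRAM

/-- The registers that a program may write. -/
def Prog.regs : Prog → List ℕ
  | skip => []
  | assign x _ => [x]
  | write _ _ _ => []
  | seq p q => p.regs ++ q.regs
  | ite _ p q => p.regs ++ q.regs
  | loop _ p => p.regs

/-- The arrays that a program may write. -/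
def Prog.arrs : Prog → List ℕ
  | skip => []
  | assign _ _ => []
  | write A _ _ => [A]
  | seq p q => p.arrs ++ q.arrs
  | ite _ p q => p.arrs ++ q.arrs
  | loop _ p => p.arrs

/-- `s'` agrees with `s` except on the registers and arrays that `p` may write. -/
def Frame (p : Prog) (s s' : State) : Prop :=
  (∀ x, x ∉ p.regs → s'.reg x = s.reg x) ∧ ∀ A, A ∉ p.arrs → s'.arr A = s.arr A

theorem Frame.refl (p : Prog) (s : State) : Frame p s s := ⟨fun _ _ => rfl, fun _ _ => rfl⟩

theorem Frame.trans {p : Prog} {s s' s'' : State} (h : Frame p s s') (h' : Frame p s' s'') :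
    Frame p s s'' :=
  ⟨fun x hx => (h'.1 x hx).trans (h.1 x hx), fun A hA => (h'.2 A hA).trans (h.2 A hA)⟩

theorem Frame.mono {p q : Prog} {s s' : State} (h : Frame p s s') (hr : p.regs ⊆ q.regs)
    (ha : p.arrs ⊆ q.arrs) : Frame q s s' :=
  ⟨fun x hx => h.1 x fun h' => hx (hr h'), fun A hA => h.2 A fun h' => hA (ha h')⟩

section Simp

variable (s : State) (x v A i : ℕ)

@[simp] theorem State.setReg_reg (y : ℕ) :
    (s.setReg x v).reg y = if y = x then v else s.reg y := by
  simp [State.setReg, Function.update_apply]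

@[simp] theorem State.setReg_arr : (s.setReg x v).arr = s.arr := rfl

@[simp] theorem State.setArr_reg : (s.setArr A i v).reg = s.reg := rfl

@[simp] theorem State.setArr_arr (B j : ℕ) :
    (s.setArr A i v).arr B j = if B = A then (if j = i then v else s.arr B j) else s.arr B j := by
  by_cases h : B = A
  · subst h
    simp [State.setArr, Function.update_apply]
  · simp [State.setArr, h]

theorem State.setArr_arr_of_ne {B : ℕ} (h : B ≠ A) : (s.setArr A i v).arr B = s.arr B := by
  simp [State.setArr, h]

end Simp

/-- Untouched registers and arrays are recognised syntactically, so that frame conditions for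
concrete programs can be settled by `decide`. -/
theorem Exec.frame {w : ℕ} {p : Prog} {s s' : State} {t : ℕ} (h : Exec w p s t s') :
    Frame p s s' := by
  induction h with
  | skip s => exact Frame.refl _ _
  | assign x e s =>
    refine ⟨fun y hy => ?_, fun _ _ => rfl⟩
    rw [State.setReg_reg, if_neg (by simpa [Prog.regs] using hy)]
  | write A i e s =>
    refine ⟨fun _ _ => rfl, fun B hB => ?_⟩
    exact State.setArr_arr_of_ne _ _ _ _ (by simpa [Prog.arrs] using hB)
  | seq _ _ ihp ihq =>
    exact (ihp.mono (by simp [Prog.regs]) (by simp [Prog.arrs])).trans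
      (ihq.mono (by simp [Prog.regs]) (by simp [Prog.arrs]))
  | ite_true _ _ ih => exact ih.mono (by simp [Prog.regs]) (by simp [Prog.arrs])
  | ite_false _ _ ih => exact ih.mono (by simp [Prog.regs]) (by simp [Prog.arrs])
  | loop_stop _ => exact Frame.refl _ _
  | loop_step _ _ _ ihp ihl => exact (ihp.mono (by simp [Prog.regs]) (by simp [Prog.arrs])).trans ihl

/-- With `w`-bit words, `p` started in `s` halts within `T` steps in a state satisfying `Q`. -/
def Run (w : ℕ) (p : Prog) (s : State) (T : ℕ) (Q : State → Prop) : Prop :=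
  ∃ t s', Exec w p s t s' ∧ t ≤ T ∧ Q s'

variable {w : ℕ} {p q : Prog} {s : State} {T T₁ T₂ : ℕ} {Q R : State → Prop}

theorem Run.imp (h : Run w p s T₁ R) (hT : T₁ ≤ T) (hQ : ∀ s', Frame p s s' → R s' → Q s') :
    Run w p s T Q := by
  obtain ⟨t, s', he, ht, hR⟩ := h
  exact ⟨t, s', he, ht.trans hT, hQ s' he.frame hR⟩

theorem Run.seq (hp : Run w p s T₁ R) (hq : ∀ s', Frame p s s' → R s' → Run w q s' T₂ Q)
    (hT : T₁ + T₂ ≤ T) : Run w (p.seq q) s T Q := by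
  obtain ⟨t, s', he, ht, hR⟩ := hp
  obtain ⟨t', s'', he', ht', hQ⟩ := hq s' he.frame hR
  exact ⟨t + t', s'', he.seq he', by omega, hQ⟩

theorem Run.ite {e : Expr} (hp : e.eval w s ≠ 0 → Run w p s T₁ Q)
    (hq : e.eval w s = 0 → Run w q s T₁ Q) (hT : e.cost + 1 + T₁ ≤ T) :
    Run w (Prog.ite e p q) s T Q := by
  by_cases h : e.eval w s = 0
  · obtain ⟨t, s', he, ht, hR⟩ := hq h
    exact ⟨_, s', Exec.ite_false h he, by omega, hR⟩
  · obtain ⟨t, s', he, ht, hR⟩ := hp h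
    exact ⟨_, s', Exec.ite_true h he, by omega, hR⟩

/-- The effect of a loop-free program. -/
def Prog.den (w : ℕ) : Prog → State → State
  | skip, s => s
  | assign x e, s => s.setReg x (e.eval w s)
  | write A i e, s => s.setArr A (i.eval w s) (e.eval w s)
  | seq p q, s => q.den w (p.den w s)
  | ite e p q, s => if e.eval w s = 0 then q.den w s else p.den w s
  | loop _ _, s => s

/-- A bound for the cost of a loop-free program. -/
def Prog.maxCost : Prog → ℕ
  | skip => 1
  | assign _ e => e.cost + 1
  | write _ i e => i.cost + e.cost + 1
  | seq p q => p.maxCost + q.maxCost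
  | ite e p q => e.cost + 1 + max p.maxCost q.maxCost
  | loop _ _ => 0

def Prog.loopFree : Prog → Bool
  | skip => true
  | assign _ _ => true
  | write _ _ _ => true
  | seq p q => p.loopFree && q.loopFree
  | ite _ p q => p.loopFree && q.loopFree
  | loop _ _ => false

/-- Straight-line code is verified by evaluating `Prog.den`; loops are excluded, so the placeholder
values of `Prog.den` and `Prog.maxCost` on them play no role. -/
theorem Run.of_loopFree (hp : p.loopFree = true) (hT : p.maxCost ≤ T) (hQ : Q (p.den w s)) :
    Run w p s T Q := by
  suffices H : ∃ t, Exec w p s t (p.den w s) ∧ t ≤ p.maxCost by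
    obtain ⟨t, he, ht⟩ := H
    exact ⟨t, _, he, ht.trans hT, hQ⟩
  clear hT hQ
  induction p generalizing s with
  | skip => exact ⟨_, Exec.skip s, le_rfl⟩
  | assign x e => exact ⟨_, Exec.assign x e s, le_rfl⟩
  | write A i e => exact ⟨_, Exec.write A i e s, le_rfl⟩
  | seq p q ihp ihq =>
    simp only [Prog.loopFree, Bool.and_eq_true] at hp
    obtain ⟨t, he, ht⟩ := ihp (s := s) hp.1
    obtain ⟨t', he', ht'⟩ := ihq (s := p.den w s) hp.2
    exact ⟨_, he.seq he', Nat.add_le_add ht ht'⟩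
  | ite e p q ihp ihq =>
    simp only [Prog.loopFree, Bool.and_eq_true] at hp
    obtain ⟨t, he, ht⟩ := ihp (s := s) hp.1
    obtain ⟨t', he', ht'⟩ := ihq (s := s) hp.2
    simp only [Prog.den, Prog.maxCost]
    split_ifs with h
    · exact ⟨_, Exec.ite_false h he', by omega⟩
    · exact ⟨_, Exec.ite_true h he, by omega⟩
  | loop e p => simp [Prog.loopFree] at hp

/-- `for x = lo, ..., reg h - 1 do body`. -/
def Prog.forUp (x : ℕ) (lo : Expr) (h : ℕ) (body : Prog) : Prog :=
  seq (assign x lo)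
    (loop (.lt (.var x) (.var h)) (seq body (assign x (.add (.var x) (.const 1)))))

/-- `I i` is the invariant at the loop test with counter `i`. Each iteration pays 4 steps for the
test and 4 for the increment besides the body; the 5 outside covers the initial assignment and the
last test. The bound `H < 2 ^ w` keeps the counter from wrapping around. -/
theorem Run.forUp {x h : ℕ} {lo : Expr} {body : Prog} (I : ℕ → State → Prop) (L H B : ℕ)
    (hL : lo.eval w s = L) (hH : s.reg h = H) (hx : x ∉ body.regs) (hh : h ∉ body.regs)
    (hxh : h ≠ x) (hLH : L ≤ H) (hw : H < 2 ^ w) (h0 : I L (s.setReg x L))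
    (hstep : ∀ i s', L ≤ i → i < H → Frame (Prog.forUp x lo h body) s s' → s'.reg x = i → I i s' →
      Run w body s' B fun s'' => I (i + 1) (s''.setReg x (i + 1)))
    (hT : lo.cost + 5 + (H - L) * (B + 8) ≤ T) (hQ : ∀ s', I H s' → Q s') :
    Run w (Prog.forUp x lo h body) s T Q := by
  have main : ∀ d i s', L ≤ i → i + d = H → Frame (Prog.forUp x lo h body) s s' →
      s'.reg x = i → I i s' →
      Run w (.loop (.lt (.var x) (.var h)) (.seq body (.assign x (.add (.var x) (.const 1)))))
        s' (4 + d * (B + 8)) Q := by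
    intro d
    induction d with
    | zero =>
      intro i s' hi hid hf hxi hI
      have hh' : s'.reg h = H := by rw [hf.1 h (by simp [Prog.forUp, Prog.regs, hh, hxh]), hH]
      refine ⟨_, s', Exec.loop_stop ?_, le_of_eq (by simp [Expr.cost]), hQ _ ?_⟩
      · simp only [Expr.eval, hxi, hh', ite_eq_right_iff]
        omega
      · have : i = H := by omega
        exact this ▸ hI
    | succ d ih =>
      intro i s' hi hid hf hxi hI
      have hh' : s'.reg h = H := by rw [hf.1 h (by simp [Prog.forUp, Prog.regs, hh, hxh]), hH]
      obtain ⟨t, s₁, he, ht, hI₁⟩ := hstep i s' hi (by omega) hf hxi hI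
      have hx₁ : s₁.reg x = i := by rw [he.frame.1 x hx, hxi]
      have hev : (Expr.add (.var x) (.const 1)).eval w s₁ = i + 1 := by
        have h1 : 1 % 2 ^ w = 1 := Nat.mod_eq_of_lt (by omega)
        simp only [Expr.eval, hx₁, h1]
        exact Nat.mod_eq_of_lt (by omega)
      have he₂ := Exec.assign (w := w) x (Expr.add (.var x) (.const 1)) s₁
      rw [hev] at he₂
      have hseq := he.seq he₂
      obtain ⟨t', s₂, he', ht', hQ'⟩ := ih (i + 1) (s₁.setReg x (i + 1)) (by omega) (by omega)
        (hf.trans (hseq.frame.mono (by simp [Prog.forUp, Prog.regs])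
          (by simp [Prog.forUp, Prog.arrs]))) (by simp) hI₁
      refine ⟨_, s₂, Exec.loop_step ?_ hseq he', ?_, hQ'⟩
      · simp only [Expr.eval, hxi, hh']
        rw [if_pos (by omega)]
        exact one_ne_zero
      · simp only [Expr.cost]
        have : (d + 1) * (B + 8) = d * (B + 8) + (B + 8) := by ring
        omega
  refine Run.seq (T₁ := lo.cost + 1) (T₂ := 4 + (H - L) * (B + 8)) (R := (· = s.setReg x L))
    ⟨_, _, Exec.assign x lo s, le_rfl, by rw [hL]⟩ ?_ (by omega)
  rintro _ hf rfl
  exact main (H - L) L _ le_rfl (by omega)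
    (hf.mono (by simp [Prog.forUp, Prog.regs]) (by simp [Prog.forUp, Prog.arrs])) (by simp) h0

end WordRAM

/-! ### The layout of the adjacency lists in memory -/

namespace SMInstance

section Layout

variable {j k : ℕ}

/-- As no vertex occurs twice, the first tie containing `u` is the tie in which `u` is listed, so
the stored tie number is its rank. -/
theorem flatMap_zipIdx_eq (l : List (List (Fin k))) (h : l.flatten.Nodup) (n : ℕ) :
    (l.zipIdx n).flatMap (fun p => p.1.map fun v : Fin k => ((v : ℕ), p.2)) =
      l.flatten.map fun u : Fin k => ((u : ℕ), n + l.findIdx fun t => decide (u ∈ t)) := by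
  induction l generalizing n with
  | nil => simp
  | cons t l ih =>
    rw [List.flatten_cons, List.nodup_append] at h
    rw [List.zipIdx_cons, List.flatMap_cons, ih h.2.1, List.flatten_cons, List.map_append]
    congr 1
    · refine List.map_congr_left fun u hu => ?_
      simp [List.findIdx_cons, hu]
    · refine List.map_congr_left fun u hu => ?_
      have : u ∉ t := fun hut => h.2.2 u hut u hu rfl
      simp [List.findIdx_cons, this]
      omega

theorem flatAdj_eq (l : List (List (Fin k))) (h : l.flatten.Nodup) :
    flatAdj l = l.flatten.map fun u : Fin k => ((u : ℕ), l.findIdx fun t => decide (u ∈ t)) := by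
  -- The definition unfolds to a monadic bind with `pure`; this puts it in the form of a plain
  -- `map`.
  have hdef : flatAdj l = l.zipIdx.flatMap fun p => p.1.map fun v : Fin k => ((v : ℕ), p.2) := by
    rw [flatAdj]
    congr 1
    funext p
    simp only [List.bind_eq_flatMap, List.pure_def, List.map_flatMap, List.map_singleton]
    exact List.map_eq_flatMap.symm
  rw [hdef, flatMap_zipIdx_eq l h 0]
  simp

/-- The list of all pairs of a vertex and one of its neighbours. -/
def adjPairs (pref : Fin j → List (List (Fin k))) : List (Fin j × Fin k) :=
  (List.finRange j).flatMap fun v => (pref v).flatten.map fun u => (v, u)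

variable {pref : Fin j → List (List (Fin k))}

theorem mem_adjPairs {e : Fin j × Fin k} : e ∈ adjPairs pref ↔ e.2 ∈ (pref e.1).flatten := by
  obtain ⟨v, u⟩ := e
  simp only [adjPairs, List.mem_flatMap, List.mem_finRange, List.mem_map, Prod.mk.injEq, true_and]
  constructor
  · rintro ⟨v, u, h, rfl, rfl⟩
    exact h
  · exact fun h => ⟨v, u, h, rfl, rfl⟩

theorem allAdj_eq (h : ∀ v, (pref v).flatten.Nodup) :
    allAdj pref = (adjPairs pref).map fun e =>
      ((e.2 : ℕ), (pref e.1).findIdx fun t => decide (e.2 ∈ t)) := by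
  rw [allAdj, adjPairs, List.map_flatMap]
  congr 1
  funext v
  rw [flatAdj_eq _ (h v), List.map_map]
  rfl

theorem length_flatAdj (h : ∀ v, (pref v).flatten.Nodup) (v : Fin j) :
    (flatAdj (pref v)).length = (pref v).flatten.length := by
  rw [flatAdj_eq _ (h v), List.length_map]

theorem adjStart_zero : adjStart pref 0 = 0 := by simp [adjStart]

theorem adjStart_succ (h : ∀ v, (pref v).flatten.Nodup) (v : Fin j) :
    adjStart pref (v + 1) = adjStart pref v + (pref v).flatten.length := by
  rw [adjStart, adjStart, List.take_add_one, List.map_append, List.sum_append,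
    List.getElem?_eq_getElem (by simp)]
  simp [length_flatAdj h v]

theorem adjStart_le_succ (h : ∀ v, (pref v).flatten.Nodup) (i : ℕ) :
    adjStart pref i ≤ adjStart pref (i + 1) := by
  by_cases hi : i < j
  · have := adjStart_succ h ⟨i, hi⟩
    simp only at this
    omega
  · rw [adjStart, adjStart, List.take_of_length_le (by simpa using hi),
      List.take_of_length_le (by simp; omega)]

theorem adjStart_mono (h : ∀ v, (pref v).flatten.Nodup) : Monotone (adjStart pref) :=
  monotone_nat_of_le_succ (adjStart_le_succ h)

theorem length_flatten_le (h : ∀ v, (pref v).flatten.Nodup) (v : Fin j) :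
    (pref v).flatten.length ≤ k := by
  simpa using (h v).length_le_card

/-- A crude bound, used only to see that positions in the women's lists fit into a word; that these
lists also have total length `m` is not needed. -/
theorem adjStart_le_mul (h : ∀ v, (pref v).flatten.Nodup) {i : ℕ} (hi : i ≤ j) :
    adjStart pref i ≤ i * k := by
  induction i with
  | zero => simp [adjStart_zero]
  | succ i ih =>
    have h1 := adjStart_succ h ⟨i, hi⟩
    have h2 := length_flatten_le h ⟨i, hi⟩
    have h3 := ih (by omega)
    simp only at h1
    rw [h1, Nat.succ_mul]
    omega

theorem length_flatMap_take (h : ∀ v, (pref v).flatten.Nodup) (i : ℕ) :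
    (((List.finRange j).take i).flatMap fun v => (pref v).flatten.map fun u => (v, u)).length =
      adjStart pref i := by
  rw [List.length_flatMap, adjStart]
  congr 1
  refine List.map_congr_left fun v _ => ?_
  rw [List.length_map, length_flatAdj h v]

theorem length_adjPairs (h : ∀ v, (pref v).flatten.Nodup) :
    (adjPairs pref).length = adjStart pref j := by
  rw [← length_flatMap_take h, List.take_of_length_le (by simp), adjPairs]

theorem getElem?_adjPairs (h : ∀ v, (pref v).flatten.Nodup) (v : Fin j) {t : ℕ}
    (ht : t < (pref v).flatten.length) :
    (adjPairs pref)[adjStart pref v + t]? = some (v, (pref v).flatten[t]) := by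
  have hsplit : List.finRange j =
      (List.finRange j).take v ++ v :: (List.finRange j).drop (v + 1) := by
    conv_lhs => rw [← List.take_append_drop v (List.finRange j)]
    congr 1
    rw [List.drop_eq_getElem_cons (by simp)]
    simp
  rw [adjPairs, hsplit, List.flatMap_append, List.flatMap_cons, ← length_flatMap_take h,
    List.getElem?_append_right (by omega), Nat.add_sub_cancel_left,
    List.getElem?_append_left (by rwa [List.length_map])]
  rw [List.getElem?_map, List.getElem?_eq_getElem ht]
  rfl

theorem exists_adjStart_le {p : ℕ} {i : ℕ} (hi : i ≤ j)
    (hp : p < adjStart pref i) :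
    ∃ v : Fin j, adjStart pref v ≤ p ∧ p < adjStart pref (v + 1) := by
  induction i with
  | zero => simp [adjStart_zero] at hp
  | succ i ih =>
    by_cases hlt : p < adjStart pref i
    · exact ih (by omega) hlt
    · exact ⟨⟨i, hi⟩, not_lt.1 hlt, hp⟩

theorem exists_getElem?_of_mem_Ico (h : ∀ v, (pref v).flatten.Nodup) {v : Fin j} {p : ℕ}
    (h1 : adjStart pref v ≤ p) (h2 : p < adjStart pref (v + 1)) :
    ∃ u, (adjPairs pref)[p]? = some (v, u) := by
  rw [adjStart_succ h] at h2
  have := getElem?_adjPairs h v (t := p - adjStart pref v) (by omega)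
  rw [Nat.add_sub_cancel' h1] at this
  exact ⟨_, this⟩

theorem adjStart_le_of_getElem? (h : ∀ v, (pref v).flatten.Nodup) {p : ℕ} {e : Fin j × Fin k}
    (hp : (adjPairs pref)[p]? = some e) :
    adjStart pref e.1 ≤ p ∧ p < adjStart pref (e.1 + 1) := by
  have hlt := (List.getElem?_eq_some_iff.1 hp).1
  rw [length_adjPairs h] at hlt
  obtain ⟨v, h1, h2⟩ := exists_adjStart_le le_rfl hlt
  obtain ⟨u, hu⟩ := exists_getElem?_of_mem_Ico h h1 h2
  rw [hp, Option.some_inj] at hu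
  subst hu
  exact ⟨h1, h2⟩

theorem nodup_adjPairs (h : ∀ v, (pref v).flatten.Nodup) : (adjPairs pref).Nodup := by
  rw [adjPairs, List.nodup_flatMap]
  refine ⟨fun v _ => (h v).map fun x y hxy => (Prod.mk.inj hxy).2, ?_⟩
  refine (List.nodup_finRange j).imp fun {v v'} hne => ?_
  intro e he he'
  simp only [List.mem_map] at he he'
  obtain ⟨_, _, rfl⟩ := he
  obtain ⟨_, _, h'⟩ := he'
  exact hne (Prod.mk.inj h').1.symm

end Layout

variable {G : SMInstance}

/-- The edge `e` stands at place `p` of the concatenated adjacency lists of the men. -/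
def At (G : SMInstance) (p : ℕ) (e : G.Pair) : Prop := (adjPairs G.menPref)[p]? = some e

/-- The start position of the adjacency list of a man. -/
abbrev st (G : SMInstance) (i : ℕ) : ℕ := adjStart G.menPref i

theorem toFinset_adjPairs : (adjPairs G.menPref).toFinset = G.edges := by
  ext e
  rw [List.mem_toFinset, mem_adjPairs, mem_edges]

theorem length_adjPairs_eq_nEdges : (adjPairs G.menPref).length = G.nEdges := by
  rw [nEdges, ← toFinset_adjPairs, List.toFinset_card_of_nodup (nodup_adjPairs G.menPref_nodup)]

theorem st_numMen : G.st G.numMen = G.nEdges := by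
  rw [st, ← length_adjPairs G.menPref_nodup, length_adjPairs_eq_nEdges]

theorem st_le {i : ℕ} (hi : i ≤ G.numMen) : G.st i ≤ G.nEdges := by
  rw [← st_numMen]
  exact adjStart_mono G.menPref_nodup hi

theorem st_succ (a : Fin G.numMen) : G.st (a + 1) = G.st a + G.deg a :=
  adjStart_succ G.menPref_nodup a

theorem deg_le (a : Fin G.numMen) : G.deg a ≤ G.numWomen := length_flatten_le G.menPref_nodup a

/-- This identity limits the number of advancing rounds of one search to `m`. -/
theorem sum_deg : ∑ a, G.deg a = G.nEdges := by
  have : ∀ i (hi : i ≤ G.numMen), ∑ a : Fin i, G.deg (Fin.castLE hi a) = G.st i := by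
    intro i
    induction i with
    | zero => intro _; simp [adjStart_zero]
    | succ i ih =>
      intro hi
      rw [Fin.sum_univ_castSucc]
      have := st_succ (G := G) ⟨i, hi⟩
      simp only at this
      rw [this, ← ih (by omega)]
      rfl
  rw [← st_numMen, ← this _ le_rfl]
  rfl

theorem At.lt {p : ℕ} {e : G.Pair} (h : G.At p e) : p < G.nEdges := by
  rw [← length_adjPairs_eq_nEdges]
  exact (List.getElem?_eq_some_iff.1 h).1

theorem exists_at {p : ℕ} (h : p < G.nEdges) : ∃ e, G.At p e := by
  rw [← length_adjPairs_eq_nEdges] at h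
  exact ⟨_, List.getElem?_eq_getElem h⟩

theorem At.mem_edges {p : ℕ} {e : G.Pair} (h : G.At p e) : e ∈ G.edges := by
  rw [← toFinset_adjPairs, List.mem_toFinset]
  exact List.mem_of_getElem? h

theorem exists_at_of_mem {e : G.Pair} (h : e ∈ G.edges) : ∃ p, G.At p e := by
  rw [← toFinset_adjPairs, List.mem_toFinset] at h
  exact List.mem_iff_getElem?.1 h

theorem At.right_unique {p : ℕ} {e f : G.Pair} (h : G.At p e) (h' : G.At p f) : e = f :=
  Option.some_injective _ (h.symm.trans h')

theorem At.left_unique {p q : ℕ} {e : G.Pair} (h : G.At p e) (h' : G.At q e) : p = q := by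
  exact (List.getElem?_inj (List.getElem?_eq_some_iff.1 h).1
    (nodup_adjPairs G.menPref_nodup)).1 (h.trans h'.symm)

theorem At.st_le {p : ℕ} {e : G.Pair} (h : G.At p e) : G.st e.1 ≤ p ∧ p < G.st (e.1 + 1) :=
  adjStart_le_of_getElem? G.menPref_nodup h

theorem exists_at_of_st_le {a : Fin G.numMen} {p : ℕ} (h1 : G.st a ≤ p) (h2 : p < G.st (a + 1)) :
    ∃ e, G.At p e ∧ e.1 = a := by
  obtain ⟨u, hu⟩ := exists_getElem?_of_mem_Ico G.menPref_nodup h1 h2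
  exact ⟨_, hu, rfl⟩

theorem At.input {p : ℕ} {e : G.Pair} (h : G.At p e) :
    G.input.arr 1 p = e.2 ∧ G.input.arr 2 p = G.mRank e := by
  simp only [SMInstance.input, allAdj_eq G.menPref_nodup, List.getD_eq_getElem?_getD,
    List.getElem?_map, show (adjPairs G.menPref)[p]? = some e from h]
  exact ⟨rfl, rfl⟩

/-- The start position of the adjacency list of a woman. -/
abbrev wst (G : SMInstance) (i : ℕ) : ℕ := adjStart G.womenPref i

theorem wst_succ (b : Fin G.numWomen) :
    G.wst (b + 1) = G.wst b + (G.womenPref b).flatten.length :=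
  adjStart_succ G.womenPref_nodup b

theorem wst_succ_le (b : Fin G.numWomen) : G.wst (b + 1) ≤ G.wst b + G.numMen := by
  rw [wst_succ]
  exact Nat.add_le_add_left (length_flatten_le G.womenPref_nodup b) _

theorem wst_le {i : ℕ} (hi : i ≤ G.numWomen) : G.wst i ≤ G.numWomen * G.numMen :=
  (adjStart_le_mul G.womenPref_nodup hi).trans (Nat.mul_le_mul_right _ hi)

theorem exists_wst {b : Fin G.numWomen} {q : ℕ} (h1 : G.wst b ≤ q) (h2 : q < G.wst (b + 1)) :
    ∃ a : Fin G.numMen, G.input.arr 4 q = a ∧ G.input.arr 5 q = G.wRank (a, b) := by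
  obtain ⟨a, ha⟩ := exists_getElem?_of_mem_Ico G.womenPref_nodup h1 h2
  refine ⟨a, ?_⟩
  simp only [SMInstance.input, allAdj_eq G.womenPref_nodup, List.getD_eq_getElem?_getD,
    List.getElem?_map, ha]
  exact ⟨rfl, rfl⟩

theorem exists_wst_of_mem {e : G.Pair} (he : e ∈ G.edges) :
    ∃ q, G.wst e.2 ≤ q ∧ q < G.wst (e.2 + 1) ∧ G.input.arr 4 q = e.1 := by
  have h : (e.2, e.1) ∈ adjPairs G.womenPref :=
    mem_adjPairs.2 ((G.mutual_adj _ _).1 (mem_edges.1 he))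
  obtain ⟨q, hq⟩ := List.mem_iff_getElem?.1 h
  obtain ⟨h1, h2⟩ := adjStart_le_of_getElem? G.womenPref_nodup hq
  refine ⟨q, h1, h2, ?_⟩
  simp only [SMInstance.input, allAdj_eq G.womenPref_nodup, List.getD_eq_getElem?_getD,
    List.getElem?_map, hq]
  rfl

end SMInstance

/-! ### Completing the input: the man of each edge and its rank at the woman -/

open WordRAM

namespace SMInstance

variable {G : SMInstance} {w : ℕ} {s s' : State}

/-- Words of `w` bits can hold the square of the size of the instance. -/
def Fits (G : SMInstance) (w : ℕ) : Prop := (G.nVerts + G.nEdges) ^ 2 < 2 ^ w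

theorem Fits.lt (hw : G.Fits w) {v : ℕ} (hv : v ≤ G.nVerts + G.nEdges) : v < 2 ^ w :=
  (hv.trans (Nat.le_self_pow two_ne_zero _)).trans_lt hw

theorem Fits.mod (hw : G.Fits w) {v : ℕ} (hv : v ≤ G.nVerts + G.nEdges) : v % 2 ^ w = v :=
  Nat.mod_eq_of_lt (hw.lt hv)

theorem Fits.mod_sq (hw : G.Fits w) {v : ℕ} (hv : v ≤ (G.nVerts + G.nEdges) ^ 2) :
    v % 2 ^ w = v :=
  Nat.mod_eq_of_lt (hv.trans_lt hw)

/-- The state `s` holds the instance: the edges are numbered as in the concatenated adjacency lists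
of the men, and arrays 1, 2, 8, 9 hold the woman, the rank at the man, the man, and the rank at the
woman of each of them. -/
structure Holds (G : SMInstance) (s : State) : Prop where
  reg0 : s.reg 0 = G.numMen
  reg1 : s.reg 1 = G.numWomen
  reg3 : s.reg 3 = G.nEdges
  start : ∀ i ≤ G.numMen, s.arr 0 i = G.st i
  edge : ∀ p e, G.At p e → s.arr 1 p = e.2 ∧ s.arr 2 p = G.mRank e ∧ s.arr 8 p = e.1 ∧
    s.arr 9 p = G.wRank e

/-- The program does not write the registers and arrays that hold the instance. -/
def _root_.WordRAM.Prog.keeps (p : Prog) : Bool :=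
  [0, 1, 3].all (fun x => decide (x ∉ p.regs)) && [0, 1, 2, 8, 9].all fun A => decide (A ∉ p.arrs)

theorem Holds.of_frame {p : Prog} (h : G.Holds s) (hf : Frame p s s') (hp : p.keeps = true) :
    G.Holds s' := by
  simp only [Prog.keeps, Bool.and_eq_true, List.all_eq_true, decide_eq_true_eq] at hp
  obtain ⟨hr, ha⟩ := hp
  refine ⟨?_, ?_, ?_, ?_, ?_⟩
  · rw [hf.1 0 (hr 0 (by decide)), h.reg0]
  · rw [hf.1 1 (hr 1 (by decide)), h.reg1]
  · rw [hf.1 3 (hr 3 (by decide)), h.reg3]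
  · rw [hf.2 0 (ha 0 (by decide))]
    exact h.start
  · rw [hf.2 1 (ha 1 (by decide)), hf.2 2 (ha 2 (by decide)), hf.2 8 (ha 8 (by decide)),
      hf.2 9 (ha 9 (by decide))]
    exact h.edge

theorem numMen_le : G.numMen ≤ G.nVerts := Nat.le_add_right _ _

theorem numWomen_le : G.numWomen ≤ G.nVerts := Nat.le_add_left _ _

/-- Sets array 8 to the man of each edge. -/
def ownerProg : Prog :=
  .forUp 4 (.const 0) 0
    (.seq (.assign 9 (.read 0 (.add (.var 4) (.const 1))))
      (.forUp 8 (.read 0 (.var 4)) 9 (.write 8 (.var 8) (.var 4))))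

theorem run_ownerProg (hw : G.Fits w) (hE : 0 < G.nEdges) (h0 : s.reg 0 = G.numMen)
    (hs : ∀ i ≤ G.numMen, s.arr 0 i = G.st i) :
    Run w ownerProg s (6 + G.numMen * (25 + 11 * G.nEdges)) fun s' =>
      ∀ p e, G.At p e → s'.arr 8 p = e.1 := by
  have hn := numMen_le (G := G)
  have h1 : 1 % 2 ^ w = 1 := hw.mod (by omega)
  refine Run.forUp (fun i s' => ∀ p e, G.At p e → (e.1 : ℕ) < i → s'.arr 8 p = e.1) 0 G.numMen
    (17 + 11 * G.nEdges) (by simp [Expr.eval]) h0 (by decide) (by decide) (by decide)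
    (Nat.zero_le _) (hw.lt (by omega)) (fun p e _ h => absurd h (Nat.not_lt_zero _)) ?_ ?_ ?_
  · intro i s₁ _ hi hf hx hI
    have ha0 : s₁.arr 0 = s.arr 0 := hf.2 0 (by decide)
    refine Run.seq (T₁ := 5) (T₂ := 12 + 11 * G.nEdges)
      (R := fun s₂ => s₂ = s₁.setReg 9 (G.st (i + 1)))
      (Run.of_loopFree rfl (by decide) ?_) ?_ (by omega)
    · simp only [Prog.den, Expr.eval, hx, h1]
      rw [hw.mod (by omega), ha0, hs _ hi]
    · rintro s₂ - rfl
      have hsucc := st_succ (G := G) ⟨i, hi⟩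
      simp only at hsucc
      have hle := st_le (G := G) (i := i + 1) hi
      -- Besides the entries of earlier men, the inner loop keeps the segment of man `i` filled up
      -- to position `j`; at the end this segment contains all his edges.
      refine Run.forUp (fun j s' => (∀ p e, G.At p e → (e.1 : ℕ) < i → s'.arr 8 p = e.1) ∧
        ∀ p, G.st i ≤ p → p < j → s'.arr 8 p = i) (G.st i) (G.st (i + 1)) 3 ?_ ?_ (by decide)
        (by decide) (by decide) (by omega) (hw.lt (by omega)) ⟨?_, ?_⟩ ?_ ?_ ?_
      · simp [Expr.eval, hx, ha0, hs i hi.le]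
      · simp
      · simpa using hI
      · intro p h1 h2
        omega
      · intro j s₃ hj hj' hf₃ hx₃ hI₃
        have hr4 : s₃.reg 4 = i := by
          rw [hf₃.1 4 (by decide)]
          simpa using hx
        refine Run.of_loopFree rfl (by decide) ⟨fun p e hp hlt => ?_, fun p hp hlt => ?_⟩
        · have : p ≠ j := by
            rintro rfl
            obtain ⟨f, hf, hfi⟩ := exists_at_of_st_le (G := G) (a := ⟨i, hi⟩) hj hj'
            rw [hp.right_unique hf, hfi] at hlt
            exact lt_irrefl _ hlt
          simp [Prog.den, Expr.eval, hx₃, this, hI₃.1 p e hp hlt]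
        · simp only [Prog.den, Expr.eval, hx₃, hr4, State.setReg_arr, State.setArr_arr, if_true]
          split_ifs with h
          · rfl
          · exact hI₃.2 p hp (by omega)
      · simp only [Expr.cost]
        omega
      · intro s₃ hI₃ p e hp hlt
        rw [State.setReg_arr]
        by_cases h : (e.1 : ℕ) = i
        · have := hp.st_le
          rw [h] at this
          rw [h]
          exact hI₃.2 p this.1 this.2
        · exact hI₃.1 p e hp (by omega)
  · simp only [Expr.cost]
    rw [show 17 + 11 * G.nEdges + 8 = 25 + 11 * G.nEdges by ring, Nat.sub_zero]
  · exact fun s' h p e hp => h p e hp e.1.isLt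

/-- Sets array 9 to the rank at the woman of each edge. -/
def womanRankProg : Prog :=
  .forUp 4 (.const 0) 3
    (.seq (.assign 10 (.read 1 (.var 4)))
      (.seq (.assign 9 (.read 3 (.add (.var 10) (.const 1))))
        (.forUp 8 (.read 3 (.var 10)) 9
          (.ite (.eq (.read 4 (.var 8)) (.read 8 (.var 4)))
            (.write 9 (.var 4) (.read 5 (.var 8))) .skip))))

theorem run_womanRankProg (hw : G.Fits w) (hE : 0 < G.nEdges) (h3 : s.reg 3 = G.nEdges)
    (ha1 : s.arr 1 = G.input.arr 1) (ha3 : s.arr 3 = G.input.arr 3)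
    (ha4 : s.arr 4 = G.input.arr 4) (ha5 : s.arr 5 = G.input.arr 5)
    (ha8 : ∀ p e, G.At p e → s.arr 8 p = e.1) :
    Run w womanRankProg s (6 + G.nEdges * (40 + 30 * G.numMen)) fun s' =>
      ∀ p e, G.At p e → s'.arr 9 p = G.wRank e := by
  have hn := numMen_le (G := G)
  have hn' := numWomen_le (G := G)
  have h1 : 1 % 2 ^ w = 1 := hw.mod (by omega)
  have hs : ∀ i ≤ G.numWomen, G.input.arr 3 i = G.wst i := fun i hi => by simp [input, hi]
  refine Run.forUp (fun i s' => ∀ p e, G.At p e → p < i → s'.arr 9 p = G.wRank e) 0 G.nEdges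
    (32 + 30 * G.numMen) (by simp [Expr.eval]) h3 (by decide) (by decide) (by decide)
    (Nat.zero_le _) (hw.lt (by omega)) (fun p e _ h => absurd h (Nat.not_lt_zero _)) ?_ ?_ ?_
  · intro i s₁ _ hi hf hx hI
    obtain ⟨e, he⟩ := exists_at hi
    have a1 : s₁.arr 1 = G.input.arr 1 := (hf.2 1 (by decide)).trans ha1
    have a3 : s₁.arr 3 = G.input.arr 3 := (hf.2 3 (by decide)).trans ha3
    have a4 : s₁.arr 4 = G.input.arr 4 := (hf.2 4 (by decide)).trans ha4
    have a5 : s₁.arr 5 = G.input.arr 5 := (hf.2 5 (by decide)).trans ha5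
    have a8 : s₁.arr 8 = s.arr 8 := hf.2 8 (by decide)
    have hb := e.2.isLt
    refine Run.seq (T₁ := 3) (T₂ := 29 + 30 * G.numMen)
      (R := fun s₂ => s₂ = s₁.setReg 10 e.2) (Run.of_loopFree rfl (by decide) ?_) ?_ (by omega)
    · simp only [Prog.den, Expr.eval, hx, a1, he.input.1]
    rintro s₂ - rfl
    refine Run.seq (T₁ := 5) (T₂ := 24 + 30 * G.numMen)
      (R := fun s₂ => s₂ = (s₁.setReg 10 e.2).setReg 9 (G.wst (e.2 + 1)))
      (Run.of_loopFree rfl (by decide) ?_) ?_ (by omega)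
    · simp only [Prog.den, Expr.eval, h1, State.setReg_reg, State.setReg_arr, if_true]
      rw [hw.mod (by omega), a3, hs _ hb]
    rintro s₂ - rfl
    have hsucc := wst_succ (G := G) e.2
    have hsucc' := wst_succ_le (G := G) e.2
    have hle : G.wst (e.2 + 1) ≤ (G.nVerts + G.nEdges) ^ 2 := by
      refine (wst_le (G := G) hb).trans ?_
      rw [pow_two]
      exact Nat.mul_le_mul (by omega) (by omega)
    -- The list of the woman is scanned for the man of edge `i`. Symmetry of adjacency guarantees
    -- that he is found.
    refine Run.forUp (fun j s' => (∀ p e, G.At p e → p < i → s'.arr 9 p = G.wRank e) ∧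
        ∀ q, G.wst e.2 ≤ q → q < j → G.input.arr 4 q = e.1 → s'.arr 9 i = G.wRank e)
        (G.wst e.2) (G.wst (e.2 + 1)) 13 ?_ ?_ (by decide)
        (by decide) (by decide) (by omega) (hle.trans_lt hw) ⟨?_, ?_⟩ ?_ ?_ ?_
    · simp [Expr.eval, a3, hs _ hb.le]
    · simp
    · simpa using hI
    · intro p h1 h2
      omega
    · intro q s₃ hq hq' hf₃ hx₃ hI₃
      have hr4 : s₃.reg 4 = i := by
        rw [hf₃.1 4 (by decide)]
        simpa using hx
      have b4 : s₃.arr 4 = G.input.arr 4 := (hf₃.2 4 (by decide)).trans a4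
      have b5 : s₃.arr 5 = G.input.arr 5 := (hf₃.2 5 (by decide)).trans a5
      have b8 : s₃.arr 8 i = e.1 := by
        rw [hf₃.2 8 (by decide), State.setReg_arr, State.setReg_arr, a8, ha8 i e he]
      obtain ⟨a, h4, h5⟩ := exists_wst hq hq'
      refine Run.of_loopFree rfl (by decide) ?_
      simp only [Prog.den, Expr.eval, hx₃, hr4, b4, b5, b8, h4, h5]
      by_cases hae : (a : ℕ) = e.1
      · have : a = e.1 := Fin.ext hae
        subst this
        simp only [if_true, one_ne_zero, if_false, State.setReg_arr, State.setArr_arr]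
        refine ⟨fun p f hp hlt => ?_, by simp⟩
        rw [if_neg (by omega)]
        exact hI₃.1 p f hp hlt
      · simp only [hae, if_false, if_true, State.setReg_arr]
        refine ⟨hI₃.1, fun q' hq₁ hq₂ hq₃ => ?_⟩
        by_cases hqq : q' = q
        · subst hqq
          exact absurd (h4.symm.trans hq₃) hae
        · exact hI₃.2 q' hq₁ (by omega) hq₃
    · simp only [Expr.cost]
      omega
    · intro s₃ hI₃ p f hp hlt
      rw [State.setReg_arr]
      by_cases h : p = i
      · subst h
        obtain rfl := hp.right_unique he
        obtain ⟨q, hq1, hq2, hq3⟩ := exists_wst_of_mem hp.mem_edges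
        exact hI₃.2 q hq1 hq2 hq3
      · exact hI₃.1 p f hp (by omega)
  · simp only [Expr.cost]
    rw [show 32 + 30 * G.numMen + 8 = 40 + 30 * G.numMen by ring, Nat.sub_zero]
  · exact fun s' h p e hp => h p e hp hp.lt

/-- Completes the input to a state that holds the instance. -/
def setupProg : Prog := .seq (.assign 3 (.read 0 (.var 0))) (.seq ownerProg womanRankProg)

theorem nVerts_pos (hE : 0 < G.nEdges) : 0 < G.numMen := by
  obtain ⟨e, -⟩ := exists_at hE
  exact e.1.pos

theorem run_setupProg (hw : G.Fits w) (hE : 0 < G.nEdges) :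
    Run w setupProg G.input (200 * (G.nVerts * G.nEdges)) fun s => G.Holds s ∧ s.reg 2 = 0 := by
  have hn := numMen_le (G := G)
  have hpos := nVerts_pos hE
  refine Run.seq (T₁ := 3) (T₂ := (6 + G.numMen * (25 + 11 * G.nEdges)) +
    (6 + G.nEdges * (40 + 30 * G.numMen))) (R := fun s => s = G.input.setReg 3 G.nEdges)
    (Run.of_loopFree rfl (by decide) ?_) ?_ ?_
  · simp only [Prog.den, Expr.eval]
    simp [input, ← st_numMen]
  · rintro s - rfl
    refine Run.seq (run_ownerProg hw hE ?_ ?_) (fun s₁ hf₁ h8 => ?_) le_rfl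
    · simp [input]
    · intro i hi
      simp [input, hi]
    have f2 : ∀ A, A ≠ 8 → s₁.arr A = G.input.arr A := fun A hA =>
      hf₁.2 A (by simpa [ownerProg, Prog.forUp, Prog.arrs] using hA)
    have r3 : s₁.reg 3 = G.nEdges := by
      rw [hf₁.1 3 (by decide)]
      simp
    refine (run_womanRankProg hw hE r3 (f2 1 (by decide)) (f2 3 (by decide)) (f2 4 (by decide))
      (f2 5 (by decide)) h8).imp le_rfl fun s₂ hf₂ h9 => ⟨⟨?_, ?_, ?_, ?_, ?_⟩, ?_⟩
    · rw [hf₂.1 0 (by decide), hf₁.1 0 (by decide)]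
      simp [input]
    · rw [hf₂.1 1 (by decide), hf₁.1 1 (by decide)]
      simp [input]
    · rw [hf₂.1 3 (by decide), r3]
    · intro i hi
      rw [hf₂.2 0 (by decide), f2 0 (by decide)]
      simp [input, hi]
    · intro p e hp
      rw [hf₂.2 1 (by decide), f2 1 (by decide), hf₂.2 2 (by decide), f2 2 (by decide),
        hf₂.2 8 (by decide)]
      exact ⟨hp.input.1, hp.input.2, h8 p e hp, h9 p e hp⟩
    · rw [hf₂.1 2 (by decide), hf₁.1 2 (by decide)]
      simp [input]
  · have h1 : G.nVerts ≤ G.nVerts * G.nEdges := Nat.le_mul_of_pos_right _ hE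
    have h2 : G.nEdges ≤ G.nVerts * G.nEdges := Nat.le_mul_of_pos_left _ (by omega)
    have h3 : G.numMen * G.nEdges ≤ G.nVerts * G.nEdges := Nat.mul_le_mul_right _ hn
    have e1 : G.numMen * (25 + 11 * G.nEdges) = 25 * G.numMen + 11 * (G.numMen * G.nEdges) := by
      ring
    have e2 : G.nEdges * (40 + 30 * G.numMen) = 40 * G.nEdges + 30 * (G.numMen * G.nEdges) := by
      ring
    rw [e1, e2]
    omega

end SMInstance

/-! ### Bookkeeping of proposals at women and of alive edges at men -/

namespace SMInstance

variable {G : SMInstance} {w : ℕ} {s s' : State}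

/-- Sets the cells of the array `A` below the value of the register `h` to `0`. -/
def clearProg (A h : ℕ) : Prog := .forUp 6 (.const 0) h (.write A (.var 6) (.const 0))

theorem run_clearProg {A h H : ℕ} (hh : h ≠ 6) (hH : s.reg h = H) (hw : H < 2 ^ w) :
    Run w (clearProg A h) s (6 + 11 * H) fun s' => ∀ i < H, s'.arr A i = 0 := by
  refine Run.forUp (fun i s' => ∀ j < i, s'.arr A j = 0) 0 H 3 (by simp [Expr.eval]) hH
    (by simp [Prog.regs]) (by simp [Prog.regs]) hh (Nat.zero_le _) hw
    (fun j hj => absurd hj (Nat.not_lt_zero _)) ?_ ?_ fun _ h => h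
  · intro i s₁ _ _ _ hx hI
    refine Run.of_loopFree rfl (by simp [Prog.maxCost, Expr.cost]) fun j hj => ?_
    simp only [Prog.den, Expr.eval, hx, State.setReg_arr, State.setArr_arr, if_true]
    split_ifs with h
    · exact Nat.zero_mod _
    · exact hI j (by omega)
  · simp only [Expr.cost]
    omega

/-- The numbers of ties the men have proposed to, stored in array 10. -/
def ties (G : SMInstance) (s : State) : Fin G.numMen → ℕ := fun a => s.arr 10 a

/-- Array entries `best b` and `eng b` correctly describe the proposals in `Q` to the woman `b`. -/
def WomanState (G : SMInstance) (Q : Finset G.Pair) (b : Fin G.numWomen) (best eng : ℕ) : Prop :=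
  (best = 0 ∧ eng = 0 ∧ ∀ f ∈ Q, f.2 ≠ b) ∨
    ∃ e ∈ Q, e.2 = b ∧ (∀ f ∈ Q, f.2 = b → G.wRank e ≤ G.wRank f) ∧ best = G.wRank e + 1 ∧
      ((eng = 0 ∧ ∃ f ∈ Q, f ≠ e ∧ f.2 = b ∧ G.wRank f = G.wRank e) ∨
        ∃ p, G.At p e ∧ eng = p + 1 ∧ ∀ f ∈ Q, f.2 = b → f ≠ e → G.wRank e < G.wRank f)

/-- A tie for the best rank leaves no unique best edge, which is why a tie is stored as `0`, like
the absence of proposals. Only `best` tells the two apart. -/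
theorem WomanState.eng {Q : Finset G.Pair} {b : Fin G.numWomen} {best eng : ℕ}
    (h : G.WomanState Q b best eng) : (eng = 0 ∧ ∀ e, G.UniqueBest Q e → e.2 ≠ b) ∨
      ∃ p e, G.At p e ∧ e.2 = b ∧ eng = p + 1 ∧ G.UniqueBest Q e := by
  rcases h with ⟨-, h, hQ⟩ | ⟨e, heQ, heb, hmin, -, ⟨h, f, hfQ, hfe, hfb, hr⟩ | ⟨p, hp, h, hu⟩⟩
  · exact Or.inl ⟨h, fun e he => hQ e he.1⟩
  · refine Or.inl ⟨h, fun k hk hkb => ?_⟩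
    have h1 := hmin k hk.1 hkb
    by_cases hke : k = e
    · subst hke
      have := hk.2 f hfQ (hfb.trans heb.symm) hfe
      omega
    · have := hk.2 e heQ (heb.trans hkb.symm) (Ne.symm hke)
      omega
  · exact Or.inr ⟨p, e, hp, heb, h, heQ, fun f hf hfe => hu f hf (hfe.trans heb)⟩

theorem WomanState.best {Q : Finset G.Pair} {b : Fin G.numWomen} {best eng : ℕ}
    (h : G.WomanState Q b best eng) : best = 0 ↔ ∀ f ∈ Q, f.2 ≠ b := by
  rcases h with ⟨h, -, hQ⟩ | ⟨e, heQ, heb, hmin, h, -⟩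
  · exact ⟨fun _ => hQ, fun _ => h⟩
  · refine ⟨fun h' => by omega, fun h' => absurd heb (h' e heQ)⟩

/-- `has` is the position (plus one) of an alive edge of the man `a`, or `0` if there is none. -/
def ManState (G : SMInstance) (r : Fin G.numMen → ℕ) (a : Fin G.numMen) (has : ℕ) : Prop :=
  (has = 0 ∧ ∀ e, G.Alive r e → e.1 ≠ a) ∨ ∃ p e, G.At p e ∧ e.1 = a ∧ has = p + 1 ∧ G.Alive r e

/-- Marks the man of the edge stored for the woman `reg 6` if that edge is alive. -/
def markProg : Prog :=
  .ite (.read 12 (.var 6))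
    (.seq (.assign 10 (.sub (.read 12 (.var 6)) (.const 1)))
      (.seq (.assign 11 (.read 8 (.var 10)))
        (.ite (.eq (.add (.read 2 (.var 10)) (.const 1)) (.read 10 (.var 11)))
          (.write 13 (.var 11) (.read 12 (.var 6))) .skip)))
    .skip

/-- Stores in array 13 an alive edge of each man. -/
def aliveProg : Prog := .seq (clearProg 13 0) (.forUp 6 (.const 0) 1 markProg)

/-- Each woman has at most one candidate, her unique best proposal, so scanning the women instead of
the edges finds all alive edges in `O(n)` steps. If a man has several, the last one found stays. -/
theorem run_aliveProg (hw : G.Fits w) (hE : 0 < G.nEdges) (hs : G.Holds s)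
    (hb : ∀ b : Fin G.numWomen, G.WomanState (G.props (G.ties s)) b (s.arr 11 b) (s.arr 12 b)) :
    Run w aliveProg s (60 * G.nVerts) fun s' =>
      ∀ a : Fin G.numMen, G.ManState (G.ties s) a (s'.arr 13 a) := by
  have hn := numMen_le (G := G)
  have hn' := numWomen_le (G := G)
  have hpos := nVerts_pos hE
  have hsum : G.nVerts = G.numMen + G.numWomen := rfl
  have h1 : 1 % 2 ^ w = 1 := hw.mod (by omega)
  refine Run.seq (run_clearProg (by decide) hs.reg0 (hw.lt (by omega)))
    (T₂ := 6 + G.numWomen * 40) (fun s₁ hf₁ hz => ?_) ?_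
  swap
  · obtain ⟨e, -⟩ := exists_at hE
    have := e.2.pos
    omega
  have hs₁ := hs.of_frame hf₁ rfl
  have e10 : s₁.arr 10 = s.arr 10 := hf₁.2 10 (by decide)
  have e12 : s₁.arr 12 = s.arr 12 := hf₁.2 12 (by decide)
  refine Run.forUp (fun i s' => ∀ a : Fin G.numMen,
      (s'.arr 13 a = 0 ∧ ∀ e, G.Alive (G.ties s) e → (e.2 : ℕ) < i → e.1 ≠ a) ∨
      ∃ p e, G.At p e ∧ e.1 = a ∧ s'.arr 13 a = p + 1 ∧ G.Alive (G.ties s) e) 0 G.numWomen 32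
    (by simp [Expr.eval]) hs₁.reg1 (by decide) (by decide) (by decide) (Nat.zero_le _)
    (hw.lt (by omega)) ?_ ?_ ?_ ?_
  · intro a
    exact Or.inl ⟨hz a a.isLt, fun e _ h => absurd h (Nat.not_lt_zero _)⟩
  · intro i s₂ _ hi hf₂ hx hI
    have hs₂ := hs₁.of_frame hf₂ rfl
    have f10 : s₂.arr 10 = s.arr 10 := (hf₂.2 10 (by decide)).trans e10
    have f12 : s₂.arr 12 = s.arr 12 := (hf₂.2 12 (by decide)).trans e12
    refine Run.of_loopFree rfl (by decide) ?_
    rcases (hb ⟨i, hi⟩).eng with ⟨h0, hno⟩ | ⟨p, e, hp, hei, hpe, hu⟩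
    · simp only at h0
      have : markProg.den w s₂ = s₂ := by
        simp [markProg, Prog.den, Expr.eval, hx, f12, h0]
      rw [this]
      intro a
      rw [State.setReg_arr]
      rcases hI a with ⟨ha, hno'⟩ | h
      · refine Or.inl ⟨ha, fun e he hlt => ?_⟩
        by_cases hei : (e.2 : ℕ) = i
        · exact absurd (Fin.ext hei) (hno e he.2)
        · exact hno' e he (by omega)
      · exact Or.inr h
    · simp only at hpe
      obtain ⟨-, hrk, hown, -⟩ := hs₂.edge p e hp
      have hplt := hp.lt
      have hdeg := mRank_lt_deg hp.mem_edges
      have hdeg' := deg_le e.1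
      have hmod : (G.mRank e + 1) % 2 ^ w = G.mRank e + 1 := hw.mod (by omega)
      have hcond : G.mRank e + 1 = s.arr 10 e.1 ↔ G.Alive (G.ties s) e :=
        ⟨fun h => ⟨h, hu⟩, fun h => h.1⟩
      have hden : ∀ a : Fin G.numMen, (markProg.den w s₂).arr 13 a =
          if G.mRank e + 1 = s.arr 10 e.1 ∧ a = e.1 then p + 1 else s₂.arr 13 a := by
        intro a
        unfold markProg
        by_cases hc : G.mRank e + 1 = s.arr 10 e.1
        · simp [Prog.den, Expr.eval, hx, f12, hpe, h1, hown, hrk, hmod, f10, hc.symm, Fin.ext_iff]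
        · simp [Prog.den, Expr.eval, hx, f12, hpe, h1, hown, hrk, hmod, f10, hc]
      intro a
      rw [State.setReg_arr, hden a]
      by_cases hc : G.mRank e + 1 = s.arr 10 e.1 ∧ a = e.1
      · rw [if_pos hc]
        exact Or.inr ⟨p, e, hp, hc.2.symm, rfl, hcond.1 hc.1⟩
      · rw [if_neg hc]
        rcases hI a with ⟨ha, hno'⟩ | h
        · refine Or.inl ⟨ha, fun f hf hlt => ?_⟩
          by_cases hfi : (f.2 : ℕ) = i
          · rintro rfl
            -- Two unique best edges of one woman coincide, for each would strictly beat the other.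
            have hfe : f = e := by
              by_contra hne
              have h2 : f.2 = e.2 := by
                rw [hei]
                exact Fin.ext hfi
              have h3 := hf.2.2 e hu.1 h2.symm (Ne.symm hne)
              have h4 := hu.2 f hf.2.1 h2 hne
              omega
            subst hfe
            exact hc ⟨hcond.2 hf, rfl⟩
          · exact hno' f hf (by omega)
        · exact Or.inr h
  · simp only [Expr.cost]
    omega
  · intro s₂ h a
    rcases h a with ⟨h1, h2⟩ | h
    · exact Or.inl ⟨h1, fun e he => h2 e he e.2.isLt⟩
    · exact Or.inr h

/-- The edge at position `reg 8` is proposed to its woman. -/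
def proposeProg : Prog :=
  .seq (.assign 10 (.read 1 (.var 8)))
    (.seq (.assign 11 (.add (.read 9 (.var 8)) (.const 1)))
      (.ite (.read 11 (.var 10))
        (.ite (.lt (.var 11) (.read 11 (.var 10)))
          (.seq (.write 11 (.var 10) (.var 11)) (.write 12 (.var 10) (.add (.var 8) (.const 1))))
          (.ite (.eq (.var 11) (.read 11 (.var 10))) (.write 12 (.var 10) (.const 0)) .skip))
        (.seq (.write 11 (.var 10) (.var 11)) (.write 12 (.var 10) (.add (.var 8) (.const 1))))))

/-- The new entry `best` after a proposal of rank `k`. -/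
def newBest (k best : ℕ) : ℕ := if best = 0 then k + 1 else if k + 1 < best then k + 1 else best

/-- The new entry `eng` after a proposal of rank `k` by the edge at position `p`. -/
def newEng (k p best eng : ℕ) : ℕ :=
  if best = 0 then p + 1 else if k + 1 < best then p + 1 else if k + 1 = best then 0 else eng

/-- A strictly better proposal replaces the stored edge, an equally good one destroys uniqueness,
and a worse one changes nothing. The hypothesis that `e` is new prevents it from tying with itself.
-/
theorem WomanState.insert {Q : Finset G.Pair} {e : G.Pair} {p best eng : ℕ} (hp : G.At p e)
    (he : e ∉ Q) (h : G.WomanState Q e.2 best eng) :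
    G.WomanState (Insert.insert e Q) e.2 (newBest (G.wRank e) best)
      (newEng (G.wRank e) p best eng) := by
  right
  rcases h with ⟨rfl, rfl, hQ⟩ | ⟨g, hgQ, hge, hmin, rfl, hcase⟩
  · refine ⟨e, Finset.mem_insert_self _ _, rfl, fun f hf hfe => ?_, by simp [newBest],
      Or.inr ⟨p, hp, by simp [newEng], fun f hf hfe hne => ?_⟩⟩
    · rcases Finset.mem_insert.1 hf with rfl | hf
      · exact le_rfl
      · exact absurd hfe (hQ f hf)
    · exact absurd hfe (hQ f ((Finset.mem_insert.1 hf).resolve_left hne))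
  · rcases lt_trichotomy (G.wRank e) (G.wRank g) with hlt | heq | hlt
    · refine ⟨e, Finset.mem_insert_self _ _, rfl, fun f hf hfe => ?_, by simp [newBest, hlt],
        Or.inr ⟨p, hp, by simp [newEng, hlt], fun f hf hfe hne => ?_⟩⟩
      · rcases Finset.mem_insert.1 hf with rfl | hf
        · exact le_rfl
        · exact hlt.le.trans (hmin f hf hfe)
      · exact hlt.trans_le (hmin f ((Finset.mem_insert.1 hf).resolve_left hne) hfe)
    · refine ⟨g, Finset.mem_insert_of_mem hgQ, hge, fun f hf hfe => ?_, by simp [newBest, heq],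
        Or.inl ⟨by simp [newEng, heq], e, Finset.mem_insert_self _ _, ?_, rfl, heq⟩⟩
      · rcases Finset.mem_insert.1 hf with rfl | hf
        · exact heq.ge
        · exact hmin f hf hfe
      · rintro rfl
        exact he hgQ
    · have h1 : ¬ G.wRank e < G.wRank g := hlt.le.not_gt
      refine ⟨g, Finset.mem_insert_of_mem hgQ, hge, fun f hf hfe => ?_, by simp [newBest, h1], ?_⟩
      · rcases Finset.mem_insert.1 hf with rfl | hf
        · exact hlt.le
        · exact hmin f hf hfe
      · have h2 : newEng (G.wRank e) p (G.wRank g + 1) eng = eng := by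
          simp [newEng, h1, hlt.ne']
        rw [h2]
        rcases hcase with ⟨h3, f, hf, h4⟩ | ⟨q, hq, h3, h4⟩
        · exact Or.inl ⟨h3, f, Finset.mem_insert_of_mem hf, h4⟩
        · refine Or.inr ⟨q, hq, h3, fun f hf hfe hne => ?_⟩
          rcases Finset.mem_insert.1 hf with rfl | hf
          · exact hlt
          · exact h4 f hf hfe hne

theorem WomanState.insert_of_ne {Q : Finset G.Pair} {e : G.Pair} {b : Fin G.numWomen}
    {best eng : ℕ} (hb : e.2 ≠ b) (h : G.WomanState Q b best eng) :
    G.WomanState (Insert.insert e Q) b best eng := by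
  rcases h with ⟨h1, h2, hQ⟩ | ⟨g, hgQ, hge, hmin, h1, hcase⟩
  · refine Or.inl ⟨h1, h2, fun f hf => ?_⟩
    rcases Finset.mem_insert.1 hf with rfl | hf
    · exact hb
    · exact hQ f hf
  · refine Or.inr ⟨g, Finset.mem_insert_of_mem hgQ, hge, fun f hf hfe => ?_, h1, ?_⟩
    · rcases Finset.mem_insert.1 hf with rfl | hf
      · exact absurd hfe hb
      · exact hmin f hf hfe
    · rcases hcase with ⟨h3, f, hf, h4⟩ | ⟨q, hq, h3, h4⟩
      · exact Or.inl ⟨h3, f, Finset.mem_insert_of_mem hf, h4⟩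
      · refine Or.inr ⟨q, hq, h3, fun f hf hfe hne => ?_⟩
        rcases Finset.mem_insert.1 hf with rfl | hf
        · exact absurd hfe hb
        · exact h4 f hf hfe hne

theorem wRank_lt {e : G.Pair} (he : e ∈ G.edges) : G.wRank e < G.numMen := by
  obtain ⟨t, ht, hb⟩ := List.mem_flatten.1 ((G.mutual_adj _ _).1 (mem_edges.1 he))
  have h1 := List.findIdx_lt_length (p := fun t => decide (e.1 ∈ t)).2 ⟨t, ht, by simpa using hb⟩
  exact (h1.trans_le (length_le_length_flatten (G.womenPref_ne e.2))).trans_le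
    (length_flatten_le G.womenPref_nodup e.2)

theorem den_proposeProg (hw : G.Fits w) (hs : G.Holds s) {p : ℕ} {e : G.Pair} (hp : G.At p e)
    (h8 : s.reg 8 = p) (i : ℕ) :
    (proposeProg.den w s).arr 11 i =
      (if i = e.2 then newBest (G.wRank e) (s.arr 11 e.2) else s.arr 11 i) ∧
    (proposeProg.den w s).arr 12 i =
      (if i = e.2 then newEng (G.wRank e) p (s.arr 11 e.2) (s.arr 12 e.2) else s.arr 12 i) := by
  obtain ⟨hwom, -, -, hrk⟩ := hs.edge p e hp
  have hplt := hp.lt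
  have hn := numMen_le (G := G)
  have hwr := wRank_lt hp.mem_edges
  have h1 : 1 % 2 ^ w = 1 := hw.mod (by omega)
  have h2 : (p + 1) % 2 ^ w = p + 1 := hw.mod (by omega)
  have h3 : (G.wRank e + 1) % 2 ^ w = G.wRank e + 1 := hw.mod (by omega)
  unfold proposeProg newBest newEng
  by_cases hb : s.arr 11 e.2 = 0
  · by_cases hi : i = e.2 <;> simp [Prog.den, Expr.eval, h8, hwom, hrk, h1, h2, h3, hb, hi]
  · by_cases hlt : G.wRank e + 1 < s.arr 11 e.2
    · by_cases hi : i = e.2 <;> simp [Prog.den, Expr.eval, h8, hwom, hrk, h1, h2, h3, hb, hlt, hi]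
    · by_cases heq : G.wRank e + 1 = s.arr 11 e.2
      · by_cases hi : i = e.2 <;>
          simp [Prog.den, Expr.eval, h8, hwom, hrk, h1, h3, heq.symm, hi]
      · by_cases hi : i = e.2 <;>
          simp [Prog.den, Expr.eval, h8, hwom, hrk, h1, h3, hb, hlt, heq, hi]

end SMInstance

/-! ### One round of the search, and the whole search -/

namespace SMInstance

variable {G : SMInstance} {w : ℕ} {s s' : State}

/-- Sets register 7 to `reg 6` if this man has to propose further, the search being for the edge
number `reg 4`. -/
def testNeedProg : Prog :=
  .ite (.lt (.read 10 (.var 6)) (.sub (.read 0 (.add (.var 6) (.const 1))) (.read 0 (.var 6))))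
    (.ite (.read 13 (.var 6))
      (.ite (.eq (.var 6) (.read 8 (.var 4)))
        (.ite (.lt (.read 10 (.var 6)) (.add (.read 2 (.var 4)) (.const 1)))
          (.assign 7 (.var 6)) .skip) .skip)
      (.assign 7 (.var 6))) .skip

/-- Sets register 7 to a man who has to propose further, or to the number of men if there is
none. -/
def selectProg : Prog := .seq (.assign 7 (.var 0)) (.forUp 6 (.const 0) 0 testNeedProg)

theorem ManState.eq_zero_iff {r : Fin G.numMen → ℕ} {a : Fin G.numMen} {k : ℕ}
    (h : G.ManState r a k) : k = 0 ↔ ∀ e, G.Alive r e → e.1 ≠ a := by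
  rcases h with ⟨h, h'⟩ | ⟨p, e, -, h, h', ha⟩
  · exact ⟨fun _ => h', fun _ => h⟩
  · exact ⟨fun h0 => by omega, fun h0 => absurd h (h0 e ha)⟩

open scoped Classical in
theorem den_testNeedProg (hw : G.Fits w) (hs : G.Holds s) {p₀ : ℕ} {e₀ : G.Pair}
    (hp₀ : G.At p₀ e₀) (h4 : s.reg 4 = p₀) (a : Fin G.numMen)
    (hm : G.ManState (G.ties s) a (s.arr 13 a)) (h6 : s.reg 6 = a) :
    (testNeedProg.den w s).reg 7 = if G.Need e₀ (G.ties s) a then (a : ℕ) else s.reg 7 := by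
  obtain ⟨-, hrk, hown, -⟩ := hs.edge p₀ e₀ hp₀
  have hn := numMen_le (G := G)
  have hn' := numWomen_le (G := G)
  have ha := a.isLt
  have hplt := hp₀.lt
  have hdeg := mRank_lt_deg hp₀.mem_edges
  have hdeg' := deg_le e₀.1
  have h1 : 1 % 2 ^ w = 1 := hw.mod (by omega)
  have h2 : (G.mRank e₀ + 1) % 2 ^ w = G.mRank e₀ + 1 := hw.mod (by omega)
  have h3 : ((a : ℕ) + 1) % 2 ^ w = a + 1 := hw.mod (by omega)
  -- The degree is read off as the difference of consecutive start positions.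
  have hd : s.arr 0 (a + 1) - s.arr 0 a = G.deg a := by
    rw [hs.start _ ha, hs.start _ ha.le, st_succ]
    omega
  have hN : G.Need e₀ (G.ties s) a ↔ s.arr 10 a < G.deg a ∧ (s.arr 13 a = 0 ∨
      ((a : ℕ) = e₀.1 ∧ s.arr 10 a < G.mRank e₀ + 1)) := by
    rw [hm.eq_zero_iff, Need, Fin.ext_iff]
    rfl
  rw [if_congr hN rfl rfl]
  unfold testNeedProg
  by_cases c1 : s.arr 10 a < G.deg a
  · by_cases c2 : s.arr 13 a = 0
    · simp [Prog.den, Expr.eval, h6, h1, h3, hd, c1, c2]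
    · by_cases c3 : (a : ℕ) = e₀.1
      · by_cases c4 : s.arr 10 a < G.mRank e₀ + 1
        · rw [if_pos ⟨c1, Or.inr ⟨c3, c4⟩⟩]
          simp only [Prog.den, Expr.eval, h4, h6, hrk, hown, h1, h2, h3, hd]
          rw [if_pos c1, if_neg one_ne_zero, if_neg c2, if_pos c3, if_neg one_ne_zero, if_pos c4,
            if_neg one_ne_zero]
          simp
        · rw [if_neg (by tauto)]
          simp only [Prog.den, Expr.eval, h4, h6, hrk, hown, h1, h2, h3, hd]
          rw [if_pos c1, if_neg one_ne_zero, if_neg c2, if_pos c3, if_neg one_ne_zero, if_neg c4,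
            if_pos rfl]
      · simp [Prog.den, Expr.eval, h4, h6, hown, h1, h3, hd, c1, c2, c3]
  · simp [Prog.den, Expr.eval, h6, h1, h3, hd, c1]

theorem run_selectProg (hw : G.Fits w) (hE : 0 < G.nEdges) (hs : G.Holds s) {p₀ : ℕ} {e₀ : G.Pair}
    (hp₀ : G.At p₀ e₀) (h4 : s.reg 4 = p₀)
    (hm : ∀ a : Fin G.numMen, G.ManState (G.ties s) a (s.arr 13 a)) :
    Run w selectProg s (60 * G.nVerts) fun s' =>
      (s'.reg 7 = G.numMen ∧ ∀ a, ¬ G.Need e₀ (G.ties s) a) ∨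
        ∃ a : Fin G.numMen, s'.reg 7 = a ∧ G.Need e₀ (G.ties s) a := by
  classical
  have hn := numMen_le (G := G)
  have hpos := nVerts_pos hE
  refine Run.seq (T₁ := 2) (T₂ := 6 + 50 * G.numMen) (R := fun s₁ => s₁ = s.setReg 7 G.numMen)
    (Run.of_loopFree rfl (by decide) ?_) ?_ (by omega)
  · simp [Prog.den, Expr.eval, hs.reg0]
  rintro s₁ hf₁ rfl
  refine Run.forUp (fun i s' => (s'.reg 7 = G.numMen ∧
      ∀ a : Fin G.numMen, (a : ℕ) < i → ¬ G.Need e₀ (G.ties s) a) ∨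
      ∃ a : Fin G.numMen, s'.reg 7 = a ∧ G.Need e₀ (G.ties s) a) 0 G.numMen 42
    (by simp [Expr.eval]) (by simp [hs.reg0]) (by decide) (by decide) (by decide) (Nat.zero_le _)
    (hw.lt (by omega)) ?_ ?_ ?_ ?_
  · exact Or.inl ⟨by simp, fun a h => absurd h (Nat.not_lt_zero _)⟩
  · intro i s₂ _ hi hf₂ hx hI
    have hs₂ := (hs.of_frame hf₁ rfl).of_frame hf₂ rfl
    have ht : G.ties s₂ = G.ties s := by
      unfold ties
      rw [hf₂.2 10 (by decide), hf₁.2 10 (by decide)]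
    refine Run.of_loopFree rfl (by decide) ?_
    have hden := den_testNeedProg hw hs₂ hp₀ (by rw [hf₂.1 4 (by decide), hf₁.1 4 (by decide), h4])
      ⟨i, hi⟩ (by
        rw [ht, hf₂.2 13 (by decide), hf₁.2 13 (by decide)]
        exact hm _) hx
    rw [ht] at hden
    rw [State.setReg_reg, if_neg (by decide), hden]
    split_ifs with hN
    · exact Or.inr ⟨_, rfl, hN⟩
    · refine hI.imp_left fun h => ⟨h.1, fun a ha => ?_⟩
      by_cases hai : (a : ℕ) = i
      · subst hai
        exact hN
      · exact h.2 a (by omega)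
  · simp only [Expr.cost]
    omega
  · exact fun s₂ h => h.imp_left fun h => ⟨h.1, fun a => h.2 a a.isLt⟩

/-- The man `reg 7` proposes to his next tie. -/
def advanceProg : Prog :=
  .seq (.write 10 (.var 7) (.add (.read 10 (.var 7)) (.const 1)))
    (.seq (.assign 9 (.read 0 (.add (.var 7) (.const 1))))
      (.forUp 8 (.read 0 (.var 7)) 9
        (.ite (.eq (.add (.read 2 (.var 8)) (.const 1)) (.read 10 (.var 7))) proposeProg .skip)))

open scoped Classical in
/-- The proposals made when the man `a` has proposed along the edges of his next tie before the
position `j`. -/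
noncomputable def partialProps (G : SMInstance) (r : Fin G.numMen → ℕ) (a : Fin G.numMen) (j : ℕ) :
    Finset G.Pair :=
  G.edges.filter fun e => G.mRank e < r e.1 ∨ (e.1 = a ∧ G.mRank e = r a ∧ ∃ p < j, G.At p e)

theorem mem_partialProps {r : Fin G.numMen → ℕ} {a : Fin G.numMen} {j : ℕ} {e : G.Pair} :
    e ∈ G.partialProps r a j ↔ e ∈ G.edges ∧
      (G.mRank e < r e.1 ∨ (e.1 = a ∧ G.mRank e = r a ∧ ∃ p < j, G.At p e)) := by
  classical
  exact Finset.mem_filter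

theorem partialProps_start (r : Fin G.numMen → ℕ) (a : Fin G.numMen) :
    G.partialProps r a (G.st a) = G.props r := by
  ext e
  rw [mem_partialProps, mem_props]
  refine and_congr_right fun _ => ⟨?_, Or.inl⟩
  rintro (h | ⟨rfl, -, p, hlt, hp⟩)
  · exact h
  · have := hp.st_le
    omega

theorem partialProps_end (r : Fin G.numMen → ℕ) (a : Fin G.numMen) :
    G.partialProps r a (G.st (a + 1)) = G.props (Function.update r a (r a + 1)) := by
  ext e
  rw [mem_partialProps, mem_props]
  refine and_congr_right fun he => ?_
  by_cases hea : e.1 = a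
  · subst hea
    rw [Function.update_self]
    obtain ⟨p, hp⟩ := exists_at_of_mem he
    constructor
    · rintro (h | ⟨-, h, -⟩) <;> omega
    · intro h
      by_cases h' : G.mRank e < r e.1
      · exact Or.inl h'
      · exact Or.inr ⟨rfl, by omega, p, hp.st_le.2, hp⟩
  · simp [hea]

theorem partialProps_succ_of_eq {r : Fin G.numMen → ℕ} {j : ℕ} {e : G.Pair} (hj : G.At j e)
    (he : G.mRank e = r e.1) :
    G.partialProps r e.1 (j + 1) = Insert.insert e (G.partialProps r e.1 j) := by
  ext f
  rw [Finset.mem_insert, mem_partialProps, mem_partialProps]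
  constructor
  · rintro ⟨hf, h | ⟨h1, h2, p, hp, hpf⟩⟩
    · exact Or.inr ⟨hf, Or.inl h⟩
    · by_cases hpj : p = j
      · subst hpj
        exact Or.inl (hpf.right_unique hj)
      · exact Or.inr ⟨hf, Or.inr ⟨h1, h2, p, by omega, hpf⟩⟩
  · rintro (rfl | ⟨hf, h | ⟨h1, h2, p, hp, hpf⟩⟩)
    · exact ⟨hj.mem_edges, Or.inr ⟨rfl, he, j, by omega, hj⟩⟩
    · exact ⟨hf, Or.inl h⟩
    · exact ⟨hf, Or.inr ⟨h1, h2, p, by omega, hpf⟩⟩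

theorem partialProps_succ_of_ne {r : Fin G.numMen → ℕ} {j : ℕ} {e : G.Pair} (hj : G.At j e)
    (he : G.mRank e ≠ r e.1) : G.partialProps r e.1 (j + 1) = G.partialProps r e.1 j := by
  ext f
  rw [mem_partialProps, mem_partialProps]
  refine and_congr_right fun hf => or_congr_right ⟨?_, ?_⟩
  · rintro ⟨h1, h2, p, hp, hpf⟩
    refine ⟨h1, h2, p, lt_of_le_of_ne (by omega) ?_, hpf⟩
    rintro rfl
    rw [hpf.right_unique hj] at h2
    exact he h2
  · rintro ⟨h1, h2, p, hp, hpf⟩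
    exact ⟨h1, h2, p, by omega, hpf⟩

theorem notMem_partialProps {r : Fin G.numMen → ℕ} {j : ℕ} {e : G.Pair} (hj : G.At j e)
    (he : G.mRank e = r e.1) : e ∉ G.partialProps r e.1 j := by
  rw [mem_partialProps]
  rintro ⟨-, h | ⟨-, -, p, hp, hpe⟩⟩
  · omega
  · have := hpe.left_unique hj
    omega

/-- The whole list of the man is scanned, at most `numWomen` entries, and only edges of the new tie
are proposed. `partialProps` interpolates between the proposals before and after, so each iteration
inserts at most one edge. -/
theorem run_advanceProg (hw : G.Fits w) (hE : 0 < G.nEdges) (hs : G.Holds s) {a : Fin G.numMen}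
    (h7 : s.reg 7 = a) (hlt : G.ties s a < G.deg a)
    (hb : ∀ b : Fin G.numWomen, G.WomanState (G.props (G.ties s)) b (s.arr 11 b) (s.arr 12 b)) :
    Run w advanceProg s (70 * G.nVerts) fun s' =>
      G.ties s' = Function.update (G.ties s) a (G.ties s a + 1) ∧
      ∀ b : Fin G.numWomen, G.WomanState (G.props (G.ties s')) b (s'.arr 11 b) (s'.arr 12 b) := by
  have hn := numMen_le (G := G)
  have hpos := nVerts_pos hE
  have hsum : G.nVerts = G.numMen + G.numWomen := rfl
  have hdeg := deg_le a
  have ha := a.isLt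
  have h1 : 1 % 2 ^ w = 1 := hw.mod (by omega)
  have h2 : ((a : ℕ) + 1) % 2 ^ w = a + 1 := hw.mod (by omega)
  have h10 : s.arr 10 a = G.ties s a := rfl
  have h3 : (G.ties s a + 1) % 2 ^ w = G.ties s a + 1 := hw.mod (by omega)
  have hst := st_succ (G := G) a
  have hstle := st_le (G := G) (i := a + 1) ha
  refine Run.seq (T₁ := 6) (T₂ := 13 + 58 * G.numWomen)
    (R := fun s₁ => s₁ = s.setArr 10 a (G.ties s a + 1)) (Run.of_loopFree rfl (by decide) ?_) ?_
    (by omega)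
  · simp only [Prog.den, Expr.eval, h7, h1, h10, h3]
  rintro s₁ hf₁ rfl
  have hs₁ := hs.of_frame hf₁ rfl
  set s₁ := s.setArr 10 a (G.ties s a + 1) with hs₁def
  have hties : G.ties s₁ = Function.update (G.ties s) a (G.ties s a + 1) := by
    funext x
    simp [hs₁def, ties, Function.update_apply, Fin.ext_iff]
  refine Run.seq (T₁ := 5) (T₂ := 8 + 58 * G.numWomen)
    (R := fun s₂ => s₂ = s₁.setReg 9 (G.st (a + 1))) (Run.of_loopFree rfl (by decide) ?_) ?_
    (by omega)
  · have h7' : s₁.reg 7 = a := h7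
    simp only [Prog.den, Expr.eval, h7', h1, h2, hs₁.start _ ha]
  rintro s₂ hf₂ rfl
  refine Run.imp (R := fun s' => ∀ b : Fin G.numWomen,
      G.WomanState (G.partialProps (G.ties s) a (G.st (a + 1))) b (s'.arr 11 b) (s'.arr 12 b))
    (Run.forUp (fun j s' => ∀ b : Fin G.numWomen,
      G.WomanState (G.partialProps (G.ties s) a j) b (s'.arr 11 b) (s'.arr 12 b))
    (G.st a) (G.st (a + 1)) 50 ?_ (by simp) (by decide) (by decide) (by decide) (by omega)
    (hw.lt (by omega)) ?_ ?_ ?_ ?_) le_rfl ?_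
  · simp [Expr.eval, hs₁def, h7, hs.start _ ha.le]
  · intro b
    rw [partialProps_start]
    simpa [hs₁def] using hb b
  · intro j s₃ hj hj' hf₃ hx hI
    obtain ⟨e, he, rfl⟩ := exists_at_of_st_le hj hj'
    have hs₃ := (hs₁.of_frame hf₂ rfl).of_frame hf₃ rfl
    have k10 : s₃.arr 10 e.1 = G.ties s e.1 + 1 := by
      rw [hf₃.2 10 (by decide)]
      simp [hs₁def]
    have k7 : s₃.reg 7 = e.1 := by
      rw [hf₃.1 7 (by decide)]
      simpa [hs₁def] using h7
    obtain ⟨-, hrk, -, -⟩ := hs₃.edge j e he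
    have hdeg' := mRank_lt_deg he.mem_edges
    have h4 : (G.mRank e + 1) % 2 ^ w = G.mRank e + 1 := hw.mod (by omega)
    refine Run.of_loopFree rfl (by decide) ?_
    rw [Prog.den]
    have hev : (Expr.eq (.add (.read 2 (.var 8)) (.const 1)) (.read 10 (.var 7))).eval w s₃ =
        if G.mRank e + 1 = G.ties s e.1 + 1 then 1 else 0 := by
      simp only [Expr.eval, hx, k7, k10, hrk, h1, h4]
    rw [hev]
    by_cases hc : G.mRank e = G.ties s e.1
    · rw [if_pos (show G.mRank e + 1 = G.ties s e.1 + 1 by omega), if_neg one_ne_zero]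
      intro b
      obtain ⟨d1, d2⟩ := den_proposeProg hw hs₃ he hx b
      rw [State.setReg_arr, d1, d2, partialProps_succ_of_eq he hc]
      by_cases hbe : b = e.2
      · subst hbe
        rw [if_pos rfl, if_pos rfl]
        exact (hI _).insert he (notMem_partialProps he hc)
      · have : (b : ℕ) ≠ e.2 := fun h => hbe (Fin.ext h)
        rw [if_neg this, if_neg this]
        exact (hI b).insert_of_ne (Ne.symm hbe)
    · rw [if_neg (show ¬ G.mRank e + 1 = G.ties s e.1 + 1 by omega), if_pos rfl,
        partialProps_succ_of_ne he hc]
      exact hI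
  · simp only [Expr.cost, hst, Nat.add_sub_cancel_left]
    omega
  · exact fun _ h => h
  · intro s₃ hf₃ hI
    have ht : G.ties s₃ = Function.update (G.ties s) a (G.ties s a + 1) := by
      rw [← hties]
      unfold ties
      rw [hf₃.2 10 (by decide), State.setReg_arr]
    refine ⟨ht, fun b => ?_⟩
    rw [ht, ← partialProps_end]
    exact hI b

/-- One step of the search. -/
def stepProg : Prog :=
  .seq aliveProg (.seq selectProg (.ite (.lt (.var 7) (.var 0)) advanceProg .skip))

/-- The state of the search for the least `P`-set containing `e₀`. -/
structure Searching (G : SMInstance) (e₀ : G.Pair) (s : State) : Prop where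
  lower : G.LowerBound e₀ (G.ties s)
  le_deg : ∀ a, G.ties s a ≤ G.deg a
  woman : ∀ b : Fin G.numWomen, G.WomanState (G.props (G.ties s)) b (s.arr 11 b) (s.arr 12 b)

theorem Searching.congr {e₀ : G.Pair} (h : G.Searching e₀ s) (h10 : s'.arr 10 = s.arr 10)
    (h11 : s'.arr 11 = s.arr 11) (h12 : s'.arr 12 = s.arr 12) : G.Searching e₀ s' := by
  have ht : G.ties s' = G.ties s := by
    unfold ties
    rw [h10]
  exact ⟨ht ▸ h.lower, ht ▸ h.le_deg, by rw [ht, h11, h12]; exact h.woman⟩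

/-- Each round either certifies a fixpoint and leaves the counters alone, or raises their sum by
exactly one. -/
theorem run_stepProg (hw : G.Fits w) (hE : 0 < G.nEdges) (hs : G.Holds s) {p₀ : ℕ} {e₀ : G.Pair}
    (hp₀ : G.At p₀ e₀) (h4 : s.reg 4 = p₀) (h : G.Searching e₀ s) :
    Run w stepProg s (194 * G.nVerts) fun s' => G.Searching e₀ s' ∧
      ((G.ties s' = G.ties s ∧ ∀ a, ¬ G.Need e₀ (G.ties s) a) ∨
        (∃ a, G.Need e₀ (G.ties s) a) ∧ ∑ a, G.ties s' a = ∑ a, G.ties s a + 1) := by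
  have hn := numMen_le (G := G)
  have hpos := nVerts_pos hE
  refine Run.seq (run_aliveProg hw hE hs h.woman) (T₂ := 60 * G.nVerts + 74 * G.nVerts)
    (fun s₁ hf₁ hm => ?_) (by omega)
  have hs₁ := hs.of_frame hf₁ rfl
  have hS₁ : G.Searching e₀ s₁ :=
    h.congr (hf₁.2 10 (by decide)) (hf₁.2 11 (by decide)) (hf₁.2 12 (by decide))
  have ht₁ : G.ties s₁ = G.ties s := by
    unfold ties
    rw [hf₁.2 10 (by decide)]
  rw [← ht₁] at hm ⊢
  have h4₁ : s₁.reg 4 = p₀ := by rw [hf₁.1 4 (by decide), h4]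
  refine Run.seq (run_selectProg hw hE hs₁ hp₀ h4₁ hm) (fun s₂ hf₂ hsel => ?_) le_rfl
  have hs₂ := hs₁.of_frame hf₂ rfl
  have hS₂ : G.Searching e₀ s₂ :=
    hS₁.congr (hf₂.2 10 (by decide)) (hf₂.2 11 (by decide)) (hf₂.2 12 (by decide))
  have ht₂ : G.ties s₂ = G.ties s₁ := by
    unfold ties
    rw [hf₂.2 10 (by decide)]
  rw [← ht₂] at hsel ⊢
  refine Run.ite (T₁ := 70 * G.nVerts) (fun hc => ?_) (fun hc => ?_)
    (by simp only [Expr.cost]; omega)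
  · rcases hsel with ⟨h7, -⟩ | ⟨a, h7, ha⟩
    · simp [Expr.eval, h7, hs₂.reg0] at hc
    refine (run_advanceProg hw hE hs₂ h7 ha.1 hS₂.woman).imp le_rfl ?_
    rintro s₃ - ⟨ht, hwom⟩
    refine ⟨⟨?_, ?_, hwom⟩, Or.inr ⟨⟨a, ha⟩, ?_⟩⟩
    · rw [ht]
      exact lowerBound_update hS₂.lower ha
    · rw [ht]
      exact update_le_deg hS₂.le_deg ha
    · rw [ht]
      exact sum_update_add_one _ _
  · rcases hsel with ⟨h7, hno⟩ | ⟨a, h7, ha⟩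
    · exact Run.of_loopFree rfl (by simp [Prog.maxCost]; omega) ⟨hS₂, Or.inl ⟨rfl, hno⟩⟩
    · simp [Expr.eval, h7, hs₂.reg0] at hc

/-- The search for the least `P`-set containing the edge number `reg 4`. -/
def searchProg : Prog :=
  .seq (clearProg 10 0) (.seq (clearProg 11 1) (.seq (clearProg 12 1)
    (.seq (.forUp 5 (.const 0) 3 stepProg) aliveProg)))

theorem run_searchProg (hw : G.Fits w) (hE : 0 < G.nEdges) (hs : G.Holds s) {p₀ : ℕ} {e₀ : G.Pair}
    (hp₀ : G.At p₀ e₀) (h4 : s.reg 4 = p₀) :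
    Run w searchProg s (400 * (G.nVerts * G.nEdges)) fun s' => G.Searching e₀ s' ∧
      (∀ a, ¬ G.Need e₀ (G.ties s') a) ∧
      ∀ a : Fin G.numMen, G.ManState (G.ties s') a (s'.arr 13 a) := by
  have hn := numMen_le (G := G)
  have hn' := numWomen_le (G := G)
  have hpos := nVerts_pos hE
  have hsum : G.nVerts = G.numMen + G.numWomen := rfl
  refine Run.seq (run_clearProg (by decide) hs.reg0 (hw.lt (by omega)))
    (T₂ := (6 + 11 * G.numWomen) + ((6 + 11 * G.numWomen) +
      ((6 + G.nEdges * (194 * G.nVerts + 8)) + 60 * G.nVerts))) (fun s₁ hf₁ h10 => ?_) ?_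
  swap
  · have h1 : G.nVerts ≤ G.nVerts * G.nEdges := Nat.le_mul_of_pos_right _ hE
    have h2 : G.nEdges ≤ G.nVerts * G.nEdges := Nat.le_mul_of_pos_left _ (by omega)
    have e1 : G.nEdges * (194 * G.nVerts + 8) = 194 * (G.nVerts * G.nEdges) + 8 * G.nEdges := by
      ring
    rw [e1]
    omega
  have hs₁ := hs.of_frame hf₁ rfl
  refine Run.seq (run_clearProg (by decide) hs₁.reg1 (hw.lt (by omega)))
    (fun s₂ hf₂ h11 => ?_) le_rfl
  have hs₂ := hs₁.of_frame hf₂ rfl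
  refine Run.seq (run_clearProg (by decide) hs₂.reg1 (hw.lt (by omega)))
    (fun s₃ hf₃ h12 => ?_) le_rfl
  have hs₃ := hs₂.of_frame hf₃ rfl
  have ht₃ : G.ties s₃ = fun _ => 0 := by
    funext a
    rw [ties, hf₃.2 10 (by decide), hf₂.2 10 (by decide)]
    exact h10 a a.isLt
  have hS₃ : G.Searching e₀ s₃ := by
    refine ⟨ht₃ ▸ lowerBound_zero e₀, fun a => ?_, fun b => Or.inl ⟨?_, h12 b b.isLt, ?_⟩⟩
    · rw [ht₃]
      exact Nat.zero_le _
    · rw [hf₃.2 11 (by decide)]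
      exact h11 b b.isLt
    · intro f hf
      rw [ht₃] at hf
      exact absurd (mem_props.1 hf).2 (Nat.not_lt_zero _)
  -- The loop always runs `m` rounds, idling once a fixpoint is reached. After `i` rounds the
  -- counters sum to at least `i` unless this has happened.
  refine Run.seq (Run.forUp (fun i s' => G.Searching e₀ s' ∧
      (i ≤ ∑ a, G.ties s' a ∨ ∀ a, ¬ G.Need e₀ (G.ties s') a)) 0 G.nEdges (194 * G.nVerts)
    (by simp [Expr.eval]) hs₃.reg3 (by decide) (by decide) (by decide) (Nat.zero_le _)
    (hw.lt (by omega)) ?_ ?_ ?_ fun s' h => h) (fun s₄ hf₄ h => ?_) le_rfl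
  · exact ⟨hS₃.congr rfl rfl rfl, Or.inl (Nat.zero_le _)⟩
  · intro i s₄ _ hi hf₄ hx hI
    have k4 : s₄.reg 4 = p₀ := by
      rw [hf₄.1 4 (by decide), hf₃.1 4 (by decide), hf₂.1 4 (by decide), hf₁.1 4 (by decide), h4]
    refine (run_stepProg hw hE (hs₃.of_frame hf₄ rfl) hp₀ k4 hI.1).imp le_rfl ?_
    rintro s₅ - ⟨hS₅, hcase⟩
    refine ⟨hS₅.congr rfl rfl rfl, ?_⟩
    change i + 1 ≤ ∑ a, G.ties s₅ a ∨ ∀ a, ¬ G.Need e₀ (G.ties s₅) a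
    rcases hcase with ⟨ht, hno⟩ | ⟨⟨a, ha⟩, hsum'⟩
    · rw [ht]
      exact Or.inr hno
    · rcases hI.2 with h | h
      · exact Or.inl (by omega)
      · exact absurd ha (h a)
  · simp only [Expr.cost, Nat.sub_zero]
    omega
  · obtain ⟨hS₄, h⟩ := h
    have hfix : ∀ a, ¬ G.Need e₀ (G.ties s₄) a := by
      rcases h with h | h
      -- A sum of at least `m`, the sum of the degrees, leaves no counter below its degree, so no
      -- man can move on.
      · intro a ha
        have h1 := Finset.sum_lt_sum (fun x (_ : x ∈ Finset.univ) => hS₄.le_deg x)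
          ⟨a, Finset.mem_univ _, ha.1⟩
        rw [sum_deg] at h1
        omega
      · exact h
    have hs₄ := hs₃.of_frame hf₄ rfl
    -- Array 13 is recomputed because the last round may have advanced a man after it was filled.
    refine (run_aliveProg hw hE hs₄ hS₄.woman).imp le_rfl fun s₅ hf₅ hm => ?_
    have ht : G.ties s₅ = G.ties s₄ := by
      unfold ties
      rw [hf₅.2 10 (by decide)]
    rw [ht]
    exact ⟨hS₄.congr (hf₅.2 10 (by decide)) (hf₅.2 11 (by decide)) (hf₅.2 12 (by decide)), hfix, hm⟩

end SMInstance

/-! ### Testing the result of a search and storing it as a row -/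

namespace SMInstance

variable {G : SMInstance} {w : ℕ} {s s' : State}

/-- `x` is `v` if `P` holds, and `0` otherwise. -/
def IsFlag (P : Prop) (v x : ℕ) : Prop := (P → x = v) ∧ (¬ P → x = 0)

theorem IsFlag.congr {P Q : Prop} {v x : ℕ} (h : IsFlag P v x) (hPQ : P ↔ Q) : IsFlag Q v x :=
  ⟨fun hQ => h.1 (hPQ.2 hQ), fun hQ => h.2 fun hP => hQ (hPQ.1 hP)⟩

/-- A loop whose body clears the register `z` unless a property holds computes a conjunction. -/
theorem run_forUp_flag (P : ℕ → Prop) {h H z B : ℕ} {body : Prog} (hH : s.reg h = H)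
    (hw : H < 2 ^ w) (hlf : body.loopFree = true) (hB : body.maxCost ≤ B)
    (h6 : 6 ∉ body.regs) (hh : h ∉ body.regs) (hh6 : h ≠ 6) (hz : z ≠ 6)
    (hbody : ∀ i s', i < H → Frame (Prog.forUp 6 (.const 0) h body) s s' → s'.reg 6 = i →
      IsFlag (P i) (s'.reg z) ((body.den w s').reg z)) :
    Run w (Prog.forUp 6 (.const 0) h body) s (6 + H * (B + 8)) fun s' =>
      IsFlag (∀ i < H, P i) (s.reg z) (s'.reg z) := by
  refine Run.forUp (fun i s' => IsFlag (∀ j < i, P j) (s.reg z) (s'.reg z)) 0 H B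
    (by simp [Expr.eval]) hH h6 hh hh6 (Nat.zero_le _) hw (by simp [hz, IsFlag]) ?_ ?_
    fun _ h => h
  · intro i s₁ _ hi hf hx hI
    refine Run.of_loopFree hlf hB ?_
    have hb := hbody i s₁ hi hf hx
    rw [State.setReg_reg, if_neg hz]
    have : (∀ j < i + 1, P j) ↔ P i ∧ ∀ j < i, P j := by
      constructor
      · exact fun h => ⟨h i (by omega), fun j hj => h j (by omega)⟩
      · rintro ⟨h1, h2⟩ j hj
        rcases Nat.lt_succ_iff_lt_or_eq.1 hj with hj | rfl
        · exact h2 j hj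
        · exact h1
    refine IsFlag.congr ⟨fun h => (hb.1 h.1).trans (hI.1 h.2), fun h => ?_⟩ this.symm
    by_cases h1 : P i
    · exact (hb.1 h1).trans (hI.2 fun h2 => h ⟨h1, h2⟩)
    · exact hb.2 h1
  · simp only [Expr.cost, Nat.sub_zero]
    omega

open scoped Classical in
/-- The edges stored for the men. -/
noncomputable def selection (G : SMInstance) (has : ℕ → ℕ) : Finset G.Pair :=
  G.edges.filter fun e => ∃ p, G.At p e ∧ has e.1 = p + 1

theorem mem_selection {has : ℕ → ℕ} {e : G.Pair} :
    e ∈ G.selection has ↔ ∃ p, G.At p e ∧ has e.1 = p + 1 := by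
  classical
  rw [selection, Finset.mem_filter]
  exact and_iff_right_of_imp fun ⟨p, hp, _⟩ => hp.mem_edges

theorem isSelection_selection {r : Fin G.numMen → ℕ} {has : ℕ → ℕ}
    (h : ∀ a : Fin G.numMen, G.ManState r a (has a)) : G.IsSelection r (G.selection has) := by
  refine ⟨fun e he => ?_, fun e he => ?_, fun e he f hf hef => ?_⟩
  · obtain ⟨p, hp, hpe⟩ := mem_selection.1 he
    rcases h e.1 with ⟨h0, -⟩ | ⟨q, f, hq, -, hqf, hf⟩
    · omega
    · have : p = q := by omega
      subst this
      rwa [hp.right_unique hq]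
  · rcases h e.1 with ⟨-, h0⟩ | ⟨q, f, hq, hfe, hqf, hf⟩
    · exact absurd rfl (h0 e he)
    · exact ⟨f, mem_selection.2 ⟨q, hq, by rw [hfe, hqf]⟩, hfe⟩
  · obtain ⟨p, hp, hpe⟩ := mem_selection.1 he
    obtain ⟨q, hq, hqf⟩ := mem_selection.1 hf
    rw [hef, hqf] at hpe
    have : q = p := by omega
    subst this
    exact hp.right_unique hq

/-- Clears register 13 if the woman `reg 6` has received a proposal but is not matched. -/
def testCoverProg : Prog :=
  .ite (.read 11 (.var 6))
    (.ite (.read 12 (.var 6))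
      (.ite (.eq (.read 13 (.read 8 (.sub (.read 12 (.var 6)) (.const 1)))) (.read 12 (.var 6)))
        .skip (.assign 13 (.const 0)))
      (.assign 13 (.const 0)))
    .skip

/-- Sets register 13 to `1` if all women with a proposal are matched, and to `0` otherwise. -/
def coverProg : Prog := .seq (.assign 13 (.const 1)) (.forUp 6 (.const 0) 1 testCoverProg)

/-- A woman can be matched only along her unique best proposal, so it suffices to check that its man
has selected exactly this edge. -/
theorem den_testCoverProg (hw : G.Fits w) (hE : 0 < G.nEdges) (hs : G.Holds s)
    {r : Fin G.numMen → ℕ} {M : Finset G.Pair} (b : Fin G.numWomen) (h6 : s.reg 6 = b)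
    (hM : G.selection (s.arr 13) = M) (hsel : G.IsSelection r M)
    (hb : G.WomanState (G.props r) b (s.arr 11 b) (s.arr 12 b)) :
    IsFlag (∀ f ∈ G.props r, f.2 = b → ∃ e ∈ M, e.2 = b) (s.reg 13)
      ((testCoverProg.den w s).reg 13) := by
  subst hM
  have hn := numMen_le (G := G)
  have h1 : 1 % 2 ^ w = 1 := hw.mod (by omega)
  have hbest := hb.best
  unfold testCoverProg
  by_cases c1 : s.arr 11 b = 0
  · refine ⟨fun _ => ?_, fun h => absurd (fun f hf hfb => absurd hfb (hbest.1 c1 f hf)) h⟩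
    simp [Prog.den, Expr.eval, h6, c1]
  · obtain ⟨f, hf, hfb⟩ : ∃ f ∈ G.props r, f.2 = b := by
      by_contra! hcon
      exact c1 (hbest.2 hcon)
    have hiff : (∀ f ∈ G.props r, f.2 = b → ∃ e ∈ G.selection (s.arr 13), e.2 = b) ↔
        ∃ e ∈ G.selection (s.arr 13), e.2 = b := ⟨fun h => h f hf hfb, fun h _ _ _ => h⟩
    refine IsFlag.congr ?_ hiff.symm
    rcases hb.eng with ⟨h0, hno⟩ | ⟨p, e, hp, heb, hpe, hu⟩
    · refine ⟨fun ⟨e, he, heb⟩ => absurd heb (hno e (hsel.1 e he).2), fun _ => ?_⟩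
      simp [Prog.den, Expr.eval, h6, c1, h0]
    · obtain ⟨-, -, hown, -⟩ := hs.edge p e hp
      have hiff' : (∃ e ∈ G.selection (s.arr 13), e.2 = b) ↔ s.arr 13 e.1 = p + 1 := by
        constructor
        · rintro ⟨f, hf, hfb⟩
          have hfe : f = e := by
            by_contra hne
            have h2 := (hsel.1 f hf).2.2 e hu.1 (heb.trans hfb.symm) (Ne.symm hne)
            have h3 := hu.2 f (hsel.1 f hf).2.1 (hfb.trans heb.symm) hne
            omega
          subst hfe
          obtain ⟨q, hq, hqf⟩ := mem_selection.1 hf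
          rw [hqf, hq.left_unique hp]
        · exact fun h => ⟨e, mem_selection.2 ⟨p, hp, h⟩, heb⟩
      refine IsFlag.congr ⟨fun c2 => ?_, fun c2 => ?_⟩ hiff'.symm <;>
        simp [Prog.den, Expr.eval, h6, c1, hpe, h1, hown, c2]

theorem run_coverProg (hw : G.Fits w) (hE : 0 < G.nEdges) (hs : G.Holds s)
    {r : Fin G.numMen → ℕ} {M : Finset G.Pair} (hM : G.selection (s.arr 13) = M)
    (hsel : G.IsSelection r M)
    (hb : ∀ b : Fin G.numWomen, G.WomanState (G.props r) b (s.arr 11 b) (s.arr 12 b)) :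
    Run w coverProg s (50 * G.nVerts) fun s' => IsFlag (G.Covers r M) 1 (s'.reg 13) := by
  have hn := numMen_le (G := G)
  have hn' := numWomen_le (G := G)
  have hpos := nVerts_pos hE
  have h1 : 1 % 2 ^ w = 1 := hw.mod (by omega)
  refine Run.seq (T₁ := 2) (T₂ := 6 + G.numWomen * 38) (R := fun s₁ => s₁ = s.setReg 13 1)
    (Run.of_loopFree rfl (by decide) ?_) ?_ (by omega)
  · simp [Prog.den, Expr.eval, h1]
  rintro s₁ hf₁ rfl
  refine (run_forUp_flag (z := 13) (B := 30) (fun i => ∀ f ∈ G.props r, (f.2 : ℕ) = i →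
    ∃ e ∈ M, (e.2 : ℕ) = i) (H := G.numWomen) (by simp [hs.reg1]) (hw.lt (by omega)) rfl
    (by decide) (by decide) (by decide) (by decide) (by decide) ?_).imp le_rfl ?_
  · intro i s₂ hi hf₂ hx
    have key := den_testCoverProg hw hE ((hs.of_frame hf₁ rfl).of_frame hf₂ rfl) ⟨i, hi⟩ hx
      (M := M) (r := r) (by rw [hf₂.2 13 (by decide), hf₁.2 13 (by decide), hM]) hsel (by
        rw [hf₂.2 11 (by decide), hf₁.2 11 (by decide), hf₂.2 12 (by decide),
          hf₁.2 12 (by decide)]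
        exact hb _)
    simpa only [Fin.ext_iff] using key
  · intro s₂ _ h
    rw [State.setReg_reg, if_pos rfl] at h
    refine h.congr ⟨fun h f hf => ?_, fun h i _ f hf hfi => ?_⟩
    · obtain ⟨e, he, hef⟩ := h f.2 f.2.isLt f hf rfl
      exact ⟨e, he, Fin.ext hef⟩
    · obtain ⟨e, he, hef⟩ := h f hf
      exact ⟨e, he, by rw [hef, hfi]⟩

/-- The cells from `c` on of arrays 6 and 14 hold the partners and their ranks, increased by one,
in `M`. -/
def Row (G : SMInstance) (s : State) (c : ℕ) (M : Finset G.Pair) : Prop :=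
  ∀ a : Fin G.numMen,
    (∃ e ∈ M, e.1 = a ∧ s.arr 6 (c + a) = e.2 + 1 ∧ s.arr 14 (c + a) = G.mRank e + 1) ∨
      ((∀ e ∈ M, e.1 ≠ a) ∧ s.arr 6 (c + a) = 0 ∧ s.arr 14 (c + a) = 0)

/-- Ranks are stored increased by one, with `0` for unmatched. Although `0` is numerically smallest,
the comparison is correct because both matchings match the same men. -/
theorem Row.le_iff {c d : ℕ} {M N : Finset G.Pair} (hM : G.Row s c M) (hN : G.Row s d N)
    (hMs : M ∈ G.superStable) (hNs : N ∈ G.superStable) :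
    (∀ a < G.numMen, s.arr 14 (c + a) ≤ s.arr 14 (d + a)) ↔ G.pSet M ⊆ G.pSet N := by
  rw [pSet_subset_iff hMs hNs, dominates_iff]
  constructor
  · intro h e he
    rcases hM e.1 with ⟨f, hf, hfe, -, hrf⟩ | ⟨h0, -⟩
    · rcases hN e.1 with ⟨g, hg, hge, -, hrg⟩ | ⟨h0, -⟩
      · have := h e.1 e.1.isLt
        obtain rfl := eq_of_fst hNs hg he hge
        exact ⟨f, hf, hfe, by omega⟩
      · exact absurd rfl (h0 e he)
    · obtain ⟨f, hf, hfe⟩ := exists_mem_fst hNs hMs he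
      exact absurd hfe (h0 f hf)
  · intro h a ha
    rcases hN ⟨a, ha⟩ with ⟨g, hg, hga, -, hrg⟩ | ⟨h0, -, hrg⟩
    · obtain ⟨f, hf, hfg, hle⟩ := h g hg
      rcases hM ⟨a, ha⟩ with ⟨f', hf', hfa, -, hrf⟩ | ⟨h0, -⟩
      · obtain rfl := eq_of_fst hMs hf' hf (hfa.trans (hga.symm.trans hfg.symm))
        simp only at hrf hrg
        omega
      · exact absurd (hfg.trans hga) (h0 f hf)
    · rcases hM ⟨a, ha⟩ with ⟨f, hf, hfa, -, -⟩ | ⟨-, -, hrf⟩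
      · obtain ⟨g, hg, hgf⟩ := exists_mem_fst hMs hNs hf
        exact absurd (hgf.trans hfa) (h0 g hg)
      · simp only at hrf
        omega

/-- Ranks alone identify a super-stable matching, by injectivity of `P`; partners need not be
compared. -/
theorem Row.eq_iff {c d : ℕ} {M N : Finset G.Pair} (hM : G.Row s c M) (hN : G.Row s d N)
    (hMs : M ∈ G.superStable) (hNs : N ∈ G.superStable) :
    (∀ a < G.numMen, s.arr 14 (c + a) = s.arr 14 (d + a)) ↔ M = N := by
  constructor
  · intro h
    exact pSet_injOn hMs hNs (((hM.le_iff hN hMs hNs).1 fun a ha => (h a ha).le).antisymm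
      ((hN.le_iff hM hNs hMs).1 fun a ha => (h a ha).ge))
  · rintro rfl a ha
    exact le_antisymm ((hM.le_iff hN hMs hMs).2 subset_rfl a ha)
      ((hN.le_iff hM hMs hMs).2 subset_rfl a ha)

theorem Row.congr {c : ℕ} {M : Finset G.Pair} (h : G.Row s c M)
    (h6 : ∀ a < G.numMen, s'.arr 6 (c + a) = s.arr 6 (c + a))
    (h14 : ∀ a < G.numMen, s'.arr 14 (c + a) = s.arr 14 (c + a)) : G.Row s' c M := by
  intro a
  rw [h6 a a.isLt, h14 a a.isLt]
  exact h a

/-- Stores the entry of the man `reg 6` in the row that starts at `reg 17`. -/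
def writeEntryProg : Prog :=
  .ite (.read 13 (.var 6))
    (.seq (.assign 10 (.sub (.read 13 (.var 6)) (.const 1)))
      (.seq (.write 6 (.add (.var 17) (.var 6)) (.add (.read 1 (.var 10)) (.const 1)))
        (.write 14 (.add (.var 17) (.var 6)) (.add (.read 2 (.var 10)) (.const 1)))))
    (.seq (.write 6 (.add (.var 17) (.var 6)) (.const 0))
      (.write 14 (.add (.var 17) (.var 6)) (.const 0)))

/-- Stores the matching given by array 13 as row number `reg 2`. -/
def rowProg : Prog :=
  .seq (.assign 17 (.mul (.var 2) (.var 0))) (.forUp 6 (.const 0) 0 writeEntryProg)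

theorem den_writeEntryProg (hw : G.Fits w) (hs : G.Holds s) {a : Fin G.numMen} {c : ℕ}
    (h6 : s.reg 6 = a) (h17 : s.reg 17 = c) (hc : c + a ≤ (G.nVerts + G.nEdges) ^ 2)
    {r : Fin G.numMen → ℕ} (hm : G.ManState r a (s.arr 13 a)) :
    ((∃ e ∈ G.selection (s.arr 13), e.1 = a ∧ (writeEntryProg.den w s).arr 6 (c + a) = e.2 + 1 ∧
        (writeEntryProg.den w s).arr 14 (c + a) = G.mRank e + 1) ∨
      ((∀ e ∈ G.selection (s.arr 13), e.1 ≠ a) ∧ (writeEntryProg.den w s).arr 6 (c + a) = 0 ∧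
        (writeEntryProg.den w s).arr 14 (c + a) = 0)) ∧
    ∀ i, i ≠ c + a → (writeEntryProg.den w s).arr 6 i = s.arr 6 i ∧
      (writeEntryProg.den w s).arr 14 i = s.arr 14 i := by
  have hn := numMen_le (G := G)
  have hn' := numWomen_le (G := G)
  have ha := a.isLt
  have h2 : (c + a) % 2 ^ w = c + a := hw.mod_sq hc
  rcases hm with ⟨h0, hno⟩ | ⟨p, e, hp, hea, hpe, hal⟩
  · refine ⟨Or.inr ⟨fun e he hea => ?_, ?_, ?_⟩, fun i hi => ⟨?_, ?_⟩⟩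
    · obtain ⟨p, hp, hpe⟩ := mem_selection.1 he
      rw [hea, h0] at hpe
      omega
    all_goals
      unfold writeEntryProg
      simp_all [Prog.den, Expr.eval]
  · obtain ⟨hwom, hrk, -, -⟩ := hs.edge p e hp
    have hplt := hp.lt
    have hb := e.2.isLt
    have hdeg := mRank_lt_deg hp.mem_edges
    have hdeg' := deg_le e.1
    have h1 : 1 % 2 ^ w = 1 := hw.mod (by omega)
    have h3 : (G.mRank e + 1) % 2 ^ w = G.mRank e + 1 := hw.mod (by omega)
    have h4 : ((e.2 : ℕ) + 1) % 2 ^ w = e.2 + 1 := hw.mod (by omega)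
    refine ⟨Or.inl ⟨e, mem_selection.2 ⟨p, hp, by rw [hea, hpe]⟩, hea, ?_, ?_⟩,
      fun i hi => ⟨?_, ?_⟩⟩
    all_goals
      unfold writeEntryProg
      simp [Prog.den, Expr.eval, h6, h17, hpe, h1, h2, h3, h4, hwom, hrk]
    all_goals simp [hi]

/-- The candidate is written provisionally just past the accepted rows, whether or not it is
super-stable; raising register 2 later accepts it. -/
theorem run_rowProg (hw : G.Fits w) (hE : 0 < G.nEdges) (hs : G.Holds s) {k : ℕ}
    (hk : s.reg 2 = k) (hkm : k < G.nEdges) {r : Fin G.numMen → ℕ}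
    (hm : ∀ a : Fin G.numMen, G.ManState r a (s.arr 13 a)) :
    Run w rowProg s (60 * G.nVerts) fun s' => s'.reg 17 = k * G.numMen ∧
      G.Row s' (k * G.numMen) (G.selection (s.arr 13)) ∧
      ∀ i < k * G.numMen, s'.arr 6 i = s.arr 6 i ∧ s'.arr 14 i = s.arr 14 i := by
  have hn := numMen_le (G := G)
  have hpos := nVerts_pos hE
  have hc : ∀ a < G.numMen, k * G.numMen + a ≤ (G.nVerts + G.nEdges) ^ 2 := by
    intro a ha
    have h1 : (k + 1) * G.numMen ≤ (G.nVerts + G.nEdges) * (G.nVerts + G.nEdges) :=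
      Nat.mul_le_mul (by omega) (by omega)
    rw [Nat.succ_mul] at h1
    rw [pow_two]
    omega
  refine Run.seq (T₁ := 4) (T₂ := 6 + G.numMen * 50)
    (R := fun s₁ => s₁ = s.setReg 17 (k * G.numMen)) (Run.of_loopFree rfl (by decide) ?_) ?_
    (by omega)
  · have := hw.mod_sq ((Nat.le_add_right _ _).trans (hc 0 hpos))
    simp [Prog.den, Expr.eval, hk, hs.reg0, this]
  rintro s₁ hf₁ rfl
  refine Run.imp (R := fun s' => G.Row s' (k * G.numMen) (G.selection (s.arr 13)) ∧
      ∀ i < k * G.numMen, s'.arr 6 i = s.arr 6 i ∧ s'.arr 14 i = s.arr 14 i)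
    (Run.forUp (fun j s' => (∀ a : Fin G.numMen, (a : ℕ) < j →
      (∃ e ∈ G.selection (s.arr 13), e.1 = a ∧ s'.arr 6 (k * G.numMen + a) = e.2 + 1 ∧
        s'.arr 14 (k * G.numMen + a) = G.mRank e + 1) ∨
      ((∀ e ∈ G.selection (s.arr 13), e.1 ≠ a) ∧ s'.arr 6 (k * G.numMen + a) = 0 ∧
        s'.arr 14 (k * G.numMen + a) = 0)) ∧
      ∀ i < k * G.numMen, s'.arr 6 i = s.arr 6 i ∧ s'.arr 14 i = s.arr 14 i) 0 G.numMen 42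
    (by simp [Expr.eval]) (by simp [hs.reg0]) (by decide) (by decide) (by decide) (Nat.zero_le _)
    (hw.lt (by omega)) ?_ ?_ ?_ ?_) le_rfl ?_
  · exact ⟨fun a ha => absurd ha (Nat.not_lt_zero _), by simp⟩
  · intro j s₂ _ hj hf₂ hx hI
    have hs₂ := (hs.of_frame hf₁ rfl).of_frame hf₂ rfl
    have e13 : s₂.arr 13 = s.arr 13 := by rw [hf₂.2 13 (by decide), hf₁.2 13 (by decide)]
    have h17 : s₂.reg 17 = k * G.numMen := by
      rw [hf₂.1 17 (by decide)]
      simp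
    obtain ⟨d1, d2⟩ := den_writeEntryProg hw hs₂ (a := ⟨j, hj⟩) hx h17 (hc j hj) (r := r)
      (by rw [e13]; exact hm _)
    rw [e13] at d1
    simp only at d1 d2
    refine Run.of_loopFree rfl (by decide) ⟨fun a ha => ?_, fun i hi => ?_⟩
    · simp only [State.setReg_arr]
      by_cases haj : (a : ℕ) = j
      · obtain rfl : a = ⟨j, hj⟩ := Fin.ext haj
        exact d1
      · rw [(d2 (k * G.numMen + a) (by omega)).1, (d2 (k * G.numMen + a) (by omega)).2]
        exact hI.1 a (by omega)
    · simp only [State.setReg_arr]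
      rw [(d2 i (by omega)).1, (d2 i (by omega)).2]
      exact hI.2 i hi
  · simp only [Expr.cost, Nat.sub_zero]
    omega
  · exact fun s₂ h => ⟨fun a => h.1 a a.isLt, h.2⟩
  · intro s₂ hf₂ h
    refine ⟨?_, h⟩
    rw [hf₂.1 17 (by decide)]
    simp

end SMInstance

/-! ### Enumeration without repetition, the order table, and the theorem -/

namespace SMInstance

variable {G : SMInstance} {w : ℕ} {s s' : State}

/-- There are at most `m` rows of length `numMen`, so addresses stay below the square of the size
and fit into a word. -/
theorem row_index_le {i a : ℕ} (hi : i < G.nEdges) (ha : a < G.numMen) :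
    i * G.numMen + a ≤ (G.nVerts + G.nEdges) ^ 2 := by
  have hn := numMen_le (G := G)
  have h1 : (i + 1) * G.numMen ≤ (G.nVerts + G.nEdges) * (G.nVerts + G.nEdges) :=
    Nat.mul_le_mul (by omega) (by omega)
  rw [Nat.succ_mul] at h1
  rw [pow_two]
  omega

/-- Compares the rank rows that start at `reg 18` and `reg 17`. -/
def testEqProg : Prog :=
  .ite (.eq (.read 14 (.add (.var 18) (.var 6))) (.read 14 (.add (.var 17) (.var 6)))) .skip
    (.assign 16 (.const 0))

/-- Clears register 13 if one of the rows before the row number `reg 2` is equal to it. -/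
def dedupProg : Prog :=
  .forUp 15 (.const 0) 2
    (.seq (.assign 16 (.const 1))
      (.seq (.assign 18 (.mul (.var 15) (.var 0)))
        (.seq (.forUp 6 (.const 0) 0 testEqProg) (.ite (.var 16) (.assign 13 (.const 0)) .skip))))

/-- Register 16 records equality with one earlier row, while register 13 is only ever cleared and
thus also preserves a failed covering test. -/
theorem run_dedupProg (hw : G.Fits w) (hE : 0 < G.nEdges) (hs : G.Holds s) {k : ℕ}
    (hk : s.reg 2 = k) (hkm : k < G.nEdges) (h17 : s.reg 17 = k * G.numMen) :
    Run w dedupProg s (100 * (G.nVerts * G.nEdges)) fun s' =>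
      IsFlag (∀ i < k, ¬ ∀ a < G.numMen, s.arr 14 (i * G.numMen + a) =
        s.arr 14 (k * G.numMen + a)) (s.reg 13) (s'.reg 13) := by
  have hn := numMen_le (G := G)
  have hpos := nVerts_pos hE
  have h1 : 1 % 2 ^ w = 1 := hw.mod (by omega)
  refine Run.forUp (fun i s' => IsFlag (∀ j < i, ¬ ∀ a < G.numMen, s.arr 14 (j * G.numMen + a) =
        s.arr 14 (k * G.numMen + a)) (s.reg 13) (s'.reg 13)) 0 k (2 + (4 + ((6 + G.numMen * 28) + 4)))
    (by simp [Expr.eval]) hk (by decide) (by decide) (by decide) (Nat.zero_le _)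
    (hw.lt (by omega)) (by simp [IsFlag]) ?_ ?_ fun _ h => h
  · intro i s₁ _ hi hf hx hI
    have e14 : s₁.arr 14 = s.arr 14 := hf.2 14 (by decide)
    have e17 : s₁.reg 17 = k * G.numMen := by rw [hf.1 17 (by decide), h17]
    have hs₁ := hs.of_frame hf rfl
    have hmod : i * G.numMen % 2 ^ w = i * G.numMen :=
      hw.mod_sq ((Nat.le_add_right _ _).trans (row_index_le (by omega) hpos))
    refine Run.seq (R := fun s₂ => s₂ = s₁.setReg 16 1) (Run.of_loopFree rfl (by decide) ?_)
      ?_ le_rfl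
    · simp [Prog.den, Expr.eval, h1]
    rintro s₂ hf₂ rfl
    refine Run.seq (R := fun s₂ => s₂ = (s₁.setReg 16 1).setReg 18 (i * G.numMen))
      (Run.of_loopFree rfl (by decide) ?_) ?_ le_rfl
    · simp [Prog.den, Expr.eval, hx, hs₁.reg0, hmod]
    rintro s₂ hf₃ rfl
    refine Run.seq (run_forUp_flag (z := 16) (B := 20) (fun a => s.arr 14 (i * G.numMen + a) =
      s.arr 14 (k * G.numMen + a)) (H := G.numMen) (by simp [hs₁.reg0]) (hw.lt (by omega)) rfl
      (by decide) (by decide) (by decide) (by decide) (by decide) ?_) ?_ le_rfl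
    · intro a s₃ ha hf₃ hx₃
      have k14 : s₃.arr 14 = s.arr 14 := by
        rw [hf₃.2 14 (by decide)]
        exact e14
      have k17 : s₃.reg 17 = k * G.numMen := by
        rw [hf₃.1 17 (by decide)]
        simpa using e17
      have k18 : s₃.reg 18 = i * G.numMen := by
        rw [hf₃.1 18 (by decide)]
        simp
      have m1 := hw.mod_sq (row_index_le (show i < G.nEdges by omega) ha)
      have m2 := hw.mod_sq (row_index_le hkm ha)
      constructor <;> intro h <;>
        simp [testEqProg, Prog.den, Expr.eval, k14, k17, k18, hx₃, m1, m2, h]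
    · intro s₃ hf₃ hflag
      have k13 : s₃.reg 13 = s₁.reg 13 := by
        rw [hf₃.1 13 (by decide)]
        simp
      refine Run.of_loopFree rfl (by decide) ?_
      have hden : (Prog.den w (.ite (.var 16) (.assign 13 (.const 0)) .skip) s₃).reg 13 =
          if s₃.reg 16 = 0 then s₁.reg 13 else 0 := by
        by_cases h : s₃.reg 16 = 0 <;> simp [Prog.den, Expr.eval, h, k13]
      rw [State.setReg_reg, if_neg (by decide), hden]
      simp only [State.setReg_reg] at hflag
      have hsucc : ∀ P : ℕ → Prop, (∀ j < i + 1, P j) ↔ P i ∧ ∀ j < i, P j := by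
        intro P
        constructor
        · exact fun h => ⟨h i (by omega), fun j hj => h j (by omega)⟩
        · rintro ⟨h1, h2⟩ j hj
          rcases Nat.lt_succ_iff_lt_or_eq.1 hj with hj | rfl
          · exact h2 j hj
          · exact h1
      refine IsFlag.congr ⟨fun h => ?_, fun h => ?_⟩ (hsucc _).symm
      · rw [if_pos (hflag.2 h.1), hI.1 h.2]
      · split_ifs with h0
        · refine hI.2 fun h2 => h ⟨fun hP => ?_, h2⟩
          rw [hflag.1 hP] at h0
          simp at h0
        · rfl
  · have e1 : k ≤ G.nEdges := hkm.le
    have e2 : k * G.nVerts ≤ G.nVerts * G.nEdges := by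
      rw [mul_comm]
      exact Nat.mul_le_mul_left _ e1
    have e3 : G.nEdges ≤ G.nVerts * G.nEdges := Nat.le_mul_of_pos_left _ (by omega)
    have e4 : k * G.numMen ≤ k * G.nVerts := Nat.mul_le_mul_left _ hn
    simp only [Expr.cost, Nat.sub_zero]
    have e5 : k * (2 + (4 + (6 + G.numMen * 28 + 4)) + 8) = 24 * k + 28 * (k * G.numMen) := by ring
    rw [e5]
    omega

/-- The iteration for the edge number `reg 4`. -/
def iterProg : Prog :=
  .seq searchProg (.seq coverProg (.seq rowProg (.seq dedupProg
    (.ite (.var 13) (.assign 2 (.add (.var 2) (.const 1))) .skip))))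

/-- The rows before the row number `reg 2` are the matchings with the least `P`-set containing some
edge with a number below `p`, each once. -/
def Listed (G : SMInstance) (p : ℕ) (s : State) : Prop :=
  s.reg 2 ≤ p ∧ ∃ L : ℕ → Finset G.Pair,
    (∀ i < s.reg 2, L i ∈ G.superStable ∧ G.Row s (i * G.numMen) (L i)) ∧
    (∀ i < s.reg 2, ∀ j < s.reg 2, L i = L j → i = j) ∧
    ∀ M, (∃ i < s.reg 2, L i = M) ↔ ∃ q < p, ∃ e, G.At q e ∧ G.IsLeastFor e M

theorem run_iterProg (hw : G.Fits w) (hE : 0 < G.nEdges) (hs : G.Holds s) {p : ℕ}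
    (hp : p < G.nEdges) (h4 : s.reg 4 = p) (hL : G.Listed p s) :
    Run w iterProg s (700 * (G.nVerts * G.nEdges)) fun s' => G.Listed (p + 1) s' := by
  obtain ⟨hkp, L, hL1, hL2, hL3⟩ := hL
  obtain ⟨e₀, he₀⟩ := exists_at hp
  set k := s.reg 2 with hk
  have hn := numMen_le (G := G)
  have hpos := nVerts_pos hE
  have h1 : G.nVerts ≤ G.nVerts * G.nEdges := Nat.le_mul_of_pos_right _ hE
  have hone : 1 % 2 ^ w = 1 := hw.mod (by omega)
  refine Run.seq (run_searchProg hw hE hs he₀ h4) (T₂ := 50 * G.nVerts + (60 * G.nVerts +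
    (100 * (G.nVerts * G.nEdges) + 6))) ?_ (by omega)
  rintro s₁ hf₁ ⟨hS, hfix, hm⟩
  have hs₁ := hs.of_frame hf₁ rfl
  obtain ⟨M, hM⟩ : ∃ M, G.selection (s₁.arr 13) = M := ⟨_, rfl⟩
  have hsel : G.IsSelection (G.ties s₁) M := hM ▸ isSelection_selection hm
  refine Run.seq (run_coverProg hw hE hs₁ hM hsel hS.woman) (fun s₂ hf₂ hcov => ?_) le_rfl
  have hs₂ := hs₁.of_frame hf₂ rfl
  have k2 : s₂.reg 2 = k := by rw [hf₂.1 2 (by decide), hf₁.1 2 (by decide)]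
  have k13 : s₂.arr 13 = s₁.arr 13 := hf₂.2 13 (by decide)
  refine Run.seq (run_rowProg hw hE hs₂ k2 (by omega) (r := G.ties s₁) (by rw [k13]; exact hm)) ?_
    le_rfl
  rintro s₃ hf₃ ⟨h17, hrow, hold⟩
  rw [k13, hM] at hrow
  have hs₃ := hs₂.of_frame hf₃ rfl
  have k2' : s₃.reg 2 = k := by rw [hf₃.1 2 (by decide), k2]
  refine Run.seq (run_dedupProg hw hE hs₃ k2' (by omega) h17) (fun s₄ hf₄ hdup => ?_) le_rfl
  have hs₄ := hs₃.of_frame hf₄ rfl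
  have k2'' : s₄.reg 2 = k := by rw [hf₄.1 2 (by decide), k2']
  have e6 : s₄.arr 6 = s₃.arr 6 := hf₄.2 6 (by decide)
  have e14 : s₄.arr 14 = s₃.arr 14 := hf₄.2 14 (by decide)
  have e13 : s₃.reg 13 = s₂.reg 13 := hf₃.1 13 (by decide)
  rw [e13] at hdup
  have hrows : ∀ i < k, G.Row s₃ (i * G.numMen) (L i) := by
    intro i hi
    have hlt : ∀ a < G.numMen, i * G.numMen + a < k * G.numMen := by
      intro a ha
      have := Nat.mul_le_mul_right G.numMen (Nat.succ_le_of_lt hi)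
      rw [Nat.succ_mul] at this
      omega
    refine (hL1 i hi).2.congr (fun a ha => ?_) fun a ha => ?_
    · rw [(hold _ (hlt a ha)).1, hf₂.2 6 (by decide), hf₁.2 6 (by decide)]
    · rw [(hold _ (hlt a ha)).2, hf₂.2 14 (by decide), hf₁.2 14 (by decide)]
  have he₀E := he₀.mem_edges
  have hstep : ∀ N, (∃ q < p + 1, ∃ e, G.At q e ∧ G.IsLeastFor e N) ↔
      (∃ q < p, ∃ e, G.At q e ∧ G.IsLeastFor e N) ∨ G.IsLeastFor e₀ N := by
    intro N
    constructor
    · rintro ⟨q, hq, e, he, hN⟩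
      rcases Nat.lt_succ_iff_lt_or_eq.1 hq with hq | rfl
      · exact Or.inl ⟨q, hq, e, he, hN⟩
      · rw [he.right_unique he₀] at hN
        exact Or.inr hN
    · rintro (⟨q, hq, e, he, hN⟩ | hN)
      · exact ⟨q, by omega, e, he, hN⟩
      · exact ⟨p, by omega, e₀, he₀, hN⟩
  -- The covering test decides existence: if any matching is least for `e₀`, the selection covers
  -- and is that matching.
  have hleast : ∀ N, G.IsLeastFor e₀ N ↔ G.Covers (G.ties s₁) M ∧ M = N := by
    intro N
    constructor
    · intro hN
      have hc := hsel.covers hS.lower hfix hN.1 hN.2.1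
      exact ⟨hc, (hsel.isLeastFor he₀E hS.lower hfix hc).unique hN⟩
    · rintro ⟨hc, rfl⟩
      exact hsel.isLeastFor he₀E hS.lower hfix hc
  have hnew : G.Covers (G.ties s₁) M → ((∀ i < k, ¬ ∀ a < G.numMen,
      s₃.arr 14 (i * G.numMen + a) = s₃.arr 14 (k * G.numMen + a)) ↔ ∀ i < k, L i ≠ M) := by
    intro hc
    refine forall₂_congr fun i hi => not_congr ?_
    exact (hrows i hi).eq_iff hrow (hL1 i hi).1 ((hleast M).2 ⟨hc, rfl⟩).1
  have h13 : s₄.reg 13 ≠ 0 ↔ G.Covers (G.ties s₁) M ∧ ∀ i < k, L i ≠ M := by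
    by_cases hc : G.Covers (G.ties s₁) M
    · rw [hnew hc, hcov.1 hc] at hdup
      by_cases hd : ∀ i < k, L i ≠ M
      · exact iff_of_true (by rw [hdup.1 hd]; exact one_ne_zero) ⟨hc, hd⟩
      · simp only [hdup.2 hd, hd, and_false, ne_eq, not_true_eq_false]
    · rw [hcov.2 hc] at hdup
      -- The flag entered the duplicate test with value `0`, so both outcomes of that test leave
      -- `0`.
      have : s₄.reg 13 = 0 := (em _).elim hdup.1 hdup.2
      simp [this, hc]
  refine Run.of_loopFree rfl (by decide) ?_
  by_cases hadd : s₄.reg 13 = 0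
  · have hden : Prog.den w (.ite (.var 13) (.assign 2 (.add (.var 2) (.const 1))) .skip) s₄ = s₄ := by
      simp [Prog.den, Expr.eval, hadd]
    rw [hden, Listed, k2'']
    refine ⟨by omega, L, fun i hi => ⟨(hL1 i hi).1, (hrows i hi).congr (fun a _ => by rw [e6])
      fun a _ => by rw [e14]⟩, hL2, fun N => ?_⟩
    rw [hstep, ← hL3, hleast, iff_self_or]
    rintro ⟨hc, rfl⟩
    -- When the counter stays put, either nothing is least for `e₀` or the least matching is already
    -- listed.
    by_contra! hcon
    exact h13.2 ⟨hc, hcon⟩ hadd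
  · obtain ⟨hc, hne⟩ := h13.1 hadd
    have hmod : (k + 1) % 2 ^ w = k + 1 := hw.mod (by omega)
    have hden : Prog.den w (.ite (.var 13) (.assign 2 (.add (.var 2) (.const 1))) .skip) s₄ =
        s₄.setReg 2 (k + 1) := by
      simp [Prog.den, Expr.eval, hadd, hone, k2'', hmod]
    have hk2 : (s₄.setReg 2 (k + 1)).reg 2 = k + 1 := by simp
    rw [hden, Listed, hk2]
    have hLlt : ∀ i < k, Function.update L k M i = L i := fun i hi =>
      Function.update_of_ne hi.ne _ _
    have hLk : Function.update L k M k = M := Function.update_self _ _ _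
    refine ⟨by omega, Function.update L k M, fun i hi => ?_, fun i hi j hj hij => ?_, fun N => ?_⟩
    · rcases Nat.lt_succ_iff_lt_or_eq.1 hi with hi | rfl
      · rw [hLlt i hi]
        exact ⟨(hL1 i hi).1, (hrows i hi).congr (fun a _ => by rw [State.setReg_arr, e6])
          fun a _ => by rw [State.setReg_arr, e14]⟩
      · rw [hLk]
        exact ⟨((hleast M).2 ⟨hc, rfl⟩).1, hrow.congr (fun a _ => by rw [State.setReg_arr, e6])
          fun a _ => by rw [State.setReg_arr, e14]⟩
    · rcases Nat.lt_succ_iff_lt_or_eq.1 hi with hi | rfl <;>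
        rcases Nat.lt_succ_iff_lt_or_eq.1 hj with hj | rfl
      · rw [hLlt i hi, hLlt j hj] at hij
        exact hL2 i hi j hj hij
      · rw [hLlt i hi, hLk] at hij
        exact absurd hij (hne i hi)
      · rw [hLlt j hj, hLk] at hij
        exact absurd hij.symm (hne j hj)
      · rfl
    · rw [hstep, ← hL3, hleast]
      constructor
      · rintro ⟨i, hi, rfl⟩
        rcases Nat.lt_succ_iff_lt_or_eq.1 hi with hi | rfl
        · exact Or.inl ⟨i, hi, (hLlt i hi).symm⟩
        · exact Or.inr ⟨hc, hLk.symm⟩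
      · rintro (⟨i, hi, rfl⟩ | ⟨-, rfl⟩)
        · exact ⟨i, by omega, hLlt i hi⟩
        · exact ⟨k, by omega, hLk⟩

/-- Clears register 13 if the man `reg 6` has a larger rank in the row that starts at `reg 17` than
in the row that starts at `reg 18`. -/
def testLeProg : Prog :=
  .ite (.lt (.read 14 (.add (.var 18) (.var 6))) (.read 14 (.add (.var 17) (.var 6))))
    (.assign 13 (.const 0)) .skip

/-- Writes the entry in row `reg 15` and column `reg 16` of the table. -/
def entryProg : Prog :=
  .seq (.assign 18 (.mul (.var 16) (.var 0)))
    (.seq (.assign 13 (.const 1))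
      (.seq (.forUp 6 (.const 0) 0 testLeProg)
        (.write 7 (.add (.var 19) (.var 16)) (.var 13))))

/-- Writes the table of the order relation between the rows. -/
def tableProg : Prog :=
  .forUp 15 (.const 0) 2
    (.seq (.assign 17 (.mul (.var 15) (.var 0)))
      (.seq (.assign 19 (.mul (.var 15) (.var 2))) (.forUp 16 (.const 0) 2 entryProg)))

theorem run_entryProg (hw : G.Fits w) (hE : 0 < G.nEdges) (hs : G.Holds s) {i j k : ℕ}
    (hk : k ≤ G.nEdges) (hi : i < k) (hj : j < k) (h16 : s.reg 16 = j)
    (h17 : s.reg 17 = i * G.numMen) (h19 : s.reg 19 = i * k) :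
    Run w entryProg s (50 * G.nVerts) fun s' =>
      IsFlag (∀ a < G.numMen, s.arr 14 (i * G.numMen + a) ≤ s.arr 14 (j * G.numMen + a)) 1
        (s'.arr 7 (i * k + j)) ∧ ∀ c, c ≠ i * k + j → s'.arr 7 c = s.arr 7 c := by
  have hn := numMen_le (G := G)
  have hpos := nVerts_pos hE
  have hsum : G.nVerts = G.numMen + G.numWomen := rfl
  have hone : 1 % 2 ^ w = 1 := hw.mod (by omega)
  have hmod : j * G.numMen % 2 ^ w = j * G.numMen :=
    hw.mod_sq ((Nat.le_add_right _ _).trans (row_index_le (by omega) hpos))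
  have hmod' : (i * k + j) % 2 ^ w = i * k + j := by
    have h1 : (i + 1) * k ≤ (G.nVerts + G.nEdges) * (G.nVerts + G.nEdges) :=
      Nat.mul_le_mul (by omega) (by omega)
    rw [Nat.succ_mul] at h1
    refine hw.mod_sq ?_
    rw [pow_two]
    omega
  have hnW : 0 < G.numWomen := by
    obtain ⟨e, -⟩ := exists_at hE
    exact e.2.pos
  refine Run.seq (T₁ := 4) (T₂ := 2 + ((6 + G.numMen * 28) + 5))
    (R := fun s₁ => s₁ = s.setReg 18 (j * G.numMen)) (Run.of_loopFree rfl (by decide) ?_) ?_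
    (by omega)
  · simp [Prog.den, Expr.eval, h16, hs.reg0, hmod]
  rintro s₁ - rfl
  refine Run.seq (R := fun s₁ => s₁ = (s.setReg 18 (j * G.numMen)).setReg 13 1)
    (Run.of_loopFree rfl (by decide) ?_) ?_ le_rfl
  · simp [Prog.den, Expr.eval, hone]
  rintro s₁ - rfl
  refine Run.seq (run_forUp_flag (z := 13) (B := 20) (fun a => s.arr 14 (i * G.numMen + a) ≤
    s.arr 14 (j * G.numMen + a)) (H := G.numMen) (by simp [hs.reg0]) (hw.lt (by omega)) rfl
    (by decide) (by decide) (by decide) (by decide) (by decide) ?_) ?_ le_rfl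
  · intro a s₂ ha hf₂ hx
    have k14 : s₂.arr 14 = s.arr 14 := by
      rw [hf₂.2 14 (by decide)]
      rfl
    have k17 : s₂.reg 17 = i * G.numMen := by
      rw [hf₂.1 17 (by decide)]
      simpa using h17
    have k18 : s₂.reg 18 = j * G.numMen := by
      rw [hf₂.1 18 (by decide)]
      simp
    have m1 := hw.mod_sq (row_index_le (show i < G.nEdges by omega) ha)
    have m2 := hw.mod_sq (row_index_le (show j < G.nEdges by omega) ha)
    constructor <;> intro h
    · simp [testLeProg, Prog.den, Expr.eval, k14, k17, k18, hx, m1, m2, h]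
    · simp [testLeProg, Prog.den, Expr.eval, k14, k17, k18, hx, m1, m2, not_le.1 h]
  · intro s₂ hf₂ hflag
    have k7 : s₂.arr 7 = s.arr 7 := by
      rw [hf₂.2 7 (by decide)]
      rfl
    have k16 : s₂.reg 16 = j := by
      rw [hf₂.1 16 (by decide)]
      simpa using h16
    have k19 : s₂.reg 19 = i * k := by
      rw [hf₂.1 19 (by decide)]
      simpa using h19
    refine Run.of_loopFree rfl (by decide) ⟨?_, fun c hc => ?_⟩
    · simpa [Prog.den, Expr.eval, k16, k19, hmod'] using hflag
    · simp [Prog.den, Expr.eval, k16, k19, hmod', hc, k7]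

theorem run_tableProg (hw : G.Fits w) (hE : 0 < G.nEdges) (hs : G.Holds s) {k : ℕ}
    (hk : s.reg 2 = k) (hkm : k ≤ G.nEdges) :
    Run w tableProg s (100 * (G.nVerts * G.nEdges ^ 2)) fun s' =>
      ∀ i < k, ∀ j < k, IsFlag (∀ a < G.numMen, s.arr 14 (i * G.numMen + a) ≤
        s.arr 14 (j * G.numMen + a)) 1 (s'.arr 7 (i * k + j)) := by
  have hn := numMen_le (G := G)
  have hpos := nVerts_pos hE
  refine Run.forUp (fun i s' => ∀ i' < i, ∀ j < k, IsFlag (∀ a < G.numMen,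
      s.arr 14 (i' * G.numMen + a) ≤ s.arr 14 (j * G.numMen + a)) 1 (s'.arr 7 (i' * k + j))) 0 k
    (4 + (4 + (6 + k * (50 * G.nVerts + 8)))) (by simp [Expr.eval]) hk (by decide) (by decide)
    (by decide) (Nat.zero_le _) (hw.lt (by omega)) (fun i hi => absurd hi (Nat.not_lt_zero _))
    ?_ ?_ fun _ h => h
  · intro i s₁ _ hi hf₁ hx hI
    have e14 : s₁.arr 14 = s.arr 14 := hf₁.2 14 (by decide)
    have e2 : s₁.reg 2 = k := by rw [hf₁.1 2 (by decide), hk]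
    have hs₁ := hs.of_frame hf₁ rfl
    have hmod : i * G.numMen % 2 ^ w = i * G.numMen :=
      hw.mod_sq ((Nat.le_add_right _ _).trans (row_index_le (by omega) hpos))
    have hmod' : i * k % 2 ^ w = i * k := by
      refine hw.mod_sq ?_
      rw [pow_two]
      exact Nat.mul_le_mul (by omega) (by omega)
    refine Run.seq (R := fun s₂ => s₂ = s₁.setReg 17 (i * G.numMen))
      (Run.of_loopFree rfl (by decide) ?_) ?_ le_rfl
    · simp [Prog.den, Expr.eval, hx, hs₁.reg0, hmod]
    rintro s₂ hf₂ rfl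
    refine Run.seq (R := fun s₂ => s₂ = (s₁.setReg 17 (i * G.numMen)).setReg 19 (i * k))
      (Run.of_loopFree rfl (by decide) ?_) ?_ le_rfl
    · simp [Prog.den, Expr.eval, hx, e2, hmod']
    rintro s₂ hf₃ rfl
    refine Run.forUp (fun j s' => (∀ i' < i, ∀ j < k, IsFlag (∀ a < G.numMen,
        s.arr 14 (i' * G.numMen + a) ≤ s.arr 14 (j * G.numMen + a)) 1 (s'.arr 7 (i' * k + j))) ∧
      ∀ j' < j, IsFlag (∀ a < G.numMen, s.arr 14 (i * G.numMen + a) ≤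
        s.arr 14 (j' * G.numMen + a)) 1 (s'.arr 7 (i * k + j'))) 0 k (50 * G.nVerts)
      (by simp [Expr.eval]) (by simp [e2]) (by decide) (by decide) (by decide) (Nat.zero_le _)
      (hw.lt (by omega)) ⟨hI, fun j hj => absurd hj (Nat.not_lt_zero _)⟩ ?_ ?_ ?_
    · intro j s₃ _ hj hf₄ hx₄ hI₄
      have hs₃ := ((hs₁.of_frame hf₂ rfl).of_frame hf₃ rfl).of_frame hf₄ rfl
      have k14 : s₃.arr 14 = s.arr 14 := by
        rw [hf₄.2 14 (by decide)]
        exact e14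
      refine (run_entryProg hw hE hs₃ hkm hi hj hx₄ ?_ ?_).imp le_rfl ?_
      · rw [hf₄.1 17 (by decide)]
        simp
      · rw [hf₄.1 19 (by decide)]
        simp
      rintro s₄ - ⟨hflag, hold⟩
      rw [k14] at hflag
      rw [State.setReg_arr]
      refine ⟨fun i' hi' j' hj' => ?_, fun j' hj' => ?_⟩
      · rw [hold]
        · exact hI₄.1 i' hi' j' hj'
        · have := Nat.mul_le_mul_right k (Nat.succ_le_of_lt hi')
          rw [Nat.succ_mul] at this
          omega
      · rcases Nat.lt_succ_iff_lt_or_eq.1 hj' with hj' | rfl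
        · rw [hold _ (by omega)]
          exact hI₄.2 j' hj'
        · exact hflag
    · simp only [Expr.cost, Nat.sub_zero]
      omega
    · intro s₃ h i' hi' j hj
      rw [State.setReg_arr]
      rcases Nat.lt_succ_iff_lt_or_eq.1 hi' with hi' | rfl
      · exact h.1 i' hi' j hj
      · exact h.2 j hj
  · simp only [Expr.cost, Nat.sub_zero]
    have e1 : k * (4 + (4 + (6 + k * (50 * G.nVerts + 8))) + 8) =
        22 * k + 8 * k ^ 2 + 50 * (G.nVerts * k ^ 2) := by ring
    have e2 : k ^ 2 ≤ G.nEdges ^ 2 := Nat.pow_le_pow_left hkm 2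
    have e3 : G.nVerts * k ^ 2 ≤ G.nVerts * G.nEdges ^ 2 := Nat.mul_le_mul_left _ e2
    have e4 : G.nEdges ^ 2 ≤ G.nVerts * G.nEdges ^ 2 := Nat.le_mul_of_pos_left _ (by omega)
    have e5 : G.nEdges ≤ G.nEdges ^ 2 := Nat.le_self_pow two_ne_zero _
    rw [e1]
    omega

/-- Constructs the poset of irreducible super-stable matchings. -/
def posetProg : Prog := .seq setupProg (.seq (.forUp 4 (.const 0) 3 iterProg) tableProg)

/-- The term `700 nm²` comes from the `m` searches and `100 nm²` from the table; since `n, m ≥ 1`,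
the setup and the lower-order terms fit into the remainder. -/
theorem run_posetProg (hw : G.Fits w) (hE : 0 < G.nEdges) :
    Run w posetProg G.input (1100 * (G.nVerts * G.nEdges ^ 2)) G.OutputsPoset := by
  have hn := numMen_le (G := G)
  have hpos := nVerts_pos hE
  refine Run.seq (run_setupProg hw hE) (T₂ := (6 + G.nEdges * (700 * (G.nVerts * G.nEdges) + 8)) +
    100 * (G.nVerts * G.nEdges ^ 2)) ?_ ?_
  swap
  · have e1 : G.nEdges * (700 * (G.nVerts * G.nEdges) + 8) =
        700 * (G.nVerts * G.nEdges ^ 2) + 8 * G.nEdges := by ring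
    have e2 : G.nEdges ≤ G.nEdges ^ 2 := Nat.le_self_pow two_ne_zero _
    have e3 : G.nVerts * G.nEdges ≤ G.nVerts * G.nEdges ^ 2 := Nat.mul_le_mul_left _ e2
    have e4 : G.nEdges ≤ G.nVerts * G.nEdges := Nat.le_mul_of_pos_left _ (by omega)
    rw [e1]
    omega
  rintro s₁ hf₁ ⟨hs₁, h2⟩
  refine Run.seq (Run.forUp (fun p s' => G.Listed p s') 0 G.nEdges (700 * (G.nVerts * G.nEdges))
    (by simp [Expr.eval]) hs₁.reg3 (by decide) (by decide) (by decide) (Nat.zero_le _)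
    (hw.lt (by omega)) ?_ ?_ ?_ fun _ h => h) (fun s₂ hf₂ hL => ?_) le_rfl
  · refine ⟨by simp [h2], fun _ => ∅, ?_, ?_, ?_⟩ <;> simp [h2]
  · intro p s₂ _ hp hf₂ hx hL
    refine (run_iterProg hw hE (hs₁.of_frame hf₂ rfl) hp hx hL).imp le_rfl fun s₃ _ h => ?_
    have hk : (s₃.setReg 4 (p + 1)).reg 2 = s₃.reg 2 := by simp
    rw [Listed, hk]
    exact h
  · simp only [Expr.cost, Nat.sub_zero]
    omega
  have hs₂ := hs₁.of_frame hf₂ rfl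
  obtain ⟨hk, L, hL1, hL2, hL3⟩ := hL
  refine (run_tableProg hw hE hs₂ rfl hk).imp le_rfl fun s₃ hf₃ htab => ?_
  have k2 : s₃.reg 2 = s₂.reg 2 := hf₃.1 2 (by decide)
  have k6 : s₃.arr 6 = s₂.arr 6 := hf₃.2 6 (by decide)
  refine ⟨s₂.reg 2, fun i => L i, fun i j hij => Fin.ext (hL2 i i.isLt j j.isLt hij), ?_, k2,
    ?_, ?_⟩
  · ext M
    rw [mem_irreducibles, Set.mem_range]
    constructor
    · rintro ⟨i, rfl⟩
      obtain ⟨q, -, e, -, h⟩ := (hL3 (L i)).1 ⟨i, i.isLt, rfl⟩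
      exact ⟨e, h⟩
    · rintro ⟨e, h⟩
      obtain ⟨q, hq⟩ := exists_at_of_mem (mem_pSet.1 h.2.1).1
      obtain ⟨i, hi, rfl⟩ := (hL3 M).2 ⟨q, hq.lt, e, hq, h⟩
      exact ⟨⟨i, hi⟩, rfl⟩
  · intro i a
    obtain ⟨hS, hrow⟩ := hL1 i i.isLt
    rw [k6]
    rcases hrow a with ⟨e, he, rfl, h6, -⟩ | ⟨hno, h6, -⟩
    · refine ⟨fun b hb => ?_, fun h => absurd he (h e.2)⟩
      rw [h6, ← eq_of_fst hS hb he rfl]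
    · exact ⟨fun b hb => absurd rfl (hno _ hb), fun _ => h6⟩
  · intro i j
    obtain ⟨hSi, hri⟩ := hL1 i i.isLt
    obtain ⟨hSj, hrj⟩ := hL1 j j.isLt
    have := htab i i.isLt j j.isLt
    exact this.congr (hri.le_iff hrj hSi hSj)

/-- Addresses need a strict bound on the square; as `n + m ≥ 2`, the cube exceeds the square and
supplies it. -/
theorem fits_of_pow_le (hE : 0 < G.nEdges) (h : (G.nVerts + G.nEdges) ^ 3 ≤ 2 ^ w) : G.Fits w := by
  have hpos := nVerts_pos hE
  have hn := numMen_le (G := G)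
  exact (Nat.pow_lt_pow_right (by omega) (by omega)).trans_le h

end SMInstance

theorem mainTheorem9 :
    -- The poset can be constructed in time `O(n m ^ 2)` on a word RAM with words of `O(log (n + m))`
    -- bits.
    (∃ (p : WordRAM.Prog) (C c : ℕ), ∀ G : SMInstance, 0 < G.nEdges →
      ∀ w : ℕ, (G.nVerts + G.nEdges) ^ c ≤ 2 ^ w →
        ∃ (t : ℕ) (s : WordRAM.State),
          WordRAM.Exec w p G.input t s ∧
          t ≤ C * (G.nVerts * G.nEdges ^ 2) ∧
          G.OutputsPoset s) ∧
    (∀ G : SMInstance, 0 < G.nEdges →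
      -- The irreducible super-stable matchings are the man-optimal super-stable `e`-matchings, and
      -- there is exactly one of these for each edge `e` that lies in a super-stable matching.
      (∀ M : Finset G.Pair,
        M ∈ G.irreducibles ↔ ∃ e ∈ G.edges, G.IsManOptimalWith e M) ∧
      (∀ e ∈ G.edges, (∃ M ∈ G.superStable, e ∈ M) →
        ∃! M : Finset G.Pair, G.IsManOptimalWith e M) ∧
      -- Super-stable matchings correspond to their `P`-sets, inclusion being dominance.
      Set.InjOn G.pSet G.superStable ∧
      (∀ M ∈ G.superStable, ∀ N ∈ G.superStable,
        (G.pSet M ⊆ G.pSet N ↔ G.Dominates M N)) ∧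
      -- The nonempty closed subsets of the poset correspond to the super-stable matchings.
      Set.BijOn G.generated {S | G.IsClosedSubset S ∧ S.Nonempty} (G.pSet '' G.superStable) ∧
      (∀ S S' : Set (Finset G.Pair),
        G.IsClosedSubset S → S.Nonempty → G.IsClosedSubset S' → S'.Nonempty →
          (G.generated S ⊆ G.generated S' ↔ S ⊆ S'))) := by
  refine ⟨⟨SMInstance.posetProg, 1100, 3, fun G hE w hw => ?_⟩, fun G hE =>
    ⟨fun M => SMInstance.mem_irreducibles_iff_isManOptimalWith hE,
      fun e _ ⟨M, hM, he⟩ => SMInstance.existsUnique_isManOptimalWith hM he,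
      SMInstance.pSet_injOn, fun M hM N hN => SMInstance.pSet_subset_iff hM hN,
      SMInstance.bijOn_generated hE, fun S S' hS _ hS' _ => SMInstance.generated_subset_iff hS hS'⟩⟩
  obtain ⟨t, s, h⟩ := SMInstance.run_posetProg (SMInstance.fits_of_pow_le hE hw) hE
  exact ⟨t, s, h⟩
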